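/- Let $\Gamma$ be the star graph consisting of three half-lines $\gamma_1,\gamma_2,\gamma_3$ with common endpoint $a$, each parametrized by the distance $x\ge 0$ to $a$; let $\Omega$ be the part of $\Gamma$ with $x\le 1$, and $a_n$ the point of $\gamma_n$ at distance $1$ from $a$. Derivatives at $a$ are taken in the direction away from $a$. A function $f$ satisfies the Kirchhoff conditions at $a$ if it is continuous at $a$ and $\sum_{n=1}^3 f_{\gamma_n}'(a)=0$. Let $\alpha\in\mathbb R$, and let $Q$ be a real-valued function on $\Gamma$ that is $C^\infty$ on each closed edge (up to $a$), with $\operatorname{supp}Q=\Omega$ and $\int_\Omega Q=0$. For $\varepsilon>0$ let $$H_\varepsilon(\alpha,Q)=-\frac{d^2}{dx^2}+\alpha\varepsilon^{-2}Q(x/\varepsilon)\quad\text{in } L_2(\Gamma),$$ with domain the set of $f\in W_2^2(\Gamma)$ (that is, $f_{\gamma_n}\in W^2_2(\gamma_n)$ for every $n$) that satisfy the Kirchhoff conditions at $a$. Let $N$ be the real vector space of the real solutions $u$ on $\Omega$ of $-u''+\alpha Qu=0$ that satisfy the Kirchhoff conditions at $a$ and $u'(a_1)=u'(a_2)=u'(a_3)=0$.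 Then $\dim N\le 2$. Let $H(\alpha,Q)f=-f''$ on the set of $f\in W_2^2(\Gamma)$ that satisfy the following conditions at $a$: * if $N=\{0\}$ (non-resonant case): $f_{\gamma_1}(a)=f_{\gamma_2}(a)=f_{\gamma_3}(a)=0$; * if $\dim N=1$ (simple resonant case), $N$ is spanned by $\varphi$ and $\theta_n=\varphi(a_n)$: the vector $(f_{\gamma_n}(a))_{n=1}^3$ is proportional to $\theta=(\theta_1,\theta_2,\theta_3)$ and $\sum_{n=1}^3\theta_n f_{\gamma_n}'(a)=0$; * if $\dim N=2$ (double resonant case), $\varphi,\psi$ is a basis of $N$ and $\theta=(\varphi(a_n))_{n=1}^3\times(\psi(a_n))_{n=1}^3$ (vector product): the vector $(f_{\gamma_n}'(a))_{n=1}^3$ is proportional to $\theta$ and $\sum_{n=1}^3\theta_n f_{\gamma_n}(a)=0$. The operator $H(\alpha,Q)$ does not depend on the choice of $\varphi$ or of the basis $\varphi,\psi$. Then, as $\varepsilon\to0^+$, the self-adjoint operators $H_\varepsilon(\alpha,Q)$ converge in the norm resolvent sense to the self-adjoint operator $H(\alpha,Q)$. Moreover, for every $\zeta\in\mathbb C\setminus\mathbb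 R$ there is a constant $C$ (depending on $\zeta,\alpha,Q$ only) such that for all $\varepsilon\in(0,1)$ $$\bigl\|(H_\varepsilon(\alpha,Q)-\zeta)^{-1}-(H(\alpha,Q)-\zeta)^{-1}\bigr\|_{B(L_2(\Gamma))}\le C\varepsilon^{1/2}.$$ -/

import Mathlib

open MeasureTheory Set Filter Topology
open scoped ContDiff

noncomputable section

namespace StarGraph

/-! The star graph `Γ` has three half-lines `γ₀, γ₁, γ₂` glued at their endpoint `a`. A function on
`Γ` is a family, indexed by `n : Fin 3`, of functions of the distance `x ≥ 0` to `a` along `γ n`.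
Only the values at `x ≥ 0` matter. Derivatives with respect to `x` at `0` point away from `a`. -/

/-- Lebesgue measure on an edge. -/
abbrev edgeMeasure : Measure ℝ := volume.restrict (Ioi (0 : ℝ))

/-- The complex Hilbert space `L₂(Γ)`, the orthogonal sum of three copies of `L₂(0, ∞)`. -/
abbrev L2 : Type := PiLp 2 (fun _ : Fin 3 => Lp ℂ 2 edgeMeasure)

/-- `u` is locally absolutely continuous on `[0, ∞)`, with almost everywhere derivative `v`. -/
structure HasACDeriv (u v : ℝ → ℂ) : Prop where
  integrable : ∀ x : ℝ, 0 ≤ x → IntervalIntegrable v volume 0 x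
  eq_integral : ∀ x : ℝ, 0 ≤ x → u x = u 0 + ∫ t in (0 : ℝ)..x, v t

/-- `u ∈ W₂²(0, ∞)`, with first derivative `v` and second derivative `w`; the functions `u` and `v`
are the continuous representatives, so `u 0` and `v 0` are the boundary values. -/
structure IsW22 (u v w : ℝ → ℂ) : Prop where
  memLp : MemLp u 2 edgeMeasure
  memLp_deriv : MemLp v 2 edgeMeasure
  memLp_deriv2 : MemLp w 2 edgeMeasure
  deriv : HasACDeriv u v
  deriv2 : HasACDeriv v w

/-- A linear condition on the pair (vertex values, outward derivatives at the vertex). -/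
abbrev VertexCondition : Type := Submodule ℂ ((Fin 3 → ℂ) × (Fin 3 → ℂ))

/-- Kirchhoff: continuity at the vertex and vanishing sum of the outward derivatives. -/
def kirchhoff : VertexCondition where
  carrier := {b | (∀ m n, b.1 m = b.1 n) ∧ ∑ n, b.2 n = 0}
  zero_mem' := by simp
  add_mem' := by
    rintro b c ⟨hb, hb'⟩ ⟨hc, hc'⟩
    refine ⟨fun m n => ?_, ?_⟩
    · simp only [Prod.fst_add, Pi.add_apply]; rw [hb m n, hc m n]
    · simp [Finset.sum_add_distrib, hb', hc']
  smul_mem' := by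
    rintro k b ⟨hb, hb'⟩
    refine ⟨fun m n => ?_, ?_⟩
    · simp only [Prod.smul_fst, Pi.smul_apply]; rw [hb m n]
    · simp only [Prod.smul_snd, Pi.smul_apply]; rw [← Finset.smul_sum, hb', smul_zero]

/-- Dirichlet: all vertex values vanish. -/
def dirichlet : VertexCondition where
  carrier := {b | ∀ n, b.1 n = 0}
  zero_mem' := by simp
  add_mem' := by
    intro b c hb hc n
    simp [hb n, hc n]
  smul_mem' := by
    intro k b hb n
    simp [hb n]

/-- `p` is proportional to `θ`: all `p n / θ n` are equal, where `p n = 0` if `θ n = 0`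
(for `θ ≠ 0`). -/
def Proportional (θ : Fin 3 → ℝ) (p : Fin 3 → ℂ) : Prop :=
  ∀ m n, (θ m : ℂ) * p n = (θ n : ℂ) * p m

theorem Proportional.add {θ : Fin 3 → ℝ} {p q : Fin 3 → ℂ} (hp : Proportional θ p)
    (hq : Proportional θ q) : Proportional θ (p + q) := by
  intro m n
  simp only [Pi.add_apply]
  linear_combination hp m n + hq m n

theorem Proportional.smul {θ : Fin 3 → ℝ} {p : Fin 3 → ℂ} (k : ℂ) (hp : Proportional θ p) :
    Proportional θ (k • p) := by
  intro m n
  simp only [Pi.smul_apply, smul_eq_mul]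
  linear_combination k * hp m n

/-- Simple resonance: vertex values proportional to `θ`, and `∑ θ n * f' n = 0`. -/
def simpleCondition (θ : Fin 3 → ℝ) : VertexCondition where
  carrier := {b | Proportional θ b.1 ∧ ∑ n, (θ n : ℂ) * b.2 n = 0}
  zero_mem' := by simp [Proportional]
  add_mem' := by
    rintro b c ⟨hb, hb'⟩ ⟨hc, hc'⟩
    exact ⟨hb.add hc, by simp [mul_add, Finset.sum_add_distrib, hb', hc']⟩
  smul_mem' := by
    rintro k b ⟨hb, hb'⟩
    refine ⟨hb.smul k, ?_⟩
    simp only [Prod.smul_snd, Pi.smul_apply, smul_eq_mul, mul_left_comm _ k]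
    rw [← Finset.mul_sum, hb', mul_zero]

/-- Double resonance: outward derivatives proportional to `θ`, and `∑ θ n * f n = 0`. -/
def doubleCondition (θ : Fin 3 → ℝ) : VertexCondition where
  carrier := {b | Proportional θ b.2 ∧ ∑ n, (θ n : ℂ) * b.1 n = 0}
  zero_mem' := by simp [Proportional]
  add_mem' := by
    rintro b c ⟨hb, hb'⟩ ⟨hc, hc'⟩
    exact ⟨hb.add hc, by simp [mul_add, Finset.sum_add_distrib, hb', hc']⟩
  smul_mem' := by
    rintro k b ⟨hb, hb'⟩
    refine ⟨hb.smul k, ?_⟩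
    simp only [Prod.smul_fst, Pi.smul_apply, smul_eq_mul, mul_left_comm _ k]
    rw [← Finset.mul_sum, hb', mul_zero]

theorem HasACDeriv.add {u v u' v' : ℝ → ℂ} (h : HasACDeriv u v) (h' : HasACDeriv u' v') :
    HasACDeriv (u + u') (v + v') := by
  refine ⟨fun x hx => (h.integrable x hx).add (h'.integrable x hx), fun x hx => ?_⟩
  simp only [Pi.add_apply]
  rw [intervalIntegral.integral_add (h.integrable x hx) (h'.integrable x hx),
    h.eq_integral x hx, h'.eq_integral x hx]
  ring

theorem HasACDeriv.smul {u v : ℝ → ℂ} (k : ℂ) (h : HasACDeriv u v) :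
    HasACDeriv (k • u) (k • v) := by
  refine ⟨fun x hx => (h.integrable x hx).smul k, fun x hx => ?_⟩
  simp only [Pi.smul_apply]
  rw [intervalIntegral.integral_smul, h.eq_integral x hx, smul_add]

theorem IsW22.add {u v w u' v' w' : ℝ → ℂ} (h : IsW22 u v w) (h' : IsW22 u' v' w') :
    IsW22 (u + u') (v + v') (w + w') :=
  ⟨h.memLp.add h'.memLp, h.memLp_deriv.add h'.memLp_deriv, h.memLp_deriv2.add h'.memLp_deriv2,
    h.deriv.add h'.deriv, h.deriv2.add h'.deriv2⟩

theorem IsW22.smul {u v w : ℝ → ℂ} (k : ℂ) (h : IsW22 u v w) :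
    IsW22 (k • u) (k • v) (k • w) :=
  ⟨h.memLp.const_smul k, h.memLp_deriv.const_smul k, h.memLp_deriv2.const_smul k,
    h.deriv.smul k, h.deriv2.smul k⟩

/-- The graph of `f ↦ -f'' + V f` on the functions in `W₂²(Γ)` that satisfy the vertex condition
`B` (and have `V f` square-integrable, which is automatic for bounded `V`). -/
def schrodingerGraph (V : Fin 3 → ℝ → ℝ) (B : VertexCondition) : Submodule ℂ (L2 × L2) where
  carrier := {p | ∃ u v w : Fin 3 → ℝ → ℂ,
    (∀ n, IsW22 (u n) (v n) (w n)) ∧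
    ((fun n => u n 0, fun n => v n 0) : (Fin 3 → ℂ) × (Fin 3 → ℂ)) ∈ B ∧
    (∀ n, p.1 n =ᵐ[edgeMeasure] u n) ∧
    (∀ n, p.2 n =ᵐ[edgeMeasure] fun x => -w n x + (V n x : ℂ) * u n x)}
  zero_mem' := by
    refine ⟨0, 0, 0, fun n => ⟨MemLp.zero, MemLp.zero, MemLp.zero, ⟨?_, ?_⟩, ⟨?_, ?_⟩⟩,
      B.zero_mem, fun n => ?_, fun n => ?_⟩
    · intro x _; exact intervalIntegrable_const
    · intro x _; simp
    · intro x _; exact intervalIntegrable_const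
    · intro x _; simp
    · simpa using Lp.coeFn_zero ℂ 2 edgeMeasure
    · filter_upwards [Lp.coeFn_zero ℂ 2 edgeMeasure] with x hx
      simpa using hx
  add_mem' := by
    rintro p q ⟨u, v, w, h, hB, h1, h2⟩ ⟨u', v', w', h', hB', h1', h2'⟩
    refine ⟨u + u', v + v', w + w', fun n => (h n).add (h' n), B.add_mem hB hB',
      fun n => ?_, fun n => ?_⟩
    · filter_upwards [Lp.coeFn_add (p.1 n) (q.1 n), h1 n, h1' n] with x hx hx1 hx2
      simpa [hx1, hx2] using hx
    · filter_upwards [Lp.coeFn_add (p.2 n) (q.2 n), h2 n, h2' n] with x hx hx1 hx2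
      simp only [Pi.add_apply, hx1, hx2] at hx
      simp only [Prod.snd_add, PiLp.add_apply, hx, Pi.add_apply]
      ring
  smul_mem' := by
    rintro k p ⟨u, v, w, h, hB, h1, h2⟩
    refine ⟨k • u, k • v, k • w, fun n => (h n).smul k, B.smul_mem k hB,
      fun n => ?_, fun n => ?_⟩
    · filter_upwards [Lp.coeFn_smul k (p.1 n), h1 n] with x hx hx1
      simpa [hx1] using hx
    · filter_upwards [Lp.coeFn_smul k (p.2 n), h2 n] with x hx hx1
      simp only [Pi.smul_apply, hx1, smul_eq_mul] at hx
      simp only [Prod.smul_snd, PiLp.smul_apply, hx, Pi.smul_apply, smul_eq_mul]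
      ring

theorem HasACDeriv.continuousOn {u v : ℝ → ℂ} (h : HasACDeriv u v) :
    ContinuousOn u (Ici 0) := by
  have key : ∀ b : ℝ, 0 ≤ b → ContinuousOn u (Icc 0 b) := by
    intro b hb
    have h1 : ContinuousOn (fun x => ∫ t in (0 : ℝ)..x, v t) (Icc 0 b) := by
      have := intervalIntegral.continuousOn_primitive_interval' (h.integrable b hb)
        (left_mem_uIcc)
      rwa [uIcc_of_le hb] at this
    exact (continuousOn_const.add h1).congr fun x hx => h.eq_integral x hx.1
  intro x hx
  refine ((key (x + 1) (by have : (0 : ℝ) ≤ x := hx; linarith)) x ⟨hx, by linarith⟩).mono_of_mem_nhdsWithin ?_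
  rw [← Ici_inter_Iic]
  exact inter_mem self_mem_nhdsWithin (mem_nhdsWithin_of_mem_nhds (Iic_mem_nhds (by linarith)))

theorem HasACDeriv.ae_deriv_eq_zero {u v : ℝ → ℂ} (h : HasACDeriv u v)
    (hu : u =ᵐ[edgeMeasure] 0) : v =ᵐ[edgeMeasure] 0 ∧ u 0 = 0 := by
  have hu0 : EqOn u 0 (Ici 0) := by
    have h1 : EqOn u 0 (Ioi 0) :=
      Measure.eqOn_open_of_ae_eq hu isOpen_Ioi (h.continuousOn.mono Ioi_subset_Ici_self)
        continuousOn_const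
    refine h1.of_subset_closure h.continuousOn continuousOn_const Ioi_subset_Ici_self ?_
    rw [closure_Ioi]
  have hz : u 0 = 0 := hu0 (mem_Ici.2 le_rfl)
  refine ⟨?_, hz⟩
  have hint : ∀ x : ℝ, 0 ≤ x → ∫ t in (0 : ℝ)..x, v t = 0 := by
    intro x hx
    have := h.eq_integral x hx
    rw [hz, hu0 (mem_Ici.2 hx)] at this
    simpa using this.symm
  have hb : ∀ k : ℕ, ∀ᵐ x, x ∈ Ioo (0 : ℝ) k → v x = 0 := by
    intro k
    have hk : (0 : ℝ) ≤ k := k.cast_nonneg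
    filter_upwards [(h.integrable k hk).ae_hasDerivAt_integral] with x hx hxk
    have hd := hx (by rw [uIcc_of_le hk]; exact Ioo_subset_Icc_self hxk) 0
      (by rw [uIcc_of_le hk]; exact ⟨le_rfl, hk⟩)
    have hd' : HasDerivAt (fun b => ∫ t in (0 : ℝ)..b, v t) 0 x :=
      (hasDerivAt_const x (0 : ℂ)).congr_of_eventuallyEq (by
        filter_upwards [Ioi_mem_nhds hxk.1] with y hy
        exact hint y (le_of_lt hy))
    exact hd.unique hd'
  rw [EventuallyEq, ae_restrict_iff' measurableSet_Ioi]
  filter_upwards [ae_all_iff.2 hb] with x hx hx0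
  obtain ⟨k, hk⟩ := exists_nat_gt x
  exact hx k ⟨hx0, hk⟩

/-- `f ↦ -f'' + V f` is single-valued, so that `schrodingerGraph V B` is a graph. -/
theorem schrodingerGraph_single (V : Fin 3 → ℝ → ℝ) (B : VertexCondition) (p : L2 × L2)
    (hp : p ∈ schrodingerGraph V B) (h0 : p.1 = 0) : p.2 = 0 := by
  obtain ⟨u, v, w, h, -, h1, h2⟩ := hp
  refine PiLp.ext fun n => ?_
  refine Lp.ext ?_
  have hu : u n =ᵐ[edgeMeasure] 0 := by
    have e := h1 n
    rw [h0] at e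
    exact e.symm.trans (Lp.coeFn_zero ℂ 2 edgeMeasure)
  have hv := ((h n).deriv.ae_deriv_eq_zero hu).1
  have hw := ((h n).deriv2.ae_deriv_eq_zero hv).1
  filter_upwards [h2 n, hu, hw, Lp.coeFn_zero ℂ 2 edgeMeasure] with x e1 e2 e3 e4
  rw [e1, e2, e3]
  simpa using e4.symm

/-- The Schrödinger operator `-d²/dx² + V` in `L₂(Γ)` with the vertex condition `B`. -/
def schrodinger (V : Fin 3 → ℝ → ℝ) (B : VertexCondition) : L2 →ₗ.[ℂ] L2 :=
  (schrodingerGraph V B).toLinearPMap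

/-- The class `𝒬`: real functions on `Γ`, smooth up to the vertex along each closed edge, whose
support is the unit star `Ω`, and whose integral vanishes. -/
structure IsProfile (Q : Fin 3 → ℝ → ℝ) : Prop where
  smooth : ∀ n, ContDiffOn ℝ ∞ (Q n) (Ici 0)
  supp : ∀ n, closure {x : ℝ | 0 ≤ x ∧ Q n x ≠ 0} = Icc 0 1
  mean_zero : ∑ n, ∫ x in (0 : ℝ)..1, Q n x = 0

/-- `H_ε(α, Q) = -d²/dx² + α ε⁻² Q(x/ε)` with Kirchhoff conditions. -/
def regularized (α : ℝ) (Q : Fin 3 → ℝ → ℝ) (ε : ℝ) : L2 →ₗ.[ℂ] L2 :=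
  schrodinger (fun n x => α * (ε ^ 2)⁻¹ * Q n (x / ε)) kirchhoff

/-- `-u'' + α Q u = 0` on `Ω` with Kirchhoff conditions at the vertex and Neumann conditions at the
three points at distance one; `v` is the first derivative. -/
def IsHalfBound (α : ℝ) (Q : Fin 3 → ℝ → ℝ) (u : Fin 3 → ℝ → ℝ) : Prop :=
  ∃ v : Fin 3 → ℝ → ℝ,
    (∀ n, ∀ x ∈ Icc (0 : ℝ) 1, HasDerivWithinAt (u n) (v n x) (Icc 0 1) x) ∧
    (∀ n, ∀ x ∈ Icc (0 : ℝ) 1, HasDerivWithinAt (v n) (α * Q n x * u n x) (Icc 0 1) x) ∧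
    (∀ m n, u m 0 = u n 0) ∧ ∑ n, v n 0 = 0 ∧ ∀ n, v n 1 = 0

/-- The real vector space of solutions of the above problem, as functions on `Ω`. -/
def resonanceSpace (α : ℝ) (Q : Fin 3 → ℝ → ℝ) : Submodule ℝ (Fin 3 → Icc (0 : ℝ) 1 → ℝ) where
  carrier := {φ | IsHalfBound α Q (fun n => IccExtend zero_le_one (φ n))}
  zero_mem' := by
    have h0 : (fun n : Fin 3 => IccExtend (zero_le_one (α := ℝ))
        ((0 : Fin 3 → Icc (0 : ℝ) 1 → ℝ) n)) = fun _ _ => 0 := by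
      funext n x; simp [IccExtend]
    simp only [mem_ofPred_eq, h0]
    refine ⟨fun _ _ => 0, fun n x _ => ?_, fun n x _ => ?_, by simp, by simp, by simp⟩
    · exact hasDerivWithinAt_const _ _ _
    · simpa using hasDerivWithinAt_const x (Icc (0 : ℝ) 1) (0 : ℝ)
  add_mem' := by
    rintro φ ψ ⟨v, h1, h2, h3, h4, h5⟩ ⟨v', h1', h2', h3', h4', h5'⟩
    refine ⟨v + v', fun n x hx => (h1 n x hx).add (h1' n x hx), fun n x hx => ?_,
      fun m n => ?_, ?_, fun n => ?_⟩
    · refine ((h2 n x hx).add (h2' n x hx)).congr_deriv ?_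
      simp only [IccExtend, Function.comp_apply, Pi.add_apply]
      ring
    · have e1 := h3 m n
      have e2 := h3' m n
      simp only [IccExtend, Function.comp_apply, Pi.add_apply] at e1 e2 ⊢
      rw [e1, e2]
    · simp [Finset.sum_add_distrib, h4, h4']
    · simp [h5 n, h5' n]
  smul_mem' := by
    rintro k φ ⟨v, h1, h2, h3, h4, h5⟩
    refine ⟨k • v, fun n x hx => (h1 n x hx).const_smul k, fun n x hx => ?_,
      fun m n => ?_, ?_, fun n => ?_⟩
    · refine ((h2 n x hx).const_smul k).congr_deriv ?_
      simp only [IccExtend, Function.comp_apply, Pi.smul_apply, smul_eq_mul]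
      ring
    · have e1 := h3 m n
      simp only [IccExtend, Function.comp_apply, Pi.smul_apply] at e1 ⊢
      rw [e1]
    · simp only [Pi.smul_apply]; rw [← Finset.smul_sum, h4, smul_zero]
    · simp [h5 n]

/-- The values of a function on `Ω` at the three points at distance one from the vertex. -/
def endValues (φ : Fin 3 → Icc (0 : ℝ) 1 → ℝ) : Fin 3 → ℝ :=
  fun n => φ n ⟨1, zero_le_one, le_rfl⟩

/-- `H` is the operator `H(α, Q)`: the case is decided by the space of solutions, the coupling vector
is `(φ(a₁), φ(a₂), φ(a₃))` for an eigenfunction `φ` in the simple case, and the vector product of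
these vectors for a basis `φ, ψ` in the double case. -/
inductive IsLimitOperator (α : ℝ) (Q : Fin 3 → ℝ → ℝ) : (L2 →ₗ.[ℂ] L2) → Prop
  | nonresonant (h : resonanceSpace α Q = ⊥) :
      IsLimitOperator α Q (schrodinger (fun _ _ => 0) dirichlet)
  | simple (φ : Fin 3 → Icc (0 : ℝ) 1 → ℝ) (hφ : φ ≠ 0)
      (h : resonanceSpace α Q = Submodule.span ℝ {φ}) :
      IsLimitOperator α Q (schrodinger (fun _ _ => 0) (simpleCondition (endValues φ)))
  | double (φ ψ : Fin 3 → Icc (0 : ℝ) 1 → ℝ) (hφψ : LinearIndependent ℝ ![φ, ψ])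
      (h : resonanceSpace α Q = Submodule.span ℝ {φ, ψ}) :
      IsLimitOperator α Q (schrodinger (fun _ _ => 0)
        (doubleCondition (crossProduct (endValues φ) (endValues ψ))))

section Resolvents

variable {E : Type*} [NormedAddCommGroup E] [InnerProductSpace ℂ E]

/-- The bounded operator `R` is the resolvent `(T - ζ)⁻¹` of the unbounded operator `T`. -/
def IsResolvent (T : E →ₗ.[ℂ] E) (ζ : ℂ) (R : E →L[ℂ] E) : Prop :=
  (∀ f : E, ∃ u : T.domain, (u : E) = R f ∧ T u - ζ • (u : E) = f) ∧
  ∀ u : T.domain, R (T u - ζ • (u : E)) = u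

/-- Norm resolvent convergence of self-adjoint operators along a filter. -/
def NormResolventTendsto [CompleteSpace E] (T : ℝ → E →ₗ.[ℂ] E) (l : Filter ℝ)
    (S : E →ₗ.[ℂ] E) : Prop :=
  (∀ᶠ ε in l, IsSelfAdjoint (T ε)) ∧ IsSelfAdjoint S ∧
  ∀ ζ : ℂ, ζ.im ≠ 0 → ∃ (R : ℝ → E →L[ℂ] E) (R₀ : E →L[ℂ] E),
    (∀ᶠ ε in l, IsResolvent (T ε) ζ (R ε)) ∧ IsResolvent S ζ R₀ ∧ Tendsto R l (𝓝 R₀)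

end Resolvents

end StarGraph

end

namespace StarGraph

/-! All three vertex conditions have one form. Let `K = resonantValues F` be the complex span of the
end values at distance one of the functions in `resonanceSpace`. Then the limit condition says that
the vertex values lie in `K` and the outward derivatives annihilate `K` under the bilinear pairing
(`splitCondition`, `IsLimitOperator.eq_schrodinger`). Since `K` is stable under conjugation, Green's
formula makes this operator self-adjoint (`isSelfAdjoint_free`). The regularized operator is a free
operator plus a bounded real potential, hence self-adjoint too.

For the convergence, let `u` be the limit resolvent applied to `f`. After rescaling by `ε`, the
inner problem lives on the unit star, and `weyl F` is the set of values and derivatives at distance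
one that solutions satisfying Kirchhoff can have. An inner solution with value `u 0 + ε c` and
derivative `v 0` at distance `ε` has rescaled data `(u 0, 0) + ε (c, v 0)`. The first term is in
`weyl F` because `u 0 ∈ K`. The second can be put there by a choice of `c` because `v 0` annihilates
`K` and the Weyl relation is maximal isotropic (`exists_weyl_of_annihilates`); finite dimension
bounds `c` by a multiple of `v 0` (`exists_bounded_weyl`).

The inner solution, with the source `f` included by variation of constants, is joined at `ε` to `u`
plus an exponentially decaying corrector that absorbs the jumps of value and derivative. By
Cauchy–Schwarz these jumps are `O(√ε)` (`FundamentalSystem.exists_edge_quasimode`). On `(0, ε]` the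
residual is only `-ζ` times a bounded function, which costs another `√ε` in `L₂`. So each `u` has a
nearby element of the regularized domain with an `O(√ε)` residual (`IsProfile.exists_quasimode`),
and the resolvent bound `1 / |Im ζ|` turns this into the norm estimate. -/

/-! ### Calculus of absolutely continuous functions. -/

/-- `u` is absolutely continuous on `[0, b]`, with almost everywhere derivative `v`. -/
structure HasACDerivOn (u v : ℝ → ℂ) (b : ℝ) : Prop where
  integrable : IntervalIntegrable v volume 0 b
  eq_integral : ∀ x ∈ Icc 0 b, u x = u 0 + ∫ t in (0 : ℝ)..x, v t

theorem HasACDeriv.on {u v : ℝ → ℂ} (h : HasACDeriv u v) {b : ℝ} (hb : 0 ≤ b) :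
    HasACDerivOn u v b :=
  ⟨h.integrable b hb, fun x hx => h.eq_integral x hx.1⟩

theorem HasACDeriv.of_on {u v : ℝ → ℂ} (h : ∀ b, 0 ≤ b → HasACDerivOn u v b) :
    HasACDeriv u v :=
  ⟨fun b hb => (h b hb).integrable, fun b hb => (h b hb).eq_integral b ⟨hb, le_rfl⟩⟩

namespace HasACDerivOn

variable {u v u₁ v₁ u₂ v₂ : ℝ → ℂ} {b : ℝ}

theorem continuousOn (h : HasACDerivOn u v b) : ContinuousOn u (Icc 0 b) := by
  rcases lt_or_ge b 0 with hb | hb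
  · simp [Icc_eq_empty (not_le.2 hb)]
  have h1 : ContinuousOn (fun x => ∫ t in (0 : ℝ)..x, v t) (Icc 0 b) := by
    have := intervalIntegral.continuousOn_primitive_interval' h.integrable left_mem_uIcc
    rwa [uIcc_of_le hb] at this
  exact (continuousOn_const.add h1).congr fun x hx => h.eq_integral x hx

theorem congr (h : HasACDerivOn u v b) (hb : 0 ≤ b) (hu : EqOn u₁ u (Icc 0 b))
    (hv : ∀ᵐ x, x ∈ Ioc 0 b → v₁ x = v x) : HasACDerivOn u₁ v₁ b := by
  have key : ∀ x ∈ Icc 0 b, ∫ t in (0 : ℝ)..x, v₁ t = ∫ t in (0 : ℝ)..x, v t := by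
    intro x hx
    refine intervalIntegral.integral_congr_ae ?_
    filter_upwards [hv] with t ht ht'
    rw [uIoc_of_le hx.1] at ht'
    exact ht ⟨ht'.1, ht'.2.trans hx.2⟩
  refine ⟨h.integrable.congr_ae ?_, fun x hx => ?_⟩
  · rw [EventuallyEq, ae_restrict_iff' measurableSet_uIoc, uIoc_of_le hb]
    filter_upwards [hv] with x hx hx'
    exact (hx hx').symm
  · rw [hu hx, hu ⟨le_rfl, hb⟩, key x hx, h.eq_integral x hx]

theorem const (k : ℂ) (b : ℝ) : HasACDerivOn (fun _ => k) (fun _ => 0) b :=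
  ⟨intervalIntegrable_const, by simp⟩

theorem add (h₁ : HasACDerivOn u₁ v₁ b) (h₂ : HasACDerivOn u₂ v₂ b) :
    HasACDerivOn (fun x => u₁ x + u₂ x) (fun x => v₁ x + v₂ x) b := by
  rcases lt_or_ge b 0 with hb | hb
  · exact ⟨h₁.integrable.add h₂.integrable, by simp [Icc_eq_empty (not_le.2 hb)]⟩
  refine ⟨h₁.integrable.add h₂.integrable, fun x hx => ?_⟩
  have i : ∀ {w : ℝ → ℂ}, IntervalIntegrable w volume 0 b → IntervalIntegrable w volume 0 x :=
    fun hw => hw.mono_set (by rw [uIcc_of_le hx.1, uIcc_of_le hb]; exact Icc_subset_Icc_right hx.2)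
  rw [intervalIntegral.integral_add (i h₁.integrable) (i h₂.integrable),
    h₁.eq_integral x hx, h₂.eq_integral x hx]
  ring

theorem const_mul (k : ℂ) (h : HasACDerivOn u v b) :
    HasACDerivOn (fun x => k * u x) (fun x => k * v x) b := by
  refine ⟨h.integrable.const_mul k, fun x hx => ?_⟩
  rw [intervalIntegral.integral_const_mul, h.eq_integral x hx, mul_add]

theorem sub (h₁ : HasACDerivOn u₁ v₁ b) (h₂ : HasACDerivOn u₂ v₂ b) :
    HasACDerivOn (fun x => u₁ x - u₂ x) (fun x => v₁ x - v₂ x) b := by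
  simpa [sub_eq_add_neg] using h₁.add (h₂.const_mul (-1))

theorem conj (h : HasACDerivOn u v b) :
    HasACDerivOn (fun x => starRingEnd ℂ (u x)) (fun x => starRingEnd ℂ (v x)) b := by
  refine ⟨?_, fun x hx => ?_⟩
  · have := h.integrable
    rw [intervalIntegrable_iff] at this ⊢
    exact (Complex.conjCLE.toContinuousLinearMap.integrable_comp this)
  · rw [h.eq_integral x hx, intervalIntegral.integral_of_le hx.1, intervalIntegral.integral_of_le hx.1,
      integral_conj, map_add]

theorem of_integral {v : ℝ → ℂ} {b : ℝ} (h : IntervalIntegrable v volume 0 b) (k : ℂ) :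
    HasACDerivOn (fun x => k + ∫ t in (0 : ℝ)..x, v t) v b :=
  ⟨h, fun x _ => by simp⟩

/-- `U` is `u 0` plus the primitives of the real and imaginary parts of `v`. Unlike `u`, it is
controlled on both sides of the endpoints, so it has two-sided derivatives almost everywhere and the
theory of `AbsolutelyContinuousOnInterval` applies to it. -/
theorem exists_absolutelyContinuous (h : HasACDerivOn u v b) (hb : 0 ≤ b) :
    ∃ U : ℝ → ℂ, AbsolutelyContinuousOnInterval U 0 b ∧ EqOn u U (Icc 0 b) ∧
      ∀ᵐ x, x ∈ uIcc 0 b → HasDerivAt U (v x) x := by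
  have hr : IntervalIntegrable (fun t => (v t).re) volume 0 b := by
    have := h.integrable
    rw [intervalIntegrable_iff] at this ⊢
    exact this.re
  have hi : IntervalIntegrable (fun t => (v t).im) volume 0 b := by
    have := h.integrable
    rw [intervalIntegrable_iff] at this ⊢
    exact this.im
  have a₂ := hr.absolutelyContinuousOnInterval_intervalIntegral (c := 0) left_mem_uIcc
  have a₃ := hi.absolutelyContinuousOnInterval_intervalIntegral (c := 0) left_mem_uIcc
  have c : ∀ k : ℂ, AbsolutelyContinuousOnInterval (fun _ : ℝ => k) 0 b := fun k =>
    LipschitzOnWith.absolutelyContinuousOnInterval (K := 0) (LipschitzWith.const k).lipschitzOnWith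
  refine ⟨_, ((c (u 0)).fun_add (a₂.fun_smul (c 1))).fun_add (a₃.fun_smul (c Complex.I)),
    fun x hx => ?_, ?_⟩
  · have hvx : IntervalIntegrable v volume 0 x := h.integrable.mono_set
      (by rw [uIcc_of_le hx.1, uIcc_of_le hb]; exact Icc_subset_Icc_right hx.2)
    rw [intervalIntegrable_iff_integrableOn_Ioc_of_le hx.1] at hvx
    have := setIntegral_re_add_im hvx
    rw [h.eq_integral x hx, intervalIntegral.integral_of_le hx.1, ← this]
    simp [intervalIntegral.integral_of_le hx.1, add_assoc]
  · filter_upwards [hr.ae_hasDerivAt_integral, hi.ae_hasDerivAt_integral] with x k₂ k₃ hx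
    refine ((((k₂ hx 0 left_mem_uIcc).smul_const (1 : ℂ)).const_add (u 0)).add
      ((k₃ hx 0 left_mem_uIcc).smul_const Complex.I)).congr_deriv ?_
    simp

/-- The product minus the primitive of the expected derivative is absolutely continuous with
derivative zero almost everywhere, hence constant. -/
theorem mul (hb : 0 ≤ b) (h₁ : HasACDerivOn u₁ v₁ b) (h₂ : HasACDerivOn u₂ v₂ b) :
    HasACDerivOn (fun x => u₁ x * u₂ x) (fun x => v₁ x * u₂ x + u₁ x * v₂ x) b := by
  have c₁ := h₁.continuousOn
  have c₂ := h₂.continuousOn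
  rw [← uIcc_of_le hb] at c₁ c₂
  have hI : IntervalIntegrable (fun x => v₁ x * u₂ x + u₁ x * v₂ x) volume 0 b :=
    (h₁.integrable.mul_continuousOn c₂).add (h₂.integrable.continuousOn_mul c₁)
  refine ⟨hI, ?_⟩
  obtain ⟨U₁, a₁, e₁, d₁⟩ := h₁.exists_absolutelyContinuous hb
  obtain ⟨U₂, a₂, e₂, d₂⟩ := h₂.exists_absolutelyContinuous hb
  obtain ⟨P, aP, eP, dP⟩ := (of_integral hI 0).exists_absolutelyContinuous hb
  have aG : AbsolutelyContinuousOnInterval (fun x => U₁ x • U₂ x - P x) 0 b :=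
    (a₁.fun_smul a₂).fun_sub aP
  obtain ⟨C, hC⟩ := aG.const_of_ae_hasDerivAt_zero (by
    filter_upwards [d₁, d₂, dP] with x k₁ k₂ k₃ hx
    refine (((k₁ hx).smul (k₂ hx)).sub (k₃ hx)).congr_deriv ?_
    rw [uIcc_of_le hb] at hx
    rw [e₁ hx, e₂ hx]
    simp only [smul_eq_mul]
    ring)
  intro x hx
  have m0 : (0 : ℝ) ∈ Icc 0 b := ⟨le_rfl, hb⟩
  rw [uIcc_of_le hb] at hC
  have h0 := hC 0 m0
  have hx' := hC x hx
  rw [smul_eq_mul, ← e₁ m0, ← e₂ m0, ← eP m0] at h0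
  rw [smul_eq_mul, ← e₁ hx, ← e₂ hx, ← eP hx] at hx'
  simp only [intervalIntegral.integral_same, zero_add] at h0 hx'
  linear_combination hx' - h0

theorem of_hasDerivWithinAt (hb : 0 ≤ b)
    (h : ∀ x ∈ Icc 0 b, HasDerivWithinAt u (v x) (Icc 0 b) x) (hv : ContinuousOn v (Icc 0 b)) :
    HasACDerivOn u v b := by
  have hI : IntervalIntegrable v volume 0 b := by
    apply ContinuousOn.intervalIntegrable; rwa [uIcc_of_le hb]
  refine ⟨hI, fun x hx => ?_⟩
  have hs : Icc 0 x ⊆ Icc 0 b := Icc_subset_Icc_right hx.2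
  rw [intervalIntegral.integral_eq_sub_of_hasDerivAt_of_le hx.1
    (fun y hy => ((h y (hs hy)).continuousWithinAt).mono hs) (fun y hy =>
      (h y (hs (Ioo_subset_Icc_self hy))).hasDerivAt
        (Icc_mem_nhds hy.1 (hy.2.trans_le hx.2)))
    (hI.mono_set (by rwa [uIcc_of_le hx.1, uIcc_of_le hb]))]
  ring

/-- Applied to a function and again to its derivative, this joins an inner and an outer solution
into an element of `W₂²`. Only the values at `b` must agree; the densities may jump there. -/
theorem glue (hb : 0 ≤ b) (h₁ : HasACDerivOn u₁ v₁ b) (h₂ : HasACDeriv u₂ v₂)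
    (heq : u₁ b = u₂ b) :
    HasACDeriv ((Iic b).piecewise u₁ u₂) ((Iic b).piecewise v₁ v₂) := by
  classical
  have hle : ∀ x, x ≤ b → ∀ f g : ℝ → ℂ, (Iic b).piecewise f g x = f x :=
    fun x hx f g => piecewise_eq_of_mem _ _ _ hx
  have hgt : ∀ x, b < x → ∀ f g : ℝ → ℂ, (Iic b).piecewise f g x = g x :=
    fun x hx f g => piecewise_eq_of_notMem _ _ _ (by simpa using hx)
  have i₁ : ∀ x ∈ Icc 0 b, IntervalIntegrable ((Iic b).piecewise v₁ v₂) volume 0 x := by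
    intro x hx
    refine (h₁.integrable.mono_set (d := x) (c := 0)
      (by rw [uIcc_of_le hx.1, uIcc_of_le hb]; exact Icc_subset_Icc_right hx.2)).congr ?_
    intro t ht
    rw [uIoc_of_le hx.1] at ht
    exact (hle t (ht.2.trans hx.2) _ _).symm
  have s₁ : ∀ x ∈ Icc 0 b, ∫ t in (0 : ℝ)..x, (Iic b).piecewise v₁ v₂ t
      = ∫ t in (0 : ℝ)..x, v₁ t := by
    intro x hx
    refine intervalIntegral.integral_congr fun t ht => ?_
    rw [uIcc_of_le hx.1] at ht
    exact hle t (ht.2.trans hx.2) _ _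
  have j₂ : ∀ x, b ≤ x → IntervalIntegrable v₂ volume b x := fun x hx =>
    (h₂.integrable x (hb.trans hx)).mono_set (by
      rw [uIcc_of_le hx, uIcc_of_le (hb.trans hx)]; exact Icc_subset_Icc_left hb)
  have i₂ : ∀ x, b ≤ x → IntervalIntegrable ((Iic b).piecewise v₁ v₂) volume b x := by
    intro x hx
    refine (j₂ x hx).congr ?_
    intro t ht
    rw [uIoc_of_le hx] at ht
    exact (hgt t ht.1 _ _).symm
  have s₂ : ∀ x, b ≤ x → ∫ t in b..x, (Iic b).piecewise v₁ v₂ t = ∫ t in b..x, v₂ t := by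
    intro x hx
    refine intervalIntegral.integral_congr_ae (Eventually.of_forall fun t ht => ?_)
    rw [uIoc_of_le hx] at ht
    exact hgt t ht.1 _ _
  refine ⟨fun x hx => ?_, fun x hx => ?_⟩
  · rcases le_total x b with hxb | hxb
    · exact i₁ x ⟨hx, hxb⟩
    · exact (i₁ b ⟨hb, le_rfl⟩).trans (i₂ x hxb)
  · rcases le_or_gt x b with hxb | hxb
    · rw [hle x hxb, hle 0 hb, s₁ x ⟨hx, hxb⟩, h₁.eq_integral x ⟨hx, hxb⟩]
    · rw [hgt x hxb, hle 0 hb, ← intervalIntegral.integral_add_adjacent_intervals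
        (i₁ b ⟨hb, le_rfl⟩) (i₂ x hxb.le), s₁ b ⟨hb, le_rfl⟩, s₂ x hxb.le, ← add_assoc,
        ← h₁.eq_integral b ⟨hb, le_rfl⟩, heq, h₂.eq_integral x hx, h₂.eq_integral b hb, add_assoc,
        intervalIntegral.integral_add_adjacent_intervals (h₂.integrable b hb) (j₂ x hxb.le)]

end HasACDerivOn

namespace HasACDeriv

variable {u v u₁ v₁ u₂ v₂ : ℝ → ℂ}

theorem mul (h₁ : HasACDeriv u₁ v₁) (h₂ : HasACDeriv u₂ v₂) :
    HasACDeriv (fun x => u₁ x * u₂ x) (fun x => v₁ x * u₂ x + u₁ x * v₂ x) :=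
  .of_on fun _ hb => (h₁.on hb).mul hb (h₂.on hb)

theorem sub (h₁ : HasACDeriv u₁ v₁) (h₂ : HasACDeriv u₂ v₂) :
    HasACDeriv (fun x => u₁ x - u₂ x) (fun x => v₁ x - v₂ x) :=
  .of_on fun _ hb => (h₁.on hb).sub (h₂.on hb)

theorem conj (h : HasACDeriv u v) :
    HasACDeriv (fun x => starRingEnd ℂ (u x)) (fun x => starRingEnd ℂ (v x)) :=
  .of_on fun _ hb => (h.on hb).conj

theorem congr_deriv (h : HasACDeriv u v) (hv : ∀ x, v₁ x = v x) : HasACDeriv u v₁ :=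
  (funext hv : v₁ = v) ▸ h

theorem of_hasDerivAt (h : ∀ x, HasDerivAt u (v x) x) (hv : Continuous v) : HasACDeriv u v :=
  .of_on fun _ hb => .of_hasDerivWithinAt hb (fun x _ => (h x).hasDerivWithinAt) hv.continuousOn

theorem aestronglyMeasurable (h : HasACDeriv u v) : AEStronglyMeasurable u edgeMeasure :=
  (h.continuousOn.mono Ioi_subset_Ici_self).aestronglyMeasurable measurableSet_Ioi

end HasACDeriv

/-! ### Self-adjoint operators and their resolvents in a Hilbert space. -/

section SelfAdjoint

variable {E : Type*} [NormedAddCommGroup E] [InnerProductSpace ℂ E] [CompleteSpace E]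

theorem isSelfAdjoint_of_graph {T : E →ₗ.[ℂ] E} (hd : Dense (T.domain : Set E))
    (h : ∀ a b : E, (∀ x y, (x, y) ∈ T.graph → inner ℂ y a = inner ℂ x b) ↔ (a, b) ∈ T.graph) :
    IsSelfAdjoint T := by
  rw [LinearPMap.isSelfAdjoint_def]
  refine LinearPMap.eq_of_eq_graph ?_
  rw [LinearPMap.adjoint_graph_eq_graph_adjoint hd]
  ext ⟨a, b⟩
  rw [Submodule.mem_adjoint_iff, ← h]
  simp only [sub_eq_zero]

theorem mem_graph_iff_of_isSelfAdjoint {T : E →ₗ.[ℂ] E} (hT : IsSelfAdjoint T) (a b : E) :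
    (∀ x y, (x, y) ∈ T.graph → inner ℂ y a = inner ℂ x b) ↔ (a, b) ∈ T.graph := by
  have h := LinearPMap.adjoint_graph_eq_graph_adjoint hT.dense_domain
  rw [LinearPMap.isSelfAdjoint_def.1 hT] at h
  have h' : (a, b) ∈ T.graph ↔ (a, b) ∈ T.graph.adjoint := by rw [← h]
  rw [h', Submodule.mem_adjoint_iff]
  simp only [sub_eq_zero]

/-- A symmetric operator `T` such that `T + 1` is onto is self-adjoint. -/
theorem isSelfAdjoint_of_symmetric_of_surjective {T : E →ₗ.[ℂ] E}
    (hs : ∀ x y x' y', (x, y) ∈ T.graph → (x', y') ∈ T.graph → inner ℂ y x' = inner ℂ x y')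
    (hr : ∀ f, ∃ x y, (x, y) ∈ T.graph ∧ y + x = f) : IsSelfAdjoint T := by
  have hd : Dense (T.domain : Set E) := by
    rw [Submodule.dense_iff_topologicalClosure_eq_top,
      Submodule.topologicalClosure_eq_top_iff, Submodule.eq_bot_iff]
    intro g hg
    rw [Submodule.mem_orthogonal] at hg
    obtain ⟨x, y, hxy, rfl⟩ := hr g
    -- Here `g = (T + 1) x` is orthogonal to the domain. Choosing `x'` with `(T + 1) x' = x`,
    -- symmetry gives `0 = ⟨x', (T + 1) x⟩ = ⟨x, x⟩`.
    have hx : x = 0 := by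
      obtain ⟨x', y', h', e⟩ := hr x
      have h1 := hg x' (LinearPMap.mem_domain_of_mem_graph h')
      rw [inner_add_right, ← hs _ _ _ _ h' hxy, ← inner_add_left, e] at h1
      exact inner_self_eq_zero.1 h1
    subst hx
    have := LinearPMap.graph_fst_eq_zero_snd T hxy rfl
    simpa using this
  refine isSelfAdjoint_of_graph hd fun a b => ⟨fun h => ?_, fun h x y hxy => hs _ _ _ _ hxy h⟩
  obtain ⟨x, y, hxy, e⟩ := hr (b + a)
  -- The pair `(a, b)` is in the adjoint graph and `(T + 1) x = b + a`, so `a - x` is orthogonal to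
  -- the range of `T + 1`, which is everything.
  have hax : a - x = 0 := by
    obtain ⟨x', y', h', e'⟩ := hr (a - x)
    have h1 := h x' y' h'
    have h2 := hs _ _ _ _ h' hxy
    have : inner ℂ (y' + x') (a - x) = 0 := by
      rw [inner_add_left, inner_sub_right, inner_sub_right, h1, h2]
      have h3 : inner ℂ x' (y + x) = inner ℂ x' (b + a) := by rw [e]
      rw [inner_add_right, inner_add_right] at h3
      linear_combination -h3
    rw [e'] at this
    exact inner_self_eq_zero.1 this
  have hax' := sub_eq_zero.1 hax
  subst hax'
  rwa [← add_right_cancel e]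

/-- Shifting second components by `A` carries one graph to the other, and also carries the pairing
condition that defines the adjoint, because `A` is symmetric and defined everywhere. -/
theorem isSelfAdjoint_of_perturbation {T T' : E →ₗ.[ℂ] E} (hT : IsSelfAdjoint T) (A : E → E)
    (hA : ∀ x y, inner ℂ (A x) y = inner ℂ x (A y))
    (h : ∀ x y, (x, y) ∈ T'.graph ↔ (x, y - A x) ∈ T.graph) : IsSelfAdjoint T' := by
  have hdom : (T.domain : Set E) ⊆ T'.domain := by
    intro x hx
    refine LinearPMap.mem_domain_of_mem_graph (y := T ⟨x, hx⟩ + A x) ((h _ _).2 ?_)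
    rw [add_sub_cancel_right]
    exact LinearPMap.mem_graph T ⟨x, hx⟩
  refine isSelfAdjoint_of_graph (hT.dense_domain.mono hdom) fun a b => ?_
  rw [h, ← mem_graph_iff_of_isSelfAdjoint hT]
  refine ⟨fun H x y hxy => ?_, fun H x y hxy => ?_⟩
  · have := H x (y + A x) (by rw [h, add_sub_cancel_right]; exact hxy)
    rw [inner_add_left, hA] at this
    rw [inner_sub_right]
    linear_combination this
  · have := H x (y - A x) ((h _ _).1 hxy)
    rw [inner_sub_left, inner_sub_right, hA] at this
    linear_combination this

/-- Symmetry makes `⟨x, y⟩` real, so the imaginary part of `⟨x, y - ζ x⟩` is `-Im ζ ‖x‖²`; then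
Cauchy–Schwarz. -/
theorem abs_im_mul_norm_le {T : E →ₗ.[ℂ] E} (hT : IsSelfAdjoint T) (ζ : ℂ) {x y : E}
    (hxy : (x, y) ∈ T.graph) : |ζ.im| * ‖x‖ ≤ ‖y - ζ • x‖ := by
  have hs := (mem_graph_iff_of_isSelfAdjoint hT x y).2 hxy x y hxy
  have hre : (inner ℂ x y).im = 0 := by
    rw [← inner_conj_symm] at hs
    exact Complex.conj_eq_iff_im.1 hs
  have h1 : (inner ℂ x (y - ζ • x)).im = -ζ.im * ‖x‖ ^ 2 := by
    rw [inner_sub_right, inner_smul_right, inner_self_eq_norm_sq_to_K, Complex.sub_im, hre]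
    simp [← Complex.ofReal_pow]
  have h2 : |ζ.im| * ‖x‖ ^ 2 ≤ ‖x‖ * ‖y - ζ • x‖ := by
    calc |ζ.im| * ‖x‖ ^ 2 = |(inner ℂ x (y - ζ • x)).im| := by
          rw [h1, abs_mul, abs_neg, abs_of_nonneg (sq_nonneg ‖x‖)]
      _ ≤ ‖inner ℂ x (y - ζ • x)‖ := Complex.abs_im_le_norm _
      _ ≤ _ := norm_inner_le_norm _ _
  rcases (norm_nonneg x).eq_or_lt with h0 | h0
  · rw [← h0, mul_zero]; exact norm_nonneg _
  · nlinarith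

/-- The graph is complete and `T - ζ` is bounded below on it in the graph norm, so the range is
closed. A vector orthogonal to the range would be an eigenvector for the nonreal number `conj ζ`, so
it vanishes. -/
theorem exists_graph_sub_eq {T : E →ₗ.[ℂ] E} (hT : IsSelfAdjoint T) {ζ : ℂ} (hζ : ζ.im ≠ 0)
    (f : E) : ∃ x y, (x, y) ∈ T.graph ∧ y - ζ • x = f := by
  let L : E × E →L[ℂ] E := ContinuousLinearMap.snd ℂ E E - ζ • ContinuousLinearMap.fst ℂ E E
  have hL : ∀ p : E × E, L p = p.2 - ζ • p.1 := fun p => rfl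
  have hcl : IsClosed (T.graph : Set (E × E)) := hT.isClosed
  have : CompleteSpace T.graph := hcl.completeSpace_coe
  let S : T.graph →L[ℂ] E := L.comp T.graph.subtypeL
  have hpos : 0 < |ζ.im| := abs_pos.2 hζ
  have hanti : AntilipschitzWith (Real.toNNReal (1 + (1 + ‖ζ‖) / |ζ.im|)) S := by
    refine AddMonoidHomClass.antilipschitz_of_bound S fun p => ?_
    have hp := abs_im_mul_norm_le hT ζ (x := p.1.1) (y := p.1.2) p.2
    have hp1 : ‖p.1.1‖ ≤ ‖S p‖ / |ζ.im| := by
      rw [le_div_iff₀ hpos, mul_comm]; exact hp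
    have hp2 : ‖p.1.2‖ ≤ ‖S p‖ + ‖ζ‖ * (‖S p‖ / |ζ.im|) := by
      have : p.1.2 = S p + ζ • p.1.1 := (sub_add_cancel _ _).symm
      rw [this]
      refine (norm_add_le _ _).trans ?_
      rw [norm_smul]
      gcongr
    have hnn : 0 ≤ ‖S p‖ / |ζ.im| := by positivity
    rw [Real.coe_toNNReal _ (by positivity)]
    have e : (1 + (1 + ‖ζ‖) / |ζ.im|) * ‖S p‖
        = ‖S p‖ + ‖S p‖ / |ζ.im| + ‖ζ‖ * (‖S p‖ / |ζ.im|) := by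
      field_simp
      ring
    rw [e]
    refine max_le ?_ ?_
    · change ‖p.1.1‖ ≤ _
      have : 0 ≤ ‖ζ‖ * (‖S p‖ / |ζ.im|) := by positivity
      linarith [norm_nonneg (S p)]
    · change ‖p.1.2‖ ≤ _
      linarith
  have hrange : IsClosed (S.range : Set E) := by
    rw [LinearMap.coe_range]
    exact hanti.isClosed_range S.uniformContinuous
  have htop : S.range = ⊤ := by
    have : CompleteSpace S.range := hrange.completeSpace_coe
    rw [← Submodule.orthogonal_eq_bot_iff, Submodule.eq_bot_iff]
    intro g hg
    rw [Submodule.mem_orthogonal] at hg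
    have hg' : (g, (starRingEnd ℂ ζ) • g) ∈ T.graph := by
      rw [← mem_graph_iff_of_isSelfAdjoint hT]
      intro x y hxy
      have h1 := hg (y - ζ • x) ⟨⟨(x, y), hxy⟩, rfl⟩
      rw [inner_sub_left, inner_smul_left] at h1
      rw [inner_smul_right]
      linear_combination h1
    have h2 := abs_im_mul_norm_le hT (starRingEnd ℂ ζ) hg'
    rw [sub_self, norm_zero, Complex.conj_im, abs_neg] at h2
    have : ‖g‖ ≤ 0 := by
      by_contra! h
      nlinarith [mul_pos hpos h]
    exact norm_le_zero_iff.1 this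
  obtain ⟨p, hp⟩ : f ∈ S.range := htop ▸ Submodule.mem_top
  exact ⟨p.1.1, p.1.2, p.2, hp⟩

/-- The resolvent of a self-adjoint operator at a nonreal point. -/
theorem exists_isResolvent {T : E →ₗ.[ℂ] E} (hT : IsSelfAdjoint T) {ζ : ℂ} (hζ : ζ.im ≠ 0) :
    ∃ R : E →L[ℂ] E, IsResolvent T ζ R ∧ ∀ f, ‖R f‖ ≤ |ζ.im|⁻¹ * ‖f‖ := by
  have hpos : 0 < |ζ.im| := abs_pos.2 hζ
  choose x y hxy hf using exists_graph_sub_eq hT hζ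
  have huniq : ∀ x₁ y₁ x₂ y₂, (x₁, y₁) ∈ T.graph → (x₂, y₂) ∈ T.graph →
      y₁ - ζ • x₁ = y₂ - ζ • x₂ → x₁ = x₂ := by
    intro x₁ y₁ x₂ y₂ h₁ h₂ h
    have h3 := abs_im_mul_norm_le hT ζ (T.graph.sub_mem h₁ h₂)
    have h4 : y₁ - y₂ - ζ • (x₁ - x₂) = 0 := by
      rw [smul_sub, ← sub_eq_zero.2 h]; abel
    rw [h4, norm_zero] at h3
    have : ‖x₁ - x₂‖ ≤ 0 := by
      by_contra! h
      nlinarith [mul_pos hpos h]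
    exact sub_eq_zero.1 (norm_le_zero_iff.1 this)
  have hb : ∀ f, ‖x f‖ ≤ |ζ.im|⁻¹ * ‖f‖ := by
    intro f
    have := abs_im_mul_norm_le hT ζ (hxy f)
    rw [hf] at this
    rw [inv_mul_eq_div, le_div_iff₀ hpos, mul_comm]
    exact this
  let R₀ : E →ₗ[ℂ] E :=
    { toFun := x
      map_add' := fun f g => huniq _ _ _ _ (hxy _) (T.graph.add_mem (hxy f) (hxy g)) (by
        change _ = (y f + y g) - ζ • (x f + x g)
        rw [hf, smul_add]; nth_rewrite 1 [← hf f, ← hf g]; abel)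
      map_smul' := fun k f => huniq _ _ _ _ (hxy _) (T.graph.smul_mem k (hxy f)) (by
        change _ = k • y f - ζ • (k • x f)
        rw [hf, smul_comm ζ k, ← smul_sub, hf]) }
  refine ⟨R₀.mkContinuous _ hb, ⟨fun f => ?_, fun u => ?_⟩, hb⟩
  · have h1 := hxy f
    rw [LinearPMap.mem_graph_iff] at h1
    obtain ⟨u, hu1, hu2⟩ := h1
    refine ⟨u, hu1, ?_⟩
    simp only at hu1 hu2
    rw [hu1, hu2, hf]
  · exact huniq _ _ _ _ (hxy _) (LinearPMap.mem_graph T u) (hf _)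

end SelfAdjoint

/-! ### Square-integrable functions on the half-line and the equation `-u'' + u = f`. -/

theorem memLp_intervalIntegrable {f : ℝ → ℂ} (hf : MemLp f 2 edgeMeasure) {b : ℝ} (hb : 0 ≤ b) :
    IntervalIntegrable f volume 0 b := by
  rw [intervalIntegrable_iff_integrableOn_Ioc_of_le hb]
  have h1 : MemLp f 2 (volume.restrict (Ioc 0 b)) :=
    hf.mono_measure (Measure.restrict_mono Ioc_subset_Ioi_self le_rfl)
  exact h1.integrable (by norm_num)

theorem integrable_sq_norm {f : ℝ → ℂ} (hf : MemLp f 2 edgeMeasure) :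
    Integrable (fun x => ‖f x‖ ^ 2) edgeMeasure :=
  (memLp_two_iff_integrable_sq_norm hf.1).1 hf

theorem intervalIntegral_le_setIntegral {f : ℝ → ℝ} (hf : Integrable f edgeMeasure)
    (h0 : ∀ x, 0 ≤ f x) {b : ℝ} (hb : 0 ≤ b) : ∫ t in (0 : ℝ)..b, f t ≤ ∫ t in Ioi 0, f t := by
  rw [intervalIntegral.integral_of_le hb]
  exact setIntegral_mono_set hf (Eventually.of_forall h0)
    (Eventually.of_forall Ioc_subset_Ioi_self)

theorem integrable_intervalIntegrable {E : Type*} [NormedAddCommGroup E] {f : ℝ → E}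
    (hf : Integrable f edgeMeasure) {b : ℝ} (hb : 0 ≤ b) : IntervalIntegrable f volume 0 b := by
  rw [intervalIntegrable_iff_integrableOn_Ioc_of_le hb]
  exact IntegrableOn.mono_set hf Ioc_subset_Ioi_self

namespace HasACDeriv

variable {u v f : ℝ → ℂ}

/-- The fundamental theorem of calculus on the half-line: an integrable function with integrable
derivative vanishes at infinity. -/
theorem integral_eq_neg (h : HasACDeriv u v) (hu : Integrable u edgeMeasure)
    (hv : Integrable v edgeMeasure) : ∫ x in Ioi (0 : ℝ), v x = -u 0 := by
  have h1 : Tendsto u atTop (𝓝 (u 0 + ∫ x in Ioi (0 : ℝ), v x)) := by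
    refine ((intervalIntegral_tendsto_integral_Ioi 0 hv tendsto_id).const_add (u 0)).congr' ?_
    filter_upwards [eventually_ge_atTop 0] with x hx
    exact (h.eq_integral x hx).symm
  have h2 : IntegrableAtFilter u atTop := ⟨Ioi 0, Ioi_mem_atTop 0, hu⟩
  have h3 := IntegrableAtFilter.eq_zero_of_tendsto h2 (by
    intro s hs
    rcases mem_atTop_sets.1 hs with ⟨b, hb⟩
    rw [← top_le_iff, ← Real.volume_Ici (a := b)]
    exact measure_mono hb) h1
  exact (neg_eq_of_add_eq_zero_right h3).symm

theorem sq_norm_eq (h : HasACDeriv u v) {x : ℝ} (hx : 0 ≤ x) :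
    IntervalIntegrable (fun t => 2 * (v t * starRingEnd ℂ (u t)).re) volume 0 x ∧
    ‖u x‖ ^ 2 = ‖u 0‖ ^ 2 + ∫ t in (0 : ℝ)..x, 2 * (v t * starRingEnd ℂ (u t)).re := by
  have h1 := h.mul h.conj
  have h2 := h1.eq_integral x hx
  have h3 := h1.integrable x hx
  have hre : ∀ t, 2 * (v t * starRingEnd ℂ (u t)).re
      = (v t * starRingEnd ℂ (u t) + u t * starRingEnd ℂ (v t)).re := by
    intro t; simp; ring
  simp only [hre]
  refine ⟨?_, ?_⟩
  · rw [intervalIntegrable_iff] at h3 ⊢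
    exact h3.re
  · rw [intervalIntegral.integral_of_le hx] at h2 ⊢
    rw [intervalIntegrable_iff_integrableOn_Ioc_of_le hx] at h3
    have h4 := integral_re (𝕜 := ℂ) h3
    simp only [RCLike.re_to_complex] at h4
    rw [h4]
    have h5 := congrArg Complex.re h2
    rw [Complex.add_re, Complex.mul_conj, Complex.mul_conj, Complex.ofReal_re, Complex.ofReal_re,
      Complex.normSq_eq_norm_sq, Complex.normSq_eq_norm_sq] at h5
    exact h5

/-- An energy estimate: a differential inequality for `‖u‖ ^ 2` makes `u` square-integrable. -/
theorem memLp_of_le (h : HasACDeriv u v) (hf : MemLp f 2 edgeMeasure) (σ C : ℝ)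
    (hle : ∀ x, ‖u x‖ ^ 2 ≤ ‖f x‖ ^ 2 + σ * (2 * (v x * starRingEnd ℂ (u x)).re))
    (hC : ∀ x, 0 ≤ x → σ * (‖u x‖ ^ 2 - ‖u 0‖ ^ 2) ≤ C) : MemLp u 2 edgeMeasure := by
  rw [memLp_two_iff_integrable_sq_norm h.aestronglyMeasurable]
  have hcont : ∀ b, 0 ≤ b → IntervalIntegrable (fun x => ‖u x‖ ^ 2) volume 0 b := by
    intro b hb
    apply ContinuousOn.intervalIntegrable
    rw [uIcc_of_le hb]
    exact ((h.on hb).continuousOn.norm.pow 2)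
  refine integrableOn_Ioi_of_intervalIntegral_norm_bounded
    ((∫ t in Ioi 0, ‖f t‖ ^ 2) + C) 0 (b := fun n : ℕ => (n : ℝ)) (l := atTop) (fun n => ?_)
    tendsto_natCast_atTop_atTop (Eventually.of_forall fun n => ?_)
  · exact (intervalIntegrable_iff_integrableOn_Ioc_of_le n.cast_nonneg).1 (hcont _ n.cast_nonneg)
  · have hn : (0 : ℝ) ≤ n := n.cast_nonneg
    obtain ⟨i1, e1⟩ := h.sq_norm_eq hn
    have i2 := integrable_intervalIntegrable (integrable_sq_norm hf) hn
    calc ∫ x in (0 : ℝ)..n, ‖‖u x‖ ^ 2‖ = ∫ x in (0 : ℝ)..n, ‖u x‖ ^ 2 := by simp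
      _ ≤ ∫ x in (0 : ℝ)..n, (‖f x‖ ^ 2 + σ * (2 * (v x * starRingEnd ℂ (u x)).re)) :=
          intervalIntegral.integral_mono_on hn (hcont _ hn) (i2.add (i1.const_mul σ))
            fun x _ => hle x
      _ = (∫ x in (0 : ℝ)..n, ‖f x‖ ^ 2) + σ * (‖u n‖ ^ 2 - ‖u 0‖ ^ 2) := by
          rw [intervalIntegral.integral_add i2 (i1.const_mul σ),
            intervalIntegral.integral_const_mul, e1]
          ring
      _ ≤ _ := add_le_add (intervalIntegral_le_setIntegral (integrable_sq_norm hf)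
          (fun x => by positivity) hn) (hC _ hn)

/-- Integrates `2 Re (v conj u) ≤ ‖u‖² + ‖v‖²`. It is needed because a bounded source term makes the
backward integral for the growing equation converge. -/
theorem sq_norm_le (h : HasACDeriv u v) (hu : MemLp u 2 edgeMeasure) (hv : MemLp v 2 edgeMeasure)
    {x : ℝ} (hx : 0 ≤ x) :
    ‖u x‖ ^ 2 ≤ ‖u 0‖ ^ 2 + ((∫ t in Ioi 0, ‖u t‖ ^ 2) + ∫ t in Ioi 0, ‖v t‖ ^ 2) := by
  obtain ⟨i1, e1⟩ := h.sq_norm_eq hx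
  have iu := integrable_sq_norm hu
  have iv := integrable_sq_norm hv
  rw [e1]
  gcongr
  calc ∫ t in (0 : ℝ)..x, 2 * (v t * starRingEnd ℂ (u t)).re
      ≤ ∫ t in (0 : ℝ)..x, (‖u t‖ ^ 2 + ‖v t‖ ^ 2) := by
        refine intervalIntegral.integral_mono_on hx i1
          (integrable_intervalIntegrable (iu.add iv) hx) fun t _ => ?_
        have := (Complex.re_le_norm (v t * starRingEnd ℂ (u t)))
        rw [norm_mul, RCLike.norm_conj] at this
        nlinarith [sq_nonneg (‖u t‖ - ‖v t‖)]
    _ = (∫ t in (0 : ℝ)..x, ‖u t‖ ^ 2) + ∫ t in (0 : ℝ)..x, ‖v t‖ ^ 2 :=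
        intervalIntegral.integral_add (integrable_intervalIntegrable iu hx)
          (integrable_intervalIntegrable iv hx)
    _ ≤ _ := add_le_add (intervalIntegral_le_setIntegral iu (fun x => by positivity) hx)
        (intervalIntegral_le_setIntegral iv (fun x => by positivity) hx)

end HasACDeriv

theorem hasDerivAt_cexp_mul (k : ℂ) (x : ℝ) :
    HasDerivAt (fun x : ℝ => Complex.exp (k * x)) (k * Complex.exp (k * x)) x := by
  have := ((Complex.ofRealCLM.hasDerivAt (x := x)).const_mul k).cexp
  simpa [mul_comm] using this

theorem hasACDeriv_cexp (k : ℂ) :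
    HasACDeriv (fun x : ℝ => Complex.exp (k * x)) (fun x : ℝ => k * Complex.exp (k * x)) :=
  .of_hasDerivAt (hasDerivAt_cexp_mul k) (by fun_prop)

theorem hasACDeriv_integral {f : ℝ → ℂ} (hf : ∀ b, 0 ≤ b → IntervalIntegrable f volume 0 b) :
    HasACDeriv (fun x => ∫ t in (0 : ℝ)..x, f t) f :=
  ⟨hf, fun x _ => by simp⟩

/-- The decaying equation `w' + w = f`. -/
theorem exists_memLp_add_eq {f : ℝ → ℂ} (hf : MemLp f 2 edgeMeasure) :
    ∃ w : ℝ → ℂ, MemLp w 2 edgeMeasure ∧ HasACDeriv w (fun x => f x - w x) := by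
  have hI : ∀ b : ℝ, 0 ≤ b →
      IntervalIntegrable (fun t : ℝ => Complex.exp (1 * t) * f t) volume 0 b := fun b hb =>
    (memLp_intervalIntegrable hf hb).continuousOn_mul (by fun_prop)
  let w : ℝ → ℂ := fun x =>
    Complex.exp (-1 * x) * ∫ t in (0 : ℝ)..x, Complex.exp (1 * t) * f t
  have hw : HasACDeriv w (fun x => f x - w x) := by
    refine ((hasACDeriv_cexp (-1)).mul (hasACDeriv_integral hI)).congr_deriv fun x => ?_
    have : Complex.exp (-1 * x) * Complex.exp (1 * x) = 1 := by
      rw [← Complex.exp_add]; simp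
    simp only [w]
    linear_combination -f x * this
  -- Energy estimate with `σ = -1`: the boundary term at infinity has a good sign and only `‖w 0‖²`
  -- remains.
  refine ⟨w, hw.memLp_of_le hf (-1) (‖w 0‖ ^ 2) (fun x => ?_) (fun x _ => ?_), hw⟩
  · have e : ((f x - w x) * starRingEnd ℂ (w x)).re
        = (f x * starRingEnd ℂ (w x)).re - ‖w x‖ ^ 2 := by
      rw [sub_mul, Complex.sub_re, Complex.mul_conj, Complex.normSq_eq_norm_sq, Complex.ofReal_re]
    have := (Complex.re_le_norm (f x * starRingEnd ℂ (w x)))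
    rw [norm_mul, RCLike.norm_conj] at this
    rw [e]
    nlinarith [sq_nonneg (‖f x‖ - ‖w x‖)]
  · nlinarith [sq_nonneg ‖w x‖]

/-- The growing equation `u' - u = -w` has a square-integrable solution. -/
theorem exists_memLp_sub_eq {w g : ℝ → ℂ} (hw : MemLp w 2 edgeMeasure)
    (hg : MemLp g 2 edgeMeasure) (hwg : HasACDeriv w g) :
    ∃ u : ℝ → ℂ, MemLp u 2 edgeMeasure ∧ HasACDeriv u (fun x => u x - w x) := by
  obtain ⟨D, hD0, hD⟩ : ∃ D : ℝ, 0 ≤ D ∧ ∀ x, 0 ≤ x → ‖w x‖ ≤ D :=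
    ⟨_, Real.sqrt_nonneg _, fun x hx => Real.le_sqrt_of_sq_le (hwg.sq_norm_le hw hg hx)⟩
  have hexp : ∀ x : ℝ, IntegrableOn (fun t => Real.exp (-t)) (Ioi x) := integrableOn_exp_neg_Ioi
  have hnorm : ∀ t : ℝ, ‖Complex.exp (-1 * t)‖ = Real.exp (-t) := by
    intro t; simp [Complex.norm_exp]
  have hI : IntegrableOn (fun t : ℝ => Complex.exp (-1 * t) * w t) (Ioi 0) := by
    refine (((hexp 0).mul_const D)).mono' ?_ ?_
    · exact AEStronglyMeasurable.mul (by fun_prop) hw.1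
    · filter_upwards [ae_restrict_mem measurableSet_Ioi] with t ht
      rw [norm_mul, hnorm]
      exact mul_le_mul_of_nonneg_left (hD t (le_of_lt ht)) (Real.exp_pos _).le
  -- This is the tail integral over `(x, ∞)`, written as total minus primitive so that its
  -- derivative is immediate. The tail is what keeps `exp x * J x` bounded.
  let J : ℝ → ℂ := fun x => (∫ t in Ioi (0 : ℝ), Complex.exp (-1 * t) * w t)
    - ∫ t in (0 : ℝ)..x, Complex.exp (-1 * t) * w t
  have hJ : HasACDeriv J (fun x => 0 - Complex.exp (-1 * x) * w x) :=
    HasACDeriv.sub (.of_on fun b _ => .const _ b)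
      (hasACDeriv_integral fun b hb => integrable_intervalIntegrable hI hb)
  let u : ℝ → ℂ := fun x => Complex.exp (1 * x) * J x
  have hu : HasACDeriv u (fun x => u x - w x) := by
    refine ((hasACDeriv_cexp 1).mul hJ).congr_deriv fun x => ?_
    have : Complex.exp (-1 * x) * Complex.exp (1 * x) = 1 := by
      rw [← Complex.exp_add]; simp
    simp only [u]
    linear_combination w x * this
  have hbd : ∀ x, 0 ≤ x → ‖u x‖ ≤ D := by
    intro x hx
    have hJx : J x = ∫ t in Ioi x, Complex.exp (-1 * t) * w t := by
      have := intervalIntegral.integral_interval_add_Ioi hI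
        (hI.mono_set (Ioi_subset_Ioi hx))
      simp only [J]
      rw [← this]; ring
    have h1 : ‖J x‖ ≤ ∫ t in Ioi x, Real.exp (-t) * D := by
      rw [hJx]
      refine norm_integral_le_of_norm_le ((hexp x).mul_const D) ?_
      filter_upwards [ae_restrict_mem measurableSet_Ioi] with t ht
      rw [norm_mul, hnorm]
      exact mul_le_mul_of_nonneg_left (hD t (hx.trans (le_of_lt ht))) (Real.exp_pos _).le
    rw [integral_mul_const, integral_exp_neg_Ioi] at h1
    have h2 : ‖Complex.exp (1 * x)‖ = Real.exp x := by simp [Complex.norm_exp]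
    calc ‖u x‖ = Real.exp x * ‖J x‖ := by rw [norm_mul, h2]
      _ ≤ Real.exp x * (Real.exp (-x) * D) := by gcongr
      _ = D := by rw [← mul_assoc, ← Real.exp_add]; simp
  refine ⟨u, hu.memLp_of_le hw 1 (D ^ 2) (fun x => ?_) (fun x hx => ?_), hu⟩
  · have e : ((u x - w x) * starRingEnd ℂ (u x)).re
        = ‖u x‖ ^ 2 - (w x * starRingEnd ℂ (u x)).re := by
      rw [sub_mul, Complex.sub_re, Complex.mul_conj, Complex.normSq_eq_norm_sq, Complex.ofReal_re]
    have := (Complex.re_le_norm (w x * starRingEnd ℂ (u x)))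
    rw [norm_mul, RCLike.norm_conj] at this
    rw [e]
    nlinarith [sq_nonneg (‖w x‖ - ‖u x‖)]
  · have := pow_le_pow_left₀ (norm_nonneg _) (hbd x hx) 2
    nlinarith [sq_nonneg ‖u 0‖]

/-- The equation `-u'' + u = f` on the half-line. -/
theorem exists_isW22_sub_eq {f : ℝ → ℂ} (hf : MemLp f 2 edgeMeasure) :
    ∃ u v : ℝ → ℂ, IsW22 u v (fun x => u x - f x) := by
  -- Factorization `-d²/dx² + 1 = (d/dx + 1)(1 - d/dx)`, with `w = u - u'`.
  obtain ⟨w, hw, hw'⟩ := exists_memLp_add_eq hf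
  obtain ⟨u, hu, hu'⟩ := exists_memLp_sub_eq hw (hf.sub hw) hw'
  exact ⟨u, fun x => u x - w x, hu, hu.sub hw, hu.sub hf, hu',
    (hu'.sub hw').congr_deriv fun x => by ring⟩

theorem memLp_cexp_neg : MemLp (fun x : ℝ => Complex.exp (-1 * x)) 2 edgeMeasure := by
  rw [memLp_two_iff_integrable_sq_norm (by fun_prop)]
  have : ∀ x : ℝ, ‖Complex.exp (-1 * x)‖ ^ 2 = Real.exp (-2 * x) := by
    intro x
    rw [Complex.norm_exp, ← Real.exp_nat_mul]
    simp
  simp only [this]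
  exact integrableOn_exp_mul_Ioi (by norm_num) 0

theorem isW22_cexp_neg : IsW22 (fun x : ℝ => Complex.exp (-1 * x))
    (fun x : ℝ => -1 * Complex.exp (-1 * x)) (fun x : ℝ => Complex.exp (-1 * x)) :=
  ⟨memLp_cexp_neg, memLp_cexp_neg.const_mul _, memLp_cexp_neg, hasACDeriv_cexp _,
    .of_on fun _ hb => by
      have := ((hasACDeriv_cexp (-1)).on hb).const_mul (-1)
      simpa using this⟩

/-! ### Split vertex conditions, Green's formula and self-adjointness. -/

theorem mem_schrodinger_graph (V : Fin 3 → ℝ → ℝ) (B : VertexCondition) (p : L2 × L2) :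
    p ∈ (schrodinger V B).graph ↔ p ∈ schrodingerGraph V B := by
  rw [schrodinger, Submodule.toLinearPMap_graph_eq _ fun x => schrodingerGraph_single V B x]

/-- Vertex values in `K`, derivatives in the annihilator of `K`. -/
def splitCondition (K : Submodule ℂ (Fin 3 → ℂ)) : VertexCondition where
  carrier := {b | b.1 ∈ K ∧ ∀ k ∈ K, ∑ n, k n * b.2 n = 0}
  zero_mem' := by simp
  add_mem' := by
    rintro b c ⟨hb, hb'⟩ ⟨hc, hc'⟩
    exact ⟨K.add_mem hb hc, fun k hk => by
      simp [mul_add, Finset.sum_add_distrib, hb' k hk, hc' k hk]⟩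
  smul_mem' := by
    rintro r b ⟨hb, hb'⟩
    refine ⟨K.smul_mem r hb, fun k hk => ?_⟩
    simp only [Prod.smul_snd, Pi.smul_apply, smul_eq_mul, mul_left_comm _ r]
    rw [← Finset.mul_sum, hb' k hk, mul_zero]

theorem mem_splitCondition {K : Submodule ℂ (Fin 3 → ℂ)} {b : (Fin 3 → ℂ) × (Fin 3 → ℂ)} :
    b ∈ splitCondition K ↔ b.1 ∈ K ∧ ∀ k ∈ K, ∑ n, k n * b.2 n = 0 := Iff.rfl

/-- A subspace of `ℂ ^ 3` that is stable under complex conjugation. -/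
def ConjStable (K : Submodule ℂ (Fin 3 → ℂ)) : Prop :=
  ∀ k ∈ K, (fun n => starRingEnd ℂ (k n)) ∈ K

/-- This is orthogonal projection onto `K`: for a conjugation-stable `K` the annihilator under the
bilinear pairing is the Hermitian orthogonal complement. -/
theorem ConjStable.exists_sub {K : Submodule ℂ (Fin 3 → ℂ)} (hK : ConjStable K)
    (d : Fin 3 → ℂ) : ∃ c ∈ K, ∀ k ∈ K, ∑ n, k n * (d n - c n) = 0 := by
  let e := (WithLp.linearEquiv 2 ℂ (Fin 3 → ℂ))
  obtain ⟨y, hy, z, hz, hyz⟩ := (K.comap e.toLinearMap).exists_add_mem_mem_orthogonal (e.symm d)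
  refine ⟨e y, hy, fun k hk => ?_⟩
  rw [Submodule.mem_orthogonal] at hz
  have h1 := hz (e.symm fun n => starRingEnd ℂ (k n)) (by
    simpa using hK k hk)
  rw [PiLp.inner_apply] at h1
  rw [← h1]
  refine Finset.sum_congr rfl fun n _ => ?_
  have h2 : d n - e y n = z n := by
    have : d = e y + e z := by rw [← map_add, ← hyz]; simp
    rw [this]
    simp [e]
  rw [h2]
  simp [e, mul_comm]

/-- The form of `-d²/dx²` on an edge: Green's formula. -/
theorem IsW22.green {u v w u' v' w' : ℝ → ℂ} (h : IsW22 u v w) (h' : IsW22 u' v' w') :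
    ∫ x in Ioi (0 : ℝ), (starRingEnd ℂ (w x) * u' x - starRingEnd ℂ (u x) * w' x)
      = starRingEnd ℂ (u 0) * v' 0 - starRingEnd ℂ (v 0) * u' 0 := by
  have ac := (h.deriv2.conj.mul h'.deriv).sub (h.deriv.conj.mul h'.deriv2)
  have hc : ∀ {f : ℝ → ℂ}, MemLp f 2 edgeMeasure →
      MemLp (fun x => starRingEnd ℂ (f x)) 2 edgeMeasure := fun hf =>
    hf.star
  have i : ∀ {f g : ℝ → ℂ}, MemLp f 2 edgeMeasure → MemLp g 2 edgeMeasure →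
      Integrable (fun x => starRingEnd ℂ (f x) * g x) edgeMeasure := fun hf hg =>
    MemLp.integrable_mul (hc hf) hg
  have := ac.integral_eq_neg
    ((i h.memLp_deriv h'.memLp).sub (i h.memLp h'.memLp_deriv))
    (((i h.memLp_deriv2 h'.memLp).add (i h.memLp_deriv h'.memLp_deriv)).sub
      ((i h.memLp_deriv h'.memLp_deriv).add (i h.memLp h'.memLp_deriv2)))
  rw [neg_sub] at this
  rw [← this]
  refine integral_congr_ae (Eventually.of_forall fun x => ?_)
  simp only
  ring

theorem inner_eq_sum (f g : L2) :
    inner ℂ f g = ∑ n, ∫ x in Ioi (0 : ℝ), starRingEnd ℂ (f n x) * g n x := by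
  rw [PiLp.inner_apply]
  refine Finset.sum_congr rfl fun n _ => ?_
  rw [MeasureTheory.L2.inner_def]
  refine integral_congr_ae (Eventually.of_forall fun x => ?_)
  simp [mul_comm]

/-- Each boundary term in Green's formula pairs an element of `K`, possibly conjugated, with an
annihilator of `K`. -/
theorem free_symmetric {K : Submodule ℂ (Fin 3 → ℂ)} (hK : ConjStable K) {x y x' y' : L2}
    (h : (x, y) ∈ (schrodinger (fun _ _ => 0) (splitCondition K)).graph)
    (h' : (x', y') ∈ (schrodinger (fun _ _ => 0) (splitCondition K)).graph) :
    inner ℂ y x' = inner ℂ x y' := by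
  rw [mem_schrodinger_graph] at h h'
  obtain ⟨u, v, w, hW, hB, h1, h2⟩ := h
  obtain ⟨u', v', w', hW', hB', h1', h2'⟩ := h'
  obtain ⟨hB1, hB2⟩ := mem_splitCondition.1 hB
  obtain ⟨hB1', hB2'⟩ := mem_splitCondition.1 hB'
  have hint : ∀ f g : Lp ℂ 2 edgeMeasure,
      Integrable (fun x => starRingEnd ℂ (f x) * g x) edgeMeasure := fun f g =>
    MemLp.integrable_mul (Lp.memLp f).star (Lp.memLp g)
  rw [← sub_eq_zero, inner_eq_sum, inner_eq_sum, ← Finset.sum_sub_distrib]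
  have key : ∀ n, (∫ t in Ioi (0 : ℝ), starRingEnd ℂ (y n t) * x' n t)
      - (∫ t in Ioi (0 : ℝ), starRingEnd ℂ (x n t) * y' n t)
      = starRingEnd ℂ (v n 0) * u' n 0 - starRingEnd ℂ (u n 0) * v' n 0 := by
    intro n
    rw [← integral_sub (hint _ _) (hint _ _), ← neg_sub, ← (hW n).green (hW' n), ← integral_neg]
    refine integral_congr_ae ?_
    filter_upwards [h1 n, h2 n, h1' n, h2' n] with t e1 e2 e3 e4
    rw [e1, e2, e3, e4]
    simp
    ring
  simp only [key]
  have s1 : ∑ n, starRingEnd ℂ (v n 0) * u' n 0 = 0 := by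
    have := congrArg (starRingEnd ℂ) (hB2 _ (hK _ hB1'))
    simpa [mul_comm] using this
  have s2 : ∑ n, starRingEnd ℂ (u n 0) * v' n 0 = 0 := hB2' _ (hK _ hB1)
  rw [Finset.sum_sub_distrib, s1, s2, sub_zero]

theorem isSelfAdjoint_free {K : Submodule ℂ (Fin 3 → ℂ)} (hK : ConjStable K) :
    IsSelfAdjoint (schrodinger (fun _ _ => 0) (splitCondition K)) := by
  refine isSelfAdjoint_of_symmetric_of_surjective
    (fun x y x' y' h h' => free_symmetric hK h h') fun f => ?_
  choose u v hW using fun n => exists_isW22_sub_eq (Lp.memLp (f n))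
  -- Adding `(c n - u n 0) e⁻ˣ` preserves the equation, makes the vertex value `c n` and the
  -- derivative `u n 0 + v n 0 - c n`. So `c` must be the projection of `u 0 + v 0` to `K`.
  obtain ⟨c, hc, hc'⟩ := hK.exists_sub (fun n => u n 0 + v n 0)
  have hW' := fun n => (hW n).add (isW22_cexp_neg.smul (c n - u n 0))
  have hmem := fun n => (hW' n).memLp
  refine ⟨WithLp.toLp 2 fun n => (hmem n).toLp _, f - WithLp.toLp 2 fun n => (hmem n).toLp _,
    ?_, by simp⟩
  rw [mem_schrodinger_graph]
  refine ⟨_, _, _, hW', mem_splitCondition.2 ⟨?_, ?_⟩, fun n => ?_, fun n => ?_⟩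
  · convert hc using 1
    funext n
    simp
  · intro k hk
    rw [← hc' k hk]
    refine Finset.sum_congr rfl fun n _ => ?_
    simp only [Pi.add_apply, Pi.smul_apply, smul_eq_mul, Complex.ofReal_zero, mul_zero,
      Complex.exp_zero]
    ring
  · exact (hmem n).coeFn_toLp
  · have e : (f - WithLp.toLp 2 fun n => (hmem n).toLp _ : L2) n = f n - (hmem n).toLp _ := rfl
    simp only [e]
    filter_upwards [Lp.coeFn_sub (f n) ((hmem n).toLp _), (hmem n).coeFn_toLp] with x h1 h2
    rw [h1, Pi.sub_apply, h2]
    simp only [Pi.add_apply, Pi.smul_apply, smul_eq_mul, Complex.ofReal_zero, zero_mul]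
    ring

theorem memLp_ofReal_mul {V : ℝ → ℝ} (hV : AEStronglyMeasurable V edgeMeasure) {M : ℝ}
    (hM : ∀ x, 0 < x → |V x| ≤ M) {f : ℝ → ℂ} (hf : MemLp f 2 edgeMeasure) :
    MemLp (fun x => (V x : ℂ) * f x) 2 edgeMeasure := by
  refine MemLp.of_le_mul (c := M) hf
    ((Complex.continuous_ofReal.comp_aestronglyMeasurable hV).mul hf.1) ?_
  filter_upwards [ae_restrict_mem measurableSet_Ioi] with x hx
  rw [norm_mul, Complex.norm_real, Real.norm_eq_abs]
  exact mul_le_mul_of_nonneg_right (hM x hx) (norm_nonneg _)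

/-- Adding a bounded potential preserves self-adjointness. -/
theorem isSelfAdjoint_schrodinger {K : Submodule ℂ (Fin 3 → ℂ)} (hK : ConjStable K)
    {V : Fin 3 → ℝ → ℝ} (hV : ∀ n, AEStronglyMeasurable (V n) edgeMeasure) {M : ℝ}
    (hM : ∀ n, ∀ x, 0 < x → |V n x| ≤ M) : IsSelfAdjoint (schrodinger V (splitCondition K)) := by
  have hmul : ∀ n (f : ℝ → ℂ), MemLp f 2 edgeMeasure →
      MemLp (fun x => (V n x : ℂ) * f x) 2 edgeMeasure := fun n f hf =>
    memLp_ofReal_mul (hV n) (hM n) hf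
  let A : L2 → L2 := fun f => WithLp.toLp 2 fun n => (hmul n _ (Lp.memLp (f n))).toLp _
  have hA : ∀ f n, (A f n : ℝ → ℂ) =ᵐ[edgeMeasure] fun x => (V n x : ℂ) * f n x :=
    fun f n => (hmul n _ (Lp.memLp (f n))).coeFn_toLp
  refine isSelfAdjoint_of_perturbation (isSelfAdjoint_free hK) A (fun f g => ?_) fun f g => ?_
  · rw [inner_eq_sum, inner_eq_sum]
    refine Finset.sum_congr rfl fun n _ => integral_congr_ae ?_
    filter_upwards [hA f n, hA g n] with x h1 h2
    rw [h1, h2]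
    simp
    ring
  · rw [mem_schrodinger_graph, mem_schrodinger_graph]
    have hsub : ∀ n, ((g - A f) n : ℝ → ℂ) =ᵐ[edgeMeasure] fun x => g n x - V n x * f n x := by
      intro n
      filter_upwards [Lp.coeFn_sub (g n) (A f n), hA f n] with x h1 h2
      change (g n - A f n : Lp ℂ 2 edgeMeasure) x = _
      rw [h1, Pi.sub_apply, h2]
    refine exists₃_congr fun u v w => and_congr_right fun _ => and_congr_right fun _ =>
      and_congr_right fun h1 => forall_congr' fun n => ?_
    have h1n := h1 n
    constructor
    · intro h2
      filter_upwards [h1n, h2, hsub n] with x e1 e2 e3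
      rw [e3, e2, e1]
      simp
    · intro h2
      filter_upwards [h1n, h2, hsub n] with x e1 e2 e3
      rw [e3, e1] at e2
      simp only [Complex.ofReal_zero, zero_mul, add_zero] at e2
      linear_combination e2

/-! ### The linear equation on the unit interval. -/

/-- `u'' = q u` on `[0, 1]`, with `v = u'`. -/
structure SolvesOn (q u v : ℝ → ℝ) : Prop where
  deriv : ∀ x ∈ Icc (0 : ℝ) 1, HasDerivWithinAt u (v x) (Icc 0 1) x
  deriv2 : ∀ x ∈ Icc (0 : ℝ) 1, HasDerivWithinAt v (q x * u x) (Icc 0 1) x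

/-- Clamping coordinates to `[-R, R]` makes a linear vector field globally bounded while keeping its
Lipschitz constant. -/
theorem abs_clamp_sub_le (R a b : ℝ) : |max (-R) (min R a) - max (-R) (min R b)| ≤ |a - b| :=
  (abs_max_sub_max_le_max _ _ _ _).trans (by
    simpa using abs_min_sub_min_le_max R a R b)

theorem abs_clamp_le {R : ℝ} (hR : 0 ≤ R) (a : ℝ) : |max (-R) (min R a)| ≤ R :=
  abs_le.2 ⟨le_max_left _ _, max_le (by linarith) (min_le_left _ _)⟩

theorem abs_clamp_le_abs {R : ℝ} (hR : 0 ≤ R) (a : ℝ) : |max (-R) (min R a)| ≤ |a| := by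
  have := abs_clamp_sub_le R a 0
  simpa [hR] using this

theorem clamp_eq {R a : ℝ} (h : |a| ≤ R) : max (-R) (min R a) = a := by
  rw [min_eq_right (abs_le.1 h).2, max_eq_right (abs_le.1 h).1]

/-- Picard–Lindelöf for the clamped field gives a solution on the whole interval. Grönwall bounds it
by `‖(c, d)‖ e^M = R`, so the clamp never acts and the solution solves the linear equation. -/
theorem exists_solvesOn_left {q : ℝ → ℝ} (hq : ContinuousOn q (Icc 0 1)) (c d : ℝ) :
    ∃ u v : ℝ → ℝ, SolvesOn q u v ∧ u 0 = c ∧ v 0 = d := by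
  obtain ⟨M₀, hM₀⟩ := isCompact_Icc.exists_bound_of_continuousOn hq
  set M := max 1 M₀ with hMdef
  have hM1 : 1 ≤ M := le_max_left _ _
  have hM : ∀ x ∈ Icc (0 : ℝ) 1, |q x| ≤ M := fun x hx => (hM₀ x hx).trans (le_max_right _ _)
  set R := ‖(c, d)‖ * Real.exp M with hRdef
  have hR : 0 ≤ R := by positivity
  let cl : ℝ → ℝ := fun a => max (-R) (min R a)
  let f : ℝ → ℝ × ℝ → ℝ × ℝ := fun t y => (cl y.2, q t * cl y.1)
  have hfR : ∀ t ∈ Icc (0 : ℝ) 1, ∀ y, ‖f t y‖ ≤ M * R := by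
    intro t ht y
    refine max_le ?_ ?_
    · exact (abs_clamp_le hR _).trans (by nlinarith)
    · rw [norm_mul]
      exact mul_le_mul (hM t ht) (abs_clamp_le hR _) (abs_nonneg _) (by linarith)
  have hfy : ∀ t ∈ Icc (0 : ℝ) 1, ∀ y, ‖f t y‖ ≤ M * ‖y‖ := by
    intro t ht y
    refine max_le ?_ ?_
    · refine (abs_clamp_le_abs hR _).trans ?_
      have : |y.2| ≤ ‖y‖ := norm_snd_le y
      nlinarith [norm_nonneg y]
    · rw [norm_mul]
      exact mul_le_mul (hM t ht) ((abs_clamp_le_abs hR _).trans (norm_fst_le y)) (abs_nonneg _)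
        (by linarith)
  -- The field is bounded by `M * R` and the interval has length one, so a ball of radius `M * R`
  -- about the initial point contains the trajectory.
  have hPL : IsPicardLindelof f (⟨0, by simp⟩ : Icc (0 : ℝ) 1) (c, d)
      (Real.toNNReal (M * R)) 0 (Real.toNNReal (M * R)) (Real.toNNReal M) := by
    refine ⟨fun t ht => ?_, fun y _ => ?_, fun t ht y _ => ?_, ?_⟩
    · refine LipschitzWith.lipschitzOnWith (LipschitzWith.of_dist_le_mul fun y z => ?_)
      rw [Real.coe_toNNReal _ (by linarith), dist_eq_norm, dist_eq_norm]
      refine max_le ?_ ?_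
      · refine (abs_clamp_sub_le R _ _).trans ?_
        have : |(y - z).2| ≤ ‖y - z‖ := norm_snd_le (y - z)
        rw [Prod.snd_sub] at this
        nlinarith [norm_nonneg (y - z)]
      · have : |(y - z).1| ≤ ‖y - z‖ := norm_fst_le (y - z)
        change ‖q t * cl y.1 - q t * cl z.1‖ ≤ _
        rw [← mul_sub, norm_mul]
        exact mul_le_mul (hM t ht) ((abs_clamp_sub_le R _ _).trans this) (abs_nonneg _)
          (by linarith)
    · exact continuousOn_const.prodMk (hq.mul continuousOn_const)
    · rw [Real.coe_toNNReal _ (by positivity)]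
      exact hfR t ht y
    · simp
  obtain ⟨γ, hγ0, hγ⟩ := hPL.exists_eq_forall_mem_Icc_hasDerivWithinAt₀
  have hbd : ∀ x ∈ Icc (0 : ℝ) 1, ‖γ x‖ ≤ R := by
    intro x hx
    have := norm_le_gronwallBound_of_norm_deriv_right_le (f := γ) (f' := fun t => f t (γ t))
      (δ := ‖(c, d)‖) (K := M) (ε := 0) (a := 0) (b := 1)
      (fun t ht => (hγ t ht).continuousWithinAt)
      (fun t ht => (hγ t (Ico_subset_Icc_self ht)).mono_of_mem_nhdsWithin
        (Icc_mem_nhdsGE_of_mem ht))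
      (le_of_eq (by rw [show γ 0 = (c, d) from hγ0]))
      (fun t ht => by simpa using hfy t (Ico_subset_Icc_self ht) (γ t)) x hx
    rw [gronwallBound_ε0] at this
    refine this.trans ?_
    rw [hRdef]
    gcongr
    nlinarith [hx.2, hx.1]
  refine ⟨fun x => (γ x).1, fun x => (γ x).2, ⟨fun x hx => ?_, fun x hx => ?_⟩, ?_, ?_⟩
  · have h1 := (hasFDerivAt_fst (p := γ x)).comp_hasDerivWithinAt (𝕜 := ℝ) x (hγ x hx)
    have e : cl (γ x).2 = (γ x).2 := clamp_eq ((norm_snd_le _).trans (hbd x hx))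
    simpa [f, e, Function.comp_def] using h1
  · have h1 := (hasFDerivAt_snd (p := γ x)).comp_hasDerivWithinAt (𝕜 := ℝ) x (hγ x hx)
    have e : cl (γ x).1 = (γ x).1 := clamp_eq ((norm_fst_le _).trans (hbd x hx))
    simpa [f, e, Function.comp_def] using h1
  · exact congrArg Prod.fst hγ0
  · exact congrArg Prod.snd hγ0

/-- The reflection `x ↦ 1 - x` moves the initial point to `1` and reverses the sign of the
derivative. -/
theorem exists_solvesOn {q : ℝ → ℝ} (hq : ContinuousOn q (Icc 0 1)) (c d : ℝ) :
    ∃ u v : ℝ → ℝ, SolvesOn q u v ∧ u 1 = c ∧ v 1 = d := by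
  have hmaps : MapsTo (fun x : ℝ => 1 - x) (Icc 0 1) (Icc 0 1) := fun x hx =>
    ⟨by linarith [hx.2], by linarith [hx.1]⟩
  obtain ⟨u, v, h, h0, h1⟩ := exists_solvesOn_left
    (hq.comp (by fun_prop : ContinuousOn (fun x : ℝ => 1 - x) (Icc 0 1)) hmaps) c (-d)
  have hd : ∀ x ∈ Icc (0 : ℝ) 1, HasDerivWithinAt (fun x : ℝ => 1 - x) (-1) (Icc 0 1) x :=
    fun x _ => ((hasDerivAt_id x).const_sub 1).hasDerivWithinAt
  refine ⟨fun x => u (1 - x), fun x => -v (1 - x), ⟨fun x hx => ?_, fun x hx => ?_⟩, ?_, ?_⟩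
  · have := (h.deriv (1 - x) (hmaps hx)).scomp x (hd x hx) hmaps
    simpa [Function.comp_def] using this
  · have := ((h.deriv2 (1 - x) (hmaps hx)).scomp x (hd x hx) hmaps).fun_neg
    simpa [Function.comp_def] using this
  · simpa using h0
  · simp [h1]

theorem SolvesOn.wronskian_eq {q u₁ v₁ u₂ v₂ : ℝ → ℝ} (h₁ : SolvesOn q u₁ v₁)
    (h₂ : SolvesOn q u₂ v₂) {x : ℝ} (hx : x ∈ Icc (0 : ℝ) 1) :
    u₁ x * v₂ x - v₁ x * u₂ x = u₁ 1 * v₂ 1 - v₁ 1 * u₂ 1 := by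
  have hd : ∀ x ∈ Icc (0 : ℝ) 1,
      HasDerivWithinAt (fun x => u₁ x * v₂ x - v₁ x * u₂ x) 0 (Icc 0 1) x := by
    intro x hx
    refine (((h₁.deriv x hx).mul (h₂.deriv2 x hx)).sub
      ((h₁.deriv2 x hx).mul (h₂.deriv x hx))).congr_deriv ?_
    ring
  have hc := constant_of_derivWithin_zero (fun x hx => (hd x hx).differentiableWithinAt)
    (fun x hx => (hd x (Ico_subset_Icc_self hx)).derivWithin
      (uniqueDiffOn_Icc zero_lt_one x (Ico_subset_Icc_self hx)))
  exact (hc x hx).trans (hc 1 ⟨zero_le_one, le_rfl⟩).symm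

/-- Solutions of `u'' = q u` on `[0, 1]`, normalized at `1`. -/
structure FundamentalSystem (q : ℝ → ℝ) where
  p : ℝ → ℝ
  p' : ℝ → ℝ
  s : ℝ → ℝ
  s' : ℝ → ℝ
  solves_p : SolvesOn q p p'
  solves_s : SolvesOn q s s'
  p_one : p 1 = 1
  p'_one : p' 1 = 0
  s_one : s 1 = 0
  s'_one : s' 1 = 1

namespace FundamentalSystem

variable {q : ℝ → ℝ}

theorem nonempty (hq : ContinuousOn q (Icc 0 1)) : Nonempty (FundamentalSystem q) := by
  obtain ⟨p, p', hp, h1, h2⟩ := exists_solvesOn hq 1 0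
  obtain ⟨s, s', hs, h3, h4⟩ := exists_solvesOn hq 0 1
  exact ⟨⟨p, p', s, s', hp, hs, h1, h2, h3, h4⟩⟩

theorem wronskian (F : FundamentalSystem q) {x : ℝ} (hx : x ∈ Icc (0 : ℝ) 1) :
    F.p x * F.s' x - F.p' x * F.s x = 1 := by
  rw [F.solves_p.wronskian_eq F.solves_s hx, F.p_one, F.p'_one, F.s'_one]
  ring

/-- A solution with `u'(1) = 0` is a multiple of `p`. -/
theorem eq_of_deriv_one_eq_zero (F : FundamentalSystem q) {u v : ℝ → ℝ} (h : SolvesOn q u v)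
    (h1 : v 1 = 0) {x : ℝ} (hx : x ∈ Icc (0 : ℝ) 1) :
    u x = u 1 * F.p x ∧ v x = u 1 * F.p' x := by
  -- The constant Wronskians give `u s' - v s = u 1` and `p v - p' u = 0`, a linear system for `(u,
  -- v)` of determinant one.
  have e₁ := h.wronskian_eq F.solves_s hx
  have e₂ := F.solves_p.wronskian_eq h hx
  have e₃ := F.wronskian hx
  rw [h1, F.s'_one, F.s_one] at e₁
  rw [h1, F.p'_one, F.p_one] at e₂
  constructor
  · linear_combination F.p x * e₁ + F.s x * e₂ - u x * e₃
  · linear_combination F.p' x * e₁ + F.s' x * e₂ - v x * e₃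

theorem exists_bound (F : FundamentalSystem q) :
    ∃ M : ℝ, ∀ x ∈ Icc (0 : ℝ) 1, |F.p x| ≤ M ∧ |F.p' x| ≤ M ∧ |F.s x| ≤ M ∧ |F.s' x| ≤ M := by
  have hb : ∀ {u v : ℝ → ℝ}, (∀ x ∈ Icc (0 : ℝ) 1, HasDerivWithinAt u (v x) (Icc 0 1) x) →
      ∃ M : ℝ, ∀ x ∈ Icc (0 : ℝ) 1, |u x| ≤ M := fun h =>
    isCompact_Icc.exists_bound_of_continuousOn fun x hx => (h x hx).continuousWithinAt
  obtain ⟨M₁, h₁⟩ := hb F.solves_p.deriv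
  obtain ⟨M₂, h₂⟩ := hb F.solves_p.deriv2
  obtain ⟨M₃, h₃⟩ := hb F.solves_s.deriv
  obtain ⟨M₄, h₄⟩ := hb F.solves_s.deriv2
  exact ⟨max (max M₁ M₂) (max M₃ M₄), fun x hx => ⟨by simp [h₁ x hx], by simp [h₂ x hx],
    by simp [h₃ x hx], by simp [h₄ x hx]⟩⟩

end FundamentalSystem

/-! ### The named vertex conditions as split conditions. -/

section Conditions

theorem mem_kirchhoff {b : (Fin 3 → ℂ) × (Fin 3 → ℂ)} :
    b ∈ kirchhoff ↔ (∀ m n, b.1 m = b.1 n) ∧ ∑ n, b.2 n = 0 := Iff.rfl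

theorem kirchhoff_eq_splitCondition :
    kirchhoff = splitCondition (Submodule.span ℂ {fun _ => 1}) := by
  ext b
  rw [mem_kirchhoff, mem_splitCondition, Submodule.mem_span_singleton]
  constructor
  · rintro ⟨h1, h2⟩
    refine ⟨⟨b.1 0, ?_⟩, fun k hk => ?_⟩
    · funext n
      simp [h1 n 0]
    · obtain ⟨r, rfl⟩ := Submodule.mem_span_singleton.1 hk
      simp [← Finset.mul_sum, h2]
  · rintro ⟨⟨r, hr⟩, h2⟩
    refine ⟨fun m n => by simp [← hr], ?_⟩
    simpa using h2 _ (Submodule.mem_span_singleton_self _)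

theorem dirichlet_eq_splitCondition : dirichlet = splitCondition ⊥ := by
  ext b
  rw [mem_splitCondition, Submodule.mem_bot]
  refine ⟨fun h => ⟨funext h, fun k hk => ?_⟩, fun h n => congrFun h.1 n⟩
  rw [Submodule.mem_bot] at hk
  simp [hk]

theorem simpleCondition_eq_splitCondition {θ : Fin 3 → ℝ} (hθ : θ ≠ 0) :
    simpleCondition θ = splitCondition (Submodule.span ℂ {fun n => (θ n : ℂ)}) := by
  obtain ⟨m, hm⟩ := Function.ne_iff.1 hθ
  have hm' : (θ m : ℂ) ≠ 0 := by simpa using hm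
  ext b
  rw [mem_splitCondition, Submodule.mem_span_singleton]
  change Proportional θ b.1 ∧ ∑ n, (θ n : ℂ) * b.2 n = 0 ↔ _
  constructor
  · rintro ⟨h1, h2⟩
    refine ⟨⟨b.1 m / θ m, ?_⟩, fun k hk => ?_⟩
    · funext n
      have := h1 m n
      simp only [Pi.smul_apply, smul_eq_mul]
      field_simp
      linear_combination -this
    · obtain ⟨r, rfl⟩ := Submodule.mem_span_singleton.1 hk
      simp only [Pi.smul_apply, smul_eq_mul, mul_assoc]
      rw [← Finset.mul_sum, h2, mul_zero]
  · rintro ⟨⟨r, hr⟩, h2⟩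
    refine ⟨fun i j => ?_, h2 _ (Submodule.mem_span_singleton_self _)⟩
    rw [← hr]
    simp only [Pi.smul_apply, smul_eq_mul]
    ring

/-- The plane spanned by `e` and `f` is the annihilator of `θ = e × f`, and its own annihilator is
the line of `θ`. As `θ` is real and nonzero, its bilinear square is nonzero, so one may divide by it
over `ℂ`. -/
theorem doubleCondition_eq_splitCondition {e f : Fin 3 → ℝ} (hef : crossProduct e f ≠ 0) :
    doubleCondition (crossProduct e f)
      = splitCondition (Submodule.span ℂ {fun n => (e n : ℂ), fun n => (f n : ℂ)}) := by
  obtain ⟨m, hm⟩ := Function.ne_iff.1 hef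
  have hm' : ((crossProduct e f m : ℝ) : ℂ) ≠ 0 :=
    Complex.ofReal_ne_zero.2 hm
  have t0 : crossProduct e f 0 = e 1 * f 2 - e 2 * f 1 := by simp [cross_apply]
  have t1 : crossProduct e f 1 = e 2 * f 0 - e 0 * f 2 := by simp [cross_apply]
  have t2 : crossProduct e f 2 = e 0 * f 1 - e 1 * f 0 := by simp [cross_apply]
  have hnorm : ((crossProduct e f 0 : ℂ)) ^ 2 + (crossProduct e f 1 : ℂ) ^ 2
      + (crossProduct e f 2 : ℂ) ^ 2 ≠ 0 := by
    norm_cast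
    intro h0
    apply hm
    have h00 : crossProduct e f 0 = 0 := by
      nlinarith [sq_nonneg (crossProduct e f 0), sq_nonneg (crossProduct e f 1),
        sq_nonneg (crossProduct e f 2)]
    have h01 : crossProduct e f 1 = 0 := by
      nlinarith [sq_nonneg (crossProduct e f 0), sq_nonneg (crossProduct e f 1),
        sq_nonneg (crossProduct e f 2)]
    have h02 : crossProduct e f 2 = 0 := by
      nlinarith [sq_nonneg (crossProduct e f 0), sq_nonneg (crossProduct e f 1),
        sq_nonneg (crossProduct e f 2)]
    fin_cases m
    · exact h00
    · exact h01
    · exact h02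
  set θ := crossProduct e f with hθ
  have c0 : (θ 0 : ℂ) = e 1 * f 2 - e 2 * f 1 := by rw [t0]; push_cast; ring
  have c1 : (θ 1 : ℂ) = e 2 * f 0 - e 0 * f 2 := by rw [t1]; push_cast; ring
  have c2 : (θ 2 : ℂ) = e 0 * f 1 - e 1 * f 0 := by rw [t2]; push_cast; ring
  ext b
  rw [mem_splitCondition]
  change Proportional θ b.2 ∧ ∑ n, (θ n : ℂ) * b.1 n = 0 ↔ _
  have hann : (∀ k ∈ Submodule.span ℂ {fun n => (e n : ℂ), fun n => (f n : ℂ)},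
      ∑ n, k n * b.2 n = 0) ↔ ∑ n, (e n : ℂ) * b.2 n = 0 ∧ ∑ n, (f n : ℂ) * b.2 n = 0 := by
    constructor
    · exact fun h => ⟨h _ (Submodule.subset_span (by simp)), h _ (Submodule.subset_span (by simp))⟩
    · rintro ⟨h1, h2⟩ k hk
      obtain ⟨x, y, rfl⟩ := Submodule.mem_span_pair.1 hk
      simp only [Pi.add_apply, Pi.smul_apply, smul_eq_mul, add_mul, Finset.sum_add_distrib,
        mul_assoc, ← Finset.mul_sum, h1, h2, mul_zero, add_zero]
  rw [hann, Submodule.mem_span_pair]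
  simp only [Fin.sum_univ_three]
  constructor
  · rintro ⟨h1, h2⟩
    have hb : ∀ n, (θ m : ℂ) * b.2 n = θ n * b.2 m := h1 m
    refine ⟨?_, ?_, ?_⟩
    · set D := (θ 0 : ℂ) ^ 2 + (θ 1 : ℂ) ^ 2 + (θ 2 : ℂ) ^ 2 with hD
      -- `X = b.1 × θ`. As `b.1` annihilates `θ`, the double vector product gives `D b.1 = θ × X =
      -- (e × f) × X`, and expanding once more gives the coefficients of `e` and `f`.
      let X : Fin 3 → ℂ := ![b.1 1 * θ 2 - b.1 2 * θ 1, b.1 2 * θ 0 - b.1 0 * θ 2,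
        b.1 0 * θ 1 - b.1 1 * θ 0]
      have X0 : X 0 = b.1 1 * θ 2 - b.1 2 * θ 1 := rfl
      have X1 : X 1 = b.1 2 * θ 0 - b.1 0 * θ 2 := rfl
      have X2 : X 2 = b.1 0 * θ 1 - b.1 1 * θ 0 := rfl
      have key : ∀ n, D * b.1 n = -(X 0 * f 0 + X 1 * f 1 + X 2 * f 2) * e n
          + (X 0 * e 0 + X 1 * e 1 + X 2 * e 2) * f n := by
        intro n
        rw [X0, X1, X2, hD]
        fin_cases n <;> simp only [Fin.mk_zero, Fin.mk_one, Fin.reduceFinMk]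
        · linear_combination (θ 0 : ℂ) * h2 - (b.1 2 * θ 0 - b.1 0 * θ 2) * c2
            + (b.1 0 * θ 1 - b.1 1 * θ 0) * c1
        · linear_combination (θ 1 : ℂ) * h2 - (b.1 0 * θ 1 - b.1 1 * θ 0) * c0
            + (b.1 1 * θ 2 - b.1 2 * θ 1) * c2
        · linear_combination (θ 2 : ℂ) * h2 - (b.1 1 * θ 2 - b.1 2 * θ 1) * c1
            + (b.1 2 * θ 0 - b.1 0 * θ 2) * c0
      refine ⟨-(X 0 * f 0 + X 1 * f 1 + X 2 * f 2) / D, (X 0 * e 0 + X 1 * e 1 + X 2 * e 2) / D,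
        funext fun n => ?_⟩
      simp only [Pi.add_apply, Pi.smul_apply, smul_eq_mul]
      field_simp
      linear_combination -key n
    · refine mul_left_cancel₀ hm' ?_
      linear_combination (e 0 : ℂ) * hb 0 + e 1 * hb 1 + e 2 * hb 2
        + b.2 m * (e 0 * c0 + e 1 * c1 + e 2 * c2)
    · refine mul_left_cancel₀ hm' ?_
      linear_combination (f 0 : ℂ) * hb 0 + f 1 * hb 1 + f 2 * hb 2
        + b.2 m * (f 0 * c0 + f 1 * c1 + f 2 * c2)
  · rintro ⟨⟨x, y, hxy⟩, h1, h2⟩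
    have hb : ∀ n, b.1 n = x * e n + y * f n := fun n => by
      rw [← hxy]; simp
    have k01 : (θ 0 : ℂ) * b.2 1 = θ 1 * b.2 0 := by
      rw [c0, c1]; linear_combination (f 2 : ℂ) * h1 - (e 2 : ℂ) * h2
    have k12 : (θ 1 : ℂ) * b.2 2 = θ 2 * b.2 1 := by
      rw [c1, c2]; linear_combination (f 0 : ℂ) * h1 - (e 0 : ℂ) * h2
    have k20 : (θ 2 : ℂ) * b.2 0 = θ 0 * b.2 2 := by
      rw [c0, c2]; linear_combination (f 1 : ℂ) * h1 - (e 1 : ℂ) * h2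
    refine ⟨fun i j => ?_, ?_⟩
    · fin_cases i <;> fin_cases j <;>
        first
          | rfl
          | exact k01
          | exact k12
          | exact k20
          | exact k01.symm
          | exact k12.symm
          | exact k20.symm
    · rw [hb, hb, hb, c0, c1, c2]
      ring

end Conditions

/-! ### The Weyl relation of the unit star and the resonance cases. -/

section Weyl

variable {α : ℝ} {Q : Fin 3 → ℝ → ℝ} (F : ∀ n, FundamentalSystem fun x => α * Q n x)

/-- From values and derivatives at distance one to values and derivatives at the vertex. -/
def transfer : ((Fin 3 → ℂ) × (Fin 3 → ℂ)) →ₗ[ℂ] (Fin 3 → ℂ) × (Fin 3 → ℂ) where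
  toFun b := (fun n => b.1 n * (F n).p 0 + b.2 n * (F n).s 0,
    fun n => b.1 n * (F n).p' 0 + b.2 n * (F n).s' 0)
  map_add' b c := by
    ext n <;> simp <;> ring
  map_smul' k b := by
    ext n <;> simp <;> ring

/-- Values and derivatives at distance one of solutions that satisfy the Kirchhoff conditions. -/
def weyl : Submodule ℂ ((Fin 3 → ℂ) × (Fin 3 → ℂ)) := kirchhoff.comap (transfer F)

/-- Values at distance one of half-bound states. -/
def resonantValues : Submodule ℂ (Fin 3 → ℂ) := (weyl F).comap (LinearMap.inl ℂ _ _)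

theorem mem_weyl {b : (Fin 3 → ℂ) × (Fin 3 → ℂ)} : b ∈ weyl F ↔
    (∀ m n, b.1 m * (F m).p 0 + b.2 m * (F m).s 0 = b.1 n * (F n).p 0 + b.2 n * (F n).s 0) ∧
      ∑ n, (b.1 n * (F n).p' 0 + b.2 n * (F n).s' 0) = 0 := Iff.rfl

theorem mem_resonantValues {k : Fin 3 → ℂ} : k ∈ resonantValues F ↔
    (∀ m n, k m * (F m).p 0 = k n * (F n).p 0) ∧ ∑ n, k n * (F n).p' 0 = 0 := by
  rw [resonantValues, Submodule.mem_comap, mem_weyl]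
  simp

theorem conjStable_resonantValues : ConjStable (resonantValues F) := by
  intro k hk
  rw [mem_resonantValues] at hk ⊢
  refine ⟨fun m n => ?_, ?_⟩
  · simpa using congrArg (starRingEnd ℂ) (hk.1 m n)
  · simpa using congrArg (starRingEnd ℂ) hk.2

/-- The Weyl relation contains the solution with given data at the vertex. -/
theorem solution_mem_weyl {b : (Fin 3 → ℂ) × (Fin 3 → ℂ)} (hb : b ∈ kirchhoff) :
    ((fun n => b.1 n * (F n).s' 0 - b.2 n * (F n).s 0,
      fun n => b.2 n * (F n).p 0 - b.1 n * (F n).p' 0) : (Fin 3 → ℂ) × (Fin 3 → ℂ)) ∈ weyl F := by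
  have hW : ∀ n, ((F n).p 0 : ℂ) * (F n).s' 0 - (F n).p' 0 * (F n).s 0 = 1 := fun n => by
    exact_mod_cast (F n).wronskian (x := 0) (by simp)
  rw [weyl, Submodule.mem_comap]
  convert hb using 1
  refine Prod.ext (funext fun n => ?_) (funext fun n => ?_)
  · simp only [transfer, LinearMap.coe_mk, AddHom.coe_mk]
    linear_combination b.1 n * hW n
  · simp only [transfer, LinearMap.coe_mk, AddHom.coe_mk]
    linear_combination b.2 n * hW n

/-- The Weyl relation is maximal isotropic. -/
theorem mem_resonantValues_of_forall {k : Fin 3 → ℂ}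
    (h : ∀ b ∈ weyl F, ∑ n, k n * b.2 n = 0) : k ∈ resonantValues F := by
  rw [mem_resonantValues]
  constructor
  · have : ∀ m n, m ≠ n → k m * (F m).p 0 = k n * (F n).p 0 := by
      intro m n hmn
      -- Test solution with zero vertex values and a unit flux from edge `n` to edge `m`; its
      -- derivatives at distance one are `p 0` and `-p 0` on these two edges.
      have h1 := h _ (solution_mem_weyl F
        (b := (0, fun j => (if j = m then 1 else 0) - if j = n then 1 else 0)) (by
          rw [mem_kirchhoff]
          simp))
      simp [sub_mul, mul_sub, Finset.sum_sub_distrib] at h1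
      exact sub_eq_zero.1 h1
    intro m n
    by_cases hmn : m = n
    · rw [hmn]
    · exact this m n hmn
  -- Test solution with vertex value one and zero derivatives; its derivatives at distance one are
  -- `-p' 0`.
  · have h1 := h _ (solution_mem_weyl F (b := (fun _ => 1, 0)) (by
      rw [mem_kirchhoff]; simp))
    simpa using h1

/-- Otherwise a linear functional separates `d` from the attainable derivatives. Its coefficient
vector annihilates all of these, so maximal isotropy puts it in `resonantValues F`, and then it
annihilates `d` as well. -/
theorem exists_weyl_of_annihilates {d : Fin 3 → ℂ}
    (hd : ∀ k ∈ resonantValues F, ∑ n, k n * d n = 0) :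
    d ∈ (weyl F).map (LinearMap.snd ℂ (Fin 3 → ℂ) (Fin 3 → ℂ)) := by
  by_contra hcon
  obtain ⟨φ, hφ, hle⟩ := Submodule.exists_le_ker_of_notMem hcon
  have hrep : ∀ c : Fin 3 → ℂ, φ c = ∑ n, φ (Pi.single n 1) * c n := by
    intro c
    conv_lhs => rw [← Finset.univ_sum_single c]
    rw [map_sum]
    refine Finset.sum_congr rfl fun n _ => ?_
    have : (Pi.single n (c n) : Fin 3 → ℂ) = c n • Pi.single n 1 := by
      rw [← Pi.single_smul, smul_eq_mul, mul_one]
    rw [this, map_smul, smul_eq_mul, mul_comm]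
  refine hφ ?_
  rw [hrep]
  refine hd _ (mem_resonantValues_of_forall F fun b hb => ?_)
  rw [← hrep]
  exact hle ⟨b, hb, rfl⟩

/-- A bounded choice of solutions with given derivatives at distance one. -/
theorem exists_bounded_weyl : ∃ C : ℝ, 0 ≤ C ∧ ∀ d : Fin 3 → ℂ,
    (∀ k ∈ resonantValues F, ∑ n, k n * d n = 0) →
      ∃ c : Fin 3 → ℂ, (c, d) ∈ weyl F ∧ ‖c‖ ≤ C * ‖d‖ := by
  let S : weyl F →ₗ[ℂ] (Fin 3 → ℂ) := (LinearMap.snd ℂ _ _).comp (weyl F).subtype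
  -- A linear choice of preimages is automatically continuous in finite dimension; its norm is the
  -- constant.
  obtain ⟨g, hg⟩ := S.rangeRestrict.exists_rightInverse_of_surjective S.range_rangeRestrict
  let G : S.range →ₗ[ℂ] (Fin 3 → ℂ) :=
    ((LinearMap.fst ℂ _ _).comp (weyl F).subtype).comp g
  let G' : S.range →L[ℂ] (Fin 3 → ℂ) := G.toContinuousLinearMap
  refine ⟨‖G'‖, G'.opNorm_nonneg, fun d hd => ?_⟩
  obtain ⟨b, hb, rfl⟩ := exists_weyl_of_annihilates F hd
  let d' : S.range := ⟨b.2, ⟨⟨b, hb⟩, rfl⟩⟩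
  refine ⟨G d', ?_, G'.le_opNorm d'⟩
  have h1 : S (g d') = b.2 := by
    have := LinearMap.congr_fun hg d'
    exact congrArg Subtype.val this
  have h2 : (g d' : (Fin 3 → ℂ) × (Fin 3 → ℂ)) = (G d', b.2) := Prod.ext rfl h1
  change (G d', b.2) ∈ weyl F
  rw [← h2]
  exact (g d').2

/-- A solution with zero derivative at distance one is `θ n * p` on each edge, so only the Kirchhoff
conditions at the vertex remain. -/
theorem exists_mem_resonanceSpace_iff (θ : Fin 3 → ℝ) :
    (fun n => (θ n : ℂ)) ∈ resonantValues F ↔ ∃ φ ∈ resonanceSpace α Q, endValues φ = θ := by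
  have h0 : (0 : ℝ) ∈ Icc (0 : ℝ) 1 := by simp
  have h1 : (1 : ℝ) ∈ Icc (0 : ℝ) 1 := by simp
  rw [mem_resonantValues]
  norm_cast
  constructor
  · rintro ⟨hc, hs⟩
    have hext : ∀ n, EqOn (IccExtend zero_le_one fun x : Icc (0 : ℝ) 1 => θ n * (F n).p x)
        (fun x => θ n * (F n).p x) (Icc 0 1) := fun n x hx => by
      rw [IccExtend_of_mem _ _ hx]
    refine ⟨fun n x => θ n * (F n).p x, ⟨fun n x => θ n * (F n).p' x, fun n x hx => ?_,
      fun n x hx => ?_, fun m n => ?_, hs, fun n => ?_⟩, ?_⟩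
    · exact (((F n).solves_p.deriv x hx).const_mul (θ n)).congr (hext n) (hext n hx)
    · refine (((F n).solves_p.deriv2 x hx).const_mul (θ n)).congr_deriv ?_
      simp only [hext n hx]
      ring
    · simp only [hext m h0, hext n h0]
      exact hc m n
    · simp only [(F n).p'_one, mul_zero]
    · funext n
      simp [endValues, (F n).p_one]
  · rintro ⟨φ, ⟨v, hv1, hv2, hc, hs, he⟩, rfl⟩
    have hsol : ∀ n, SolvesOn (fun x => α * Q n x) (IccExtend zero_le_one (φ n)) (v n) :=
      fun n => ⟨hv1 n, hv2 n⟩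
    have hend : ∀ n, IccExtend (zero_le_one (α := ℝ)) (φ n) 1 = endValues φ n := fun n => by
      rw [IccExtend_of_mem _ _ h1]; rfl
    have key := fun n => (F n).eq_of_deriv_one_eq_zero (hsol n) (he n) h0
    simp only [hend] at key
    refine ⟨fun m n => ?_, ?_⟩
    · rw [← (key m).1, ← (key n).1]; exact hc m n
    · exact (Finset.sum_congr rfl fun n _ => (key n).2.symm).trans hs

/-- Uniqueness for the Cauchy problem at distance one, where the derivative vanishes already. -/
theorem eq_zero_of_endValues (F : ∀ n, FundamentalSystem fun x => α * Q n x)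
    {φ : Fin 3 → Icc (0 : ℝ) 1 → ℝ} (hφ : φ ∈ resonanceSpace α Q)
    (h : endValues φ = 0) : φ = 0 := by
  obtain ⟨v, hv1, hv2, hc, hs, he⟩ := hφ
  funext n x
  have hend : IccExtend (zero_le_one (α := ℝ)) (φ n) 1 = endValues φ n := by
    rw [IccExtend_of_mem _ _ (by simp)]; rfl
  have key := (F n).eq_of_deriv_one_eq_zero (⟨hv1 n, hv2 n⟩ : SolvesOn (fun x => α * Q n x)
    (IccExtend zero_le_one (φ n)) (v n)) (he n) x.2
  rw [hend, h, IccExtend_of_mem _ _ x.2] at key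
  simpa using key.1

theorem endValues_add (φ ψ : Fin 3 → Icc (0 : ℝ) 1 → ℝ) :
    endValues (φ + ψ) = endValues φ + endValues ψ := rfl

theorem endValues_smul (r : ℝ) (φ : Fin 3 → Icc (0 : ℝ) 1 → ℝ) :
    endValues (r • φ) = r • endValues φ := rfl

/-- The equations defining `resonantValues F` are real, so the real and imaginary parts of a
solution are again solutions, and real solutions come from `resonanceSpace`. -/
theorem resonantValues_eq_span {S : Set (Fin 3 → Icc (0 : ℝ) 1 → ℝ)}
    (hS : resonanceSpace α Q = Submodule.span ℝ S) :
    resonantValues F = Submodule.span ℂ ((fun φ n => (endValues φ n : ℂ)) '' S) := by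
  apply le_antisymm
  · have hreal : ∀ φ ∈ resonanceSpace α Q, (fun n => (endValues φ n : ℂ)) ∈
        Submodule.span ℂ ((fun φ n => (endValues φ n : ℂ)) '' S) := by
      intro φ hφ
      rw [hS] at hφ
      induction hφ using Submodule.span_induction with
      | mem φ h => exact Submodule.subset_span ⟨φ, h, rfl⟩
      | zero =>
        convert Submodule.zero_mem _ using 1
        funext n; simp [endValues]
      | add φ ψ _ _ h1 h2 =>
        convert Submodule.add_mem _ h1 h2 using 1
        funext n; simp [endValues]
      | smul r φ _ h =>
        convert Submodule.smul_mem _ (r : ℂ) h using 1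
        funext n; simp [endValues]
    intro k hk
    have hk' := conjStable_resonantValues F k hk
    have hre : (fun n => ((k n).re : ℂ)) ∈ resonantValues F := by
      convert (resonantValues F).smul_mem (2⁻¹ : ℂ) ((resonantValues F).add_mem hk hk') using 1
      funext n
      simp [Complex.add_conj]
    have him : (fun n => ((k n).im : ℂ)) ∈ resonantValues F := by
      convert (resonantValues F).smul_mem ((2 * Complex.I)⁻¹ : ℂ)
        ((resonantValues F).sub_mem hk hk') using 1
      funext n
      simp only [Pi.smul_apply, Pi.sub_apply, Complex.sub_conj, smul_eq_mul]
      field_simp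
      push_cast
      ring
    obtain ⟨φ, hφ, e1⟩ := (exists_mem_resonanceSpace_iff F _).1 hre
    obtain ⟨ψ, hψ, e2⟩ := (exists_mem_resonanceSpace_iff F _).1 him
    convert Submodule.add_mem _ (hreal φ hφ) (Submodule.smul_mem _ Complex.I (hreal ψ hψ)) using 1
    funext n
    rw [e1, e2]
    simp [mul_comm Complex.I]
  · rw [Submodule.span_le]
    rintro _ ⟨φ, hφ, rfl⟩
    exact (exists_mem_resonanceSpace_iff F _).2 ⟨φ, hS ▸ Submodule.subset_span hφ, rfl⟩

theorem crossProduct_endValues_ne_zero (F : ∀ n, FundamentalSystem fun x => α * Q n x)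
    {φ ψ : Fin 3 → Icc (0 : ℝ) 1 → ℝ}
    (hφψ : LinearIndependent ℝ ![φ, ψ]) (h : resonanceSpace α Q = Submodule.span ℝ {φ, ψ}) :
    crossProduct (endValues φ) (endValues ψ) ≠ 0 := by
  rw [crossProduct_ne_zero_iff_linearIndependent, LinearIndependent.pair_iff]
  rw [LinearIndependent.pair_iff] at hφψ
  intro s t hst
  refine hφψ s t (eq_zero_of_endValues F ?_ ?_)
  · rw [h]
    exact Submodule.mem_span_pair.2 ⟨s, t, rfl⟩
  · rw [endValues_add, endValues_smul, endValues_smul, hst]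

/-- The right side involves neither the case nor the basis, so the limit operator is independent of
both. -/
theorem IsLimitOperator.eq_schrodinger {H : L2 →ₗ.[ℂ] L2} (h : IsLimitOperator α Q H) :
    H = schrodinger (fun _ _ => 0) (splitCondition (resonantValues F)) := by
  cases h with
  | nonresonant h =>
    rw [resonantValues_eq_span F (S := ∅) (by rw [h, Submodule.span_empty]), image_empty,
      Submodule.span_empty, dirichlet_eq_splitCondition]
  | simple φ hφ h =>
    rw [resonantValues_eq_span F h, image_singleton, simpleCondition_eq_splitCondition]
    intro h0
    exact hφ (eq_zero_of_endValues F (h ▸ Submodule.mem_span_singleton_self φ) h0)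
  | double φ ψ hφψ h =>
    rw [resonantValues_eq_span F h, image_pair, doubleCondition_eq_splitCondition]
    exact crossProduct_endValues_ne_zero F hφψ h

theorem exists_isLimitOperator (F : ∀ n, FundamentalSystem fun x => α * Q n x) :
    ∃ H, IsLimitOperator α Q H := by
  let E : resonanceSpace α Q →ₗ[ℝ] (Fin 3 → ℝ) :=
    { toFun := fun φ => endValues φ
      map_add' := fun φ ψ => rfl
      map_smul' := fun r φ => rfl }
  have hE : Function.Injective E := by
    rw [injective_iff_map_eq_zero]
    intro φ h
    exact Subtype.ext (eq_zero_of_endValues F φ.2 h)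
  have hfin : FiniteDimensional ℝ (resonanceSpace α Q) := .of_injective E hE
  have hle : Module.finrank ℝ (resonanceSpace α Q) ≤ 3 := by
    simpa using LinearMap.finrank_le_finrank_of_injective hE
  have hne : Module.finrank ℝ (resonanceSpace α Q) ≠ 3 := by
    intro h3
    have hsurj : Function.Surjective E :=
      (LinearMap.injective_iff_surjective_of_finrank_eq_finrank (by simpa using h3)).1 hE
    -- If all end values occurred, so would `(1, 0, 0)`; continuity and the flux condition would
    -- then force `p 0 = p' 0 = 0` on the first edge, against the Wronskian.
    obtain ⟨φ, hφ⟩ := hsurj (Pi.single 0 1)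
    have hmem := (exists_mem_resonanceSpace_iff F (Pi.single 0 1)).2 ⟨φ, φ.2, hφ⟩
    rw [mem_resonantValues] at hmem
    have h1 := hmem.1 0 1
    have h2 := hmem.2
    simp [Fin.sum_univ_three] at h1 h2
    have := (F 0).wronskian (x := 0) (by simp)
    rw [h1, h2] at this
    simp at this
  obtain h | h | h : Module.finrank ℝ (resonanceSpace α Q) = 0 ∨
    Module.finrank ℝ (resonanceSpace α Q) = 1 ∨ Module.finrank ℝ (resonanceSpace α Q) = 2 := by
    omega
  · exact ⟨_, .nonresonant (Submodule.finrank_eq_zero.1 h)⟩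
  · obtain ⟨φ, hφ, hspan⟩ := finrank_eq_one_iff'.1 h
    refine ⟨_, .simple φ (by simpa using hφ) (le_antisymm (fun ψ hψ => ?_) ?_)⟩
    · obtain ⟨r, hr⟩ := hspan ⟨ψ, hψ⟩
      exact Submodule.mem_span_singleton.2 ⟨r, congrArg Subtype.val hr⟩
    · rw [Submodule.span_singleton_le_iff_mem]
      exact φ.2
  · let b := Module.finBasisOfFinrankEq ℝ (resonanceSpace α Q) h
    have hb0 : ![(b 0 : Fin 3 → Icc (0 : ℝ) 1 → ℝ), b 1]
        = (resonanceSpace α Q).subtype ∘ b := by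
      funext i; fin_cases i <;> rfl
    refine ⟨_, .double (b 0) (b 1) ?_ (le_antisymm (fun ψ hψ => ?_) ?_)⟩
    · rw [hb0]
      exact b.linearIndependent.map' _ (Submodule.ker_subtype _)
    · have := b.sum_repr ⟨ψ, hψ⟩
      rw [Fin.sum_univ_two] at this
      exact Submodule.mem_span_pair.2 ⟨_, _, congrArg Subtype.val this⟩
    · rw [Submodule.span_le]
      rintro x (rfl | rfl)
      · exact (b 0).2
      · exact (b 1).2

theorem existsUnique_isLimitOperator (F : ∀ n, FundamentalSystem fun x => α * Q n x) :
    ∃! H, IsLimitOperator α Q H := by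
  obtain ⟨H, hH⟩ := exists_isLimitOperator F
  exact ⟨H, hH, fun H' hH' => (hH'.eq_schrodinger F).trans (hH.eq_schrodinger F).symm⟩

end Weyl

/-! ### Trace and Taylor estimates in `W₂²`. -/

/-- Cauchy–Schwarz on a short interval. -/
theorem integral_norm_le_sqrt_mul {f : ℝ → ℂ} (hf : MemLp f 2 edgeMeasure) {Λ : ℝ} (hΛ : 0 ≤ Λ)
    (h : ∫ x in Ioi (0 : ℝ), ‖f x‖ ^ 2 ≤ Λ ^ 2) {b : ℝ} (hb : 0 ≤ b) :
    ∫ x in (0 : ℝ)..b, ‖f x‖ ≤ Real.sqrt b * Λ := by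
  have hf' : MemLp f 2 (volume.restrict (Ioc 0 b)) :=
    hf.mono_measure (Measure.restrict_mono Ioc_subset_Ioi_self le_rfl)
  have h1 : MemLp (fun _ : ℝ => (1 : ℂ)) (ENNReal.ofReal 2) (volume.restrict (Ioc 0 b)) :=
    memLp_const 1
  have h2 := integral_mul_norm_le_Lp_mul_Lq (μ := volume.restrict (Ioc 0 b))
    Real.HolderConjugate.two_two h1 (g := f) (by simpa using hf')
  have h3 : ∫ x in Ioc 0 b, ‖f x‖ ^ 2 ≤ Λ ^ 2 := by
    refine le_trans ?_ h
    rw [← intervalIntegral.integral_of_le hb]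
    exact intervalIntegral_le_setIntegral (integrable_sq_norm hf) (fun x => by positivity) hb
  rw [intervalIntegral.integral_of_le hb]
  simp only [norm_one, one_mul, one_pow, Real.rpow_two, integral_const, smul_eq_mul,
    mul_one, ← Real.sqrt_eq_rpow] at h2
  refine h2.trans ?_
  rw [show (volume.restrict (Ioc 0 b)).real univ = b by simp [hb]]
  gcongr
  exact Real.sqrt_le_iff.2 ⟨hΛ, h3⟩

theorem norm_integral_le_sqrt_mul {f g : ℝ → ℂ} (hf : MemLp f 2 edgeMeasure) {Λ : ℝ}
    (hΛ : 0 ≤ Λ) (h : ∫ x in Ioi (0 : ℝ), ‖f x‖ ^ 2 ≤ Λ ^ 2) {b x m : ℝ} (hx : x ∈ Icc 0 b)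
    (hm : 0 ≤ m) (hg : ∀ t ∈ Icc 0 b, ‖g t‖ ≤ m) :
    ‖∫ t in (0 : ℝ)..x, g t * f t‖ ≤ m * (Real.sqrt b * Λ) := by
  have hfi := (memLp_intervalIntegrable hf hx.1).norm
  calc ‖∫ t in (0 : ℝ)..x, g t * f t‖ ≤ ∫ t in (0 : ℝ)..x, m * ‖f t‖ := by
        refine intervalIntegral.norm_integral_le_of_norm_le hx.1
          (Eventually.of_forall fun t ht => ?_) (hfi.const_mul m)
        rw [norm_mul]
        exact mul_le_mul_of_nonneg_right (hg t ⟨ht.1.le, ht.2.trans hx.2⟩) (norm_nonneg _)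
    _ = m * ∫ t in (0 : ℝ)..x, ‖f t‖ := intervalIntegral.integral_const_mul _ _
    _ ≤ m * (Real.sqrt x * Λ) := by
        gcongr
        exact integral_norm_le_sqrt_mul hf hΛ h hx.1
    _ ≤ _ := by
        gcongr
        exact hx.2

namespace IsW22

variable {u v w : ℝ → ℂ}

/-- A square-integrable second derivative makes `u'` Hölder of exponent `1/2`. Here the rate `√ε`
enters the matching at distance `ε`. -/
theorem norm_deriv_sub_le (h : IsW22 u v w) {Λ : ℝ} (hΛ : 0 ≤ Λ)
    (hw : ∫ x in Ioi (0 : ℝ), ‖w x‖ ^ 2 ≤ Λ ^ 2) {x : ℝ} (hx : 0 ≤ x) :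
    ‖v x - v 0‖ ≤ Real.sqrt x * Λ := by
  rw [h.deriv2.eq_integral x hx, add_sub_cancel_left]
  have := norm_integral_le_sqrt_mul (g := fun _ => 1) h.memLp_deriv2 hΛ hw
    (x := x) (b := x) ⟨hx, le_rfl⟩ zero_le_one (by simp)
  simpa using this

theorem norm_sub_sub_le (h : IsW22 u v w) {Λ : ℝ} (hΛ : 0 ≤ Λ)
    (hw : ∫ x in Ioi (0 : ℝ), ‖w x‖ ^ 2 ≤ Λ ^ 2) {x : ℝ} (hx : 0 ≤ x) :
    ‖u x - u 0 - x * v 0‖ ≤ x * (Real.sqrt x * Λ) := by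
  have e : u x - u 0 - x * v 0 = ∫ t in (0 : ℝ)..x, (v t - v 0) := by
    rw [intervalIntegral.integral_sub (h.deriv.integrable x hx) intervalIntegrable_const,
      h.deriv.eq_integral x hx]
    simp
  rw [e]
  have := intervalIntegral.norm_integral_le_of_norm_le_const (a := 0) (b := x)
    (f := fun t => v t - v 0) (C := Real.sqrt x * Λ) (by
      intro t ht
      rw [uIoc_of_le hx] at ht
      refine (h.norm_deriv_sub_le hΛ hw ht.1.le).trans ?_
      gcongr
      exact ht.2)
  rwa [sub_zero, abs_of_nonneg hx, mul_comm] at this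

/-- A trace estimate. -/
theorem norm_zero_le (h : IsW22 u v w) {Λ : ℝ} (hΛ : 0 ≤ Λ)
    (hu : ∫ x in Ioi (0 : ℝ), ‖u x‖ ^ 2 ≤ Λ ^ 2) (hw : ∫ x in Ioi (0 : ℝ), ‖w x‖ ^ 2 ≤ Λ ^ 2) :
    ‖u 0‖ ≤ 12 * Λ ∧ ‖v 0‖ ≤ 12 * Λ := by
  -- Integrating `u` against a kernel `k` on `[0, 1]` extracts the combination of `u 0` and `v 0`
  -- with the moments `P₀ 1 = ∫ k` and `P₁ 1 = ∫ k x` as coefficients. With `|k| ≤ 6`, the term in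
  -- `u` and the Taylor remainder contribute `6 Λ` each.
  have key : ∀ (k P₀ P₁ : ℝ → ℝ), Continuous k → (∀ x ∈ Icc (0 : ℝ) 1, |k x| ≤ 6) →
      (∀ x, HasDerivAt P₀ (k x) x) → (∀ x, HasDerivAt P₁ (k x * x) x) → P₀ 0 = 0 → P₁ 0 = 0 →
      ‖(P₀ 1 : ℂ) * u 0 + P₁ 1 * v 0‖ ≤ 12 * Λ := by
    intro k P₀ P₁ hk hk6 h₀ h₁ z₀ z₁
    have hkc : Continuous fun x => (k x : ℂ) := Complex.continuous_ofReal.comp hk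
    have e₁ : ∫ x in (0 : ℝ)..1, ((k x : ℂ) * (u 0 + x * v 0))
        = (P₀ 1 : ℂ) * u 0 + P₁ 1 * v 0 := by
      rw [intervalIntegral.integral_eq_sub_of_hasDerivAt
        (f := fun x => (P₀ x : ℂ) * u 0 + P₁ x * v 0) (fun x _ => ?_)
        (Continuous.intervalIntegrable (by fun_prop) _ _), z₀, z₁]
      · simp
      · refine (((h₀ x).ofReal_comp.mul_const (u 0)).add
          ((h₁ x).ofReal_comp.mul_const (v 0))).congr_deriv ?_
        push_cast
        ring
    have hui := h.deriv.on (b := 1) zero_le_one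
    have hucont : ContinuousOn u (uIcc 0 1) := by
      rw [uIcc_of_le zero_le_one]; exact hui.continuousOn
    have e₂ : (P₀ 1 : ℂ) * u 0 + P₁ 1 * v 0 = (∫ x in (0 : ℝ)..1, (k x : ℂ) * u x)
        - ∫ x in (0 : ℝ)..1, (k x : ℂ) * (u x - u 0 - x * v 0) := by
      rw [← e₁, ← intervalIntegral.integral_sub]
      · exact intervalIntegral.integral_congr fun x _ => by ring
      · exact (hkc.continuousOn.mul hucont).intervalIntegrable
      · exact (hkc.continuousOn.mul ((hucont.sub continuousOn_const).sub
          (by fun_prop))).intervalIntegrable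
    have hk6' : ∀ t ∈ Icc (0 : ℝ) 1, ‖(k t : ℂ)‖ ≤ 6 := fun t ht => by
      rw [Complex.norm_real]; exact hk6 t ht
    have b₁ : ‖∫ x in (0 : ℝ)..1, (k x : ℂ) * u x‖ ≤ 6 * (Real.sqrt 1 * Λ) :=
      norm_integral_le_sqrt_mul h.memLp hΛ hu ⟨zero_le_one, le_rfl⟩ (by norm_num) hk6'
    have b₂ : ‖∫ x in (0 : ℝ)..1, (k x : ℂ) * (u x - u 0 - x * v 0)‖ ≤ 6 * Λ := by
      have := intervalIntegral.norm_integral_le_of_norm_le_const (a := 0) (b := 1)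
        (f := fun x : ℝ => (k x : ℂ) * (u x - u 0 - x * v 0)) (C := 6 * Λ) (by
          intro t ht
          rw [uIoc_of_le zero_le_one] at ht
          rw [norm_mul]
          refine mul_le_mul (hk6' t ⟨ht.1.le, ht.2⟩) ?_ (norm_nonneg _) (by norm_num)
          refine (h.norm_sub_sub_le hΛ hw ht.1.le).trans ?_
          have h1 : Real.sqrt t ≤ 1 := Real.sqrt_le_one.2 ht.2
          have h2 : t * Real.sqrt t ≤ 1 := by nlinarith [ht.1.le, ht.2, Real.sqrt_nonneg t]
          nlinarith)
      simpa using this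
    rw [e₂]
    refine (norm_sub_le _ _).trans ?_
    rw [Real.sqrt_one] at b₁
    linarith
  constructor
  -- The kernel `4 - 6 x` has moments `1, 0` and isolates `u 0`; below, `12 x - 6` has moments `0,
  -- 1` and isolates `v 0`.
  · have := key (fun x => 4 - 6 * x) (fun x => 4 * x - 3 * x ^ 2) (fun x => 2 * x ^ 2 - 2 * x ^ 3)
      (by fun_prop) (fun x hx => abs_le.2 ⟨by linarith [hx.2], by linarith [hx.1]⟩)
      (fun x => by
        refine (((hasDerivAt_id x).const_mul 4).sub ((hasDerivAt_pow 2 x).const_mul 3)).congr_deriv ?_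
        norm_num; ring)
      (fun x => by
        refine (((hasDerivAt_pow 2 x).const_mul 2).sub
          ((hasDerivAt_pow 3 x).const_mul 2)).congr_deriv ?_
        norm_num; ring) (by simp) (by simp)
    norm_num at this
    exact this
  · have := key (fun x => 12 * x - 6) (fun x => 6 * x ^ 2 - 6 * x) (fun x => 4 * x ^ 3 - 3 * x ^ 2)
      (by fun_prop) (fun x hx => abs_le.2 ⟨by linarith [hx.1], by linarith [hx.2]⟩)
      (fun x => by
        refine (((hasDerivAt_pow 2 x).const_mul 6).sub ((hasDerivAt_id x).const_mul 6)).congr_deriv ?_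
        norm_num; ring)
      (fun x => by
        refine (((hasDerivAt_pow 3 x).const_mul 4).sub
          ((hasDerivAt_pow 2 x).const_mul 3)).congr_deriv ?_
        norm_num; ring) (by simp) (by simp)
    norm_num at this
    exact this

end IsW22

/-! ### Correctors, rescaled solutions and quasimodes on one edge. -/

/-- `(k₀ + k₁ x) e⁻ˣ`. -/
noncomputable def decay (k₀ k₁ : ℂ) (x : ℝ) : ℂ := (k₀ + k₁ * x) * Complex.exp (-1 * x)

theorem hasACDeriv_decay (k₀ k₁ : ℂ) : HasACDeriv (decay k₀ k₁) (decay (k₁ - k₀) (-k₁)) := by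
  refine .of_hasDerivAt (fun x => ?_) (by unfold decay; fun_prop)
  have h1 : HasDerivAt (fun x : ℝ => k₀ + k₁ * (x : ℂ)) k₁ x := by
    simpa using ((Complex.ofRealCLM.hasDerivAt (x := x)).const_mul k₁).const_add k₀
  refine (h1.mul (hasDerivAt_cexp_mul (-1) x)).congr_deriv ?_
  simp only [decay]
  ring

/-- Half of the exponential pays for the linear factor, through `1 + x ≤ 2 exp (x / 2)`. -/
theorem norm_decay_le {k₀ k₁ : ℂ} {K : ℝ} (h₀ : ‖k₀‖ ≤ K) (h₁ : ‖k₁‖ ≤ K) {x : ℝ} (hx : 0 ≤ x) :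
    ‖decay k₀ k₁ x‖ ≤ 2 * K * Real.exp (-x / 2) := by
  have hK : 0 ≤ K := (norm_nonneg _).trans h₀
  have e1 : ‖Complex.exp (-1 * x)‖ = Real.exp (-x / 2) * Real.exp (-x / 2) := by
    rw [← Real.exp_add, Complex.norm_exp]; simp
  have e2 : ‖k₀ + k₁ * x‖ ≤ K * (1 + x) := by
    refine (norm_add_le _ _).trans ?_
    rw [norm_mul, Complex.norm_real, Real.norm_of_nonneg hx]
    nlinarith
  have e3 : 1 + x ≤ 2 * Real.exp (x / 2) := by linarith [Real.add_one_le_exp (x / 2)]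
  have e4 : Real.exp (x / 2) * Real.exp (-x / 2) = 1 := by
    rw [← Real.exp_add, show x / 2 + -x / 2 = 0 by ring, Real.exp_zero]
  rw [decay, norm_mul, e1]
  have hp := Real.exp_pos (-x / 2)
  calc ‖k₀ + k₁ * x‖ * (Real.exp (-x / 2) * Real.exp (-x / 2))
      ≤ (K * (2 * Real.exp (x / 2))) * (Real.exp (-x / 2) * Real.exp (-x / 2)) := by
        gcongr
        exact e2.trans (by gcongr)
    _ = 2 * K * Real.exp (-x / 2) * (Real.exp (x / 2) * Real.exp (-x / 2)) := by ring
    _ = _ := by rw [e4, mul_one]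

theorem memLp_decay (k₀ k₁ : ℂ) : MemLp (decay k₀ k₁) 2 edgeMeasure := by
  have hm : AEStronglyMeasurable (decay k₀ k₁) edgeMeasure := by
    unfold decay; fun_prop
  rw [memLp_two_iff_integrable_sq_norm hm]
  refine ((integrableOn_exp_neg_Ioi 0).const_mul ((2 * (‖k₀‖ + ‖k₁‖)) ^ 2)).mono' (hm.norm.pow 2) ?_
  filter_upwards [ae_restrict_mem measurableSet_Ioi] with x hx
  have := norm_decay_le (k₀ := k₀) (k₁ := k₁) (K := ‖k₀‖ + ‖k₁‖)
    (by linarith [norm_nonneg k₁]) (by linarith [norm_nonneg k₀]) (le_of_lt hx)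
  rw [Real.norm_of_nonneg (by positivity)]
  refine (pow_le_pow_left₀ (norm_nonneg _) this 2).trans (le_of_eq ?_)
  rw [mul_pow, ← Real.exp_nat_mul]
  congr 2
  push_cast
  ring

/-- A decaying corrector with prescribed value and derivative at `ε`. -/
theorem exists_corrector {ε : ℝ} (hε : 0 < ε) (hε1 : ε < 1) {j₀ j₁ : ℂ} {J : ℝ} (h₀ : ‖j₀‖ ≤ J)
    (h₁ : ‖j₁‖ ≤ J) : ∃ k v w : ℝ → ℂ, IsW22 k v w ∧ k ε = j₀ ∧ v ε = j₁ ∧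
      ∀ x, 0 ≤ x → ‖k x‖ ≤ 42 * J * Real.exp (-x / 2) ∧ ‖w x‖ ≤ 42 * J * Real.exp (-x / 2) := by
  set E : ℂ := Complex.exp ε with hE
  have hEn : ‖E‖ ≤ 3 := by
    rw [hE, Complex.norm_exp, Complex.ofReal_re]
    exact (Real.exp_le_exp.2 hε1.le).trans (Real.exp_one_lt_d9.le.trans (by norm_num))
  have hEE : E * Complex.exp (-1 * ε) = 1 := by
    rw [hE, ← Complex.exp_add]; simp
  have hJ : 0 ≤ J := (norm_nonneg _).trans h₀
  -- Solves `(a + b ε) e^(-ε) = j₀` and `(b - a - b ε) e^(-ε) = j₁`; adding the two equations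
  -- isolates `b`.
  set b := E * (j₀ + j₁) with hb
  set a := E * j₀ - b * ε with ha
  have hbn : ‖b‖ ≤ 6 * J := by
    rw [hb, norm_mul]
    have := (norm_add_le j₀ j₁)
    nlinarith [norm_nonneg E, norm_nonneg (j₀ + j₁)]
  have han : ‖a‖ ≤ 9 * J := by
    rw [ha]
    refine (norm_sub_le _ _).trans ?_
    rw [norm_mul, norm_mul, Complex.norm_real, Real.norm_of_nonneg hε.le]
    nlinarith [norm_nonneg E, norm_nonneg j₀, norm_nonneg b]
  refine ⟨decay a b, decay (b - a) (-b), decay (-b - (b - a)) (- -b),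
    ⟨memLp_decay _ _, memLp_decay _ _, memLp_decay _ _, hasACDeriv_decay _ _,
      hasACDeriv_decay _ _⟩, ?_, ?_, fun x hx => ⟨?_, ?_⟩⟩
  · simp only [decay, ha]
    linear_combination j₀ * hEE
  · simp only [decay, ha, hb]
    linear_combination j₁ * hEE
  · refine (norm_decay_le (K := 21 * J) (by linarith) (by linarith) hx).trans (le_of_eq (by ring))
  -- The second derivative has coefficients `a - 2 b` and `b`, and `9 + 2 * 6 = 21`.
  · refine (norm_decay_le (K := 21 * J) ?_ (by rw [neg_neg]; linarith) hx).trans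
      (le_of_eq (by ring))
    rw [show -b - (b - a) = a - b - b by ring]
    exact (norm_sub_le _ _).trans (by linarith [norm_sub_le a b])

/-- Used with `r = 1` for `p` and `r = ε` for `s`; this keeps the pair normalized at `ε` with
Wronskian one. -/
theorem SolvesOn.rescale {q u v : ℝ → ℝ} (h : SolvesOn q u v) {ε : ℝ} (hε : 0 < ε) (r : ℝ)
    (hq : ContinuousOn q (Icc 0 1)) :
    HasACDerivOn (fun x => ((r * u (x / ε) : ℝ) : ℂ)) (fun x => ((r * (v (x / ε) / ε) : ℝ) : ℂ)) ε ∧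
    HasACDerivOn (fun x => ((r * (v (x / ε) / ε) : ℝ) : ℂ))
      (fun x => (((ε ^ 2)⁻¹ * q (x / ε) * (r * u (x / ε)) : ℝ) : ℂ)) ε := by
  have hmaps : MapsTo (fun x : ℝ => x / ε) (Icc 0 ε) (Icc 0 1) := fun x hx =>
    ⟨div_nonneg hx.1 hε.le, (div_le_one hε).2 hx.2⟩
  have hd : ∀ x, HasDerivWithinAt (fun x : ℝ => x / ε) (1 / ε) (Icc 0 ε) x := fun x =>
    ((hasDerivAt_id x).div_const ε).hasDerivWithinAt
  have hdc : ContinuousOn (fun x : ℝ => x / ε) (Icc 0 ε) := by fun_prop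
  have hu : ContinuousOn u (Icc 0 1) := fun x hx => (h.deriv x hx).continuousWithinAt
  have hv : ContinuousOn v (Icc 0 1) := fun x hx => (h.deriv2 x hx).continuousWithinAt
  have cu := hu.comp hdc hmaps
  have cv := hv.comp hdc hmaps
  have cq := hq.comp hdc hmaps
  simp only [Function.comp_def] at cu cv cq
  constructor
  · refine .of_hasDerivWithinAt hε.le (fun x hx => ?_) ?_
    · refine (HasDerivWithinAt.ofReal_comp (u := r * (v (x / ε) / ε)) ?_)
      refine ((((h.deriv _ (hmaps hx)).scomp x (hd x) hmaps)).const_mul r).congr_deriv ?_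
      simp only [smul_eq_mul]
      ring
    · exact Complex.continuous_ofReal.comp_continuousOn
        (continuousOn_const.mul (cv.div_const ε))
  · refine .of_hasDerivWithinAt hε.le (fun x hx => ?_) ?_
    · refine (HasDerivWithinAt.ofReal_comp (u := (ε ^ 2)⁻¹ * q (x / ε) * (r * u (x / ε))) ?_)
      refine (((((h.deriv2 _ (hmaps hx)).scomp x (hd x) hmaps)).div_const ε).const_mul
        r).congr_deriv ?_
      simp only [smul_eq_mul]
      field_simp
    · exact Complex.continuous_ofReal.comp_continuousOn
        ((continuousOn_const.mul cq).mul (continuousOn_const.mul cu))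

/-- The solution of the rescaled equation near the vertex. -/
theorem FundamentalSystem.exists_inner {q : ℝ → ℝ} (F : FundamentalSystem q)
    (hq : ContinuousOn q (Icc 0 1)) {M : ℝ}
    (hM : ∀ x ∈ Icc (0 : ℝ) 1, |F.p x| ≤ M ∧ |F.p' x| ≤ M ∧ |F.s x| ≤ M ∧ |F.s' x| ≤ M)
    {ε : ℝ} (hε : 0 < ε) {f : ℝ → ℂ} (hf : MemLp f 2 edgeMeasure) {Λ : ℝ} (hΛ : 0 ≤ Λ)
    (hfΛ : ∫ x in Ioi (0 : ℝ), ‖f x‖ ^ 2 ≤ Λ ^ 2) (k₀ k₁ : ℂ) :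
    ∃ W W' : ℝ → ℂ, HasACDerivOn W W' ε ∧
      HasACDerivOn W' (fun x => (((ε ^ 2)⁻¹ * q (x / ε) : ℝ) : ℂ) * W x - f x) ε ∧
      W 0 = k₀ * F.p 0 + ε * k₁ * F.s 0 ∧ ε * W' 0 = k₀ * F.p' 0 + ε * k₁ * F.s' 0 ∧
      ‖W ε - k₀‖ ≤ ε * M * (Real.sqrt ε * Λ) ∧ ‖W' ε - k₁‖ ≤ M * (Real.sqrt ε * Λ) ∧
      ∀ x ∈ Icc 0 ε, ‖W x‖ ≤ (‖k₀‖ + ε * M * (Real.sqrt ε * Λ)) * M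
        + (‖k₁‖ + M * (Real.sqrt ε * Λ)) * (ε * M) := by
  have hmaps : MapsTo (fun x : ℝ => x / ε) (Icc 0 ε) (Icc 0 1) := fun x hx =>
    ⟨div_nonneg hx.1 hε.le, (div_le_one hε).2 hx.2⟩
  have hM0 : 0 ≤ M := (abs_nonneg _).trans (hM 0 (by simp)).1
  obtain ⟨hp, hp'⟩ := F.solves_p.rescale hε 1 hq
  obtain ⟨hs, hs'⟩ := F.solves_s.rescale hε ε hq
  set P : ℝ → ℂ := fun x => ((1 * F.p (x / ε) : ℝ) : ℂ) with hP
  set P' : ℝ → ℂ := fun x => ((1 * (F.p' (x / ε) / ε) : ℝ) : ℂ) with hP'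
  set S : ℝ → ℂ := fun x => ((ε * F.s (x / ε) : ℝ) : ℂ) with hS
  set S' : ℝ → ℂ := fun x => ((ε * (F.s' (x / ε) / ε) : ℝ) : ℂ) with hS'
  have bP : ∀ t ∈ Icc 0 ε, ‖P t‖ ≤ M := fun t ht => by
    rw [hP, Complex.norm_real, one_mul]; exact (hM _ (hmaps ht)).1
  have bS : ∀ t ∈ Icc 0 ε, ‖S t‖ ≤ ε * M := fun t ht => by
    rw [hS, Complex.norm_real, norm_mul, Real.norm_of_nonneg hε.le]
    exact mul_le_mul_of_nonneg_left (hM _ (hmaps ht)).2.2.1 hε.le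
  have hfi := memLp_intervalIntegrable hf hε.le
  have iP : IntervalIntegrable (fun t => P t * f t) volume 0 ε :=
    hfi.continuousOn_mul (by rw [uIcc_of_le hε.le]; exact hp.continuousOn)
  have iS : IntervalIntegrable (fun t => S t * f t) volume 0 ε :=
    hfi.continuousOn_mul (by rw [uIcc_of_le hε.le]; exact hs.continuousOn)
  -- Variation of constants with integrals starting at the vertex. There the solution has the
  -- homogeneous data of `(k₀, k₁)`, so `f` does not disturb the Kirchhoff conditions; its effect
  -- appears only as an error at `ε`.
  set A : ℝ → ℂ := fun x => k₀ + ∫ t in (0 : ℝ)..x, S t * f t with hA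
  set B : ℝ → ℂ := fun x => k₁ - ∫ t in (0 : ℝ)..x, P t * f t with hB
  have dA : HasACDerivOn A (fun t => S t * f t) ε := .of_integral iS k₀
  have dB : HasACDerivOn B (fun t => 0 - P t * f t) ε := by
    have := (HasACDerivOn.const k₁ ε).sub (HasACDerivOn.of_integral iP 0)
    simpa [hB] using this
  have bA : ∀ x ∈ Icc 0 ε, ‖A x - k₀‖ ≤ ε * M * (Real.sqrt ε * Λ) := fun x hx => by
    rw [hA, add_sub_cancel_left]
    exact norm_integral_le_sqrt_mul hf hΛ hfΛ hx (by positivity) bS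
  have bB : ∀ x ∈ Icc 0 ε, ‖B x - k₁‖ ≤ M * (Real.sqrt ε * Λ) := fun x hx => by
    rw [hB, sub_sub_cancel_left, norm_neg]
    exact norm_integral_le_sqrt_mul hf hΛ hfΛ hx hM0 bP
  have hεε : ε ∈ Icc 0 ε := ⟨hε.le, le_rfl⟩
  have hε1 : ε / ε = 1 := div_self hε.ne'
  have hεc : (ε : ℂ) ≠ 0 := by exact_mod_cast hε.ne'
  have wr : ∀ x ∈ Icc 0 ε, P x * S' x - P' x * S x = 1 := fun x hx => by
    have := F.wronskian (hmaps hx)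
    simp only [hP, hS', hP', hS]
    rw [← Complex.ofReal_mul, ← Complex.ofReal_mul, ← Complex.ofReal_sub, ← Complex.ofReal_one]
    congr 1
    field_simp
    exact this
  refine ⟨fun x => A x * P x + B x * S x, fun x => A x * P' x + B x * S' x, ?_, ?_, ?_, ?_, ?_, ?_,
    fun x hx => ?_⟩
  · refine ((dA.mul hε.le hp).add (dB.mul hε.le hs)).congr hε.le (fun x _ => rfl)
      (Eventually.of_forall fun x _ => ?_)
    ring
  · refine ((dA.mul hε.le hp').add (dB.mul hε.le hs')).congr hε.le (fun x _ => rfl)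
      (Eventually.of_forall fun x hx => ?_)
    have := wr x ⟨hx.1.le, hx.2⟩
    have e1 : (((ε ^ 2)⁻¹ * q (x / ε) * (1 * F.p (x / ε)) : ℝ) : ℂ)
        = (((ε ^ 2)⁻¹ * q (x / ε) : ℝ) : ℂ) * P x := by rw [Complex.ofReal_mul]
    have e2 : (((ε ^ 2)⁻¹ * q (x / ε) * (ε * F.s (x / ε)) : ℝ) : ℂ)
        = (((ε ^ 2)⁻¹ * q (x / ε) : ℝ) : ℂ) * S x := by rw [Complex.ofReal_mul]
    rw [e1, e2]
    linear_combination f x * this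
  · simp [hA, hB, hP, hS]
    ring
  · simp only [hA, hB, hP', hS', intervalIntegral.integral_same, zero_div]
    push_cast
    field_simp
    ring
  · have : A ε * P ε + B ε * S ε = A ε := by
      simp [hP, hS, hε1, F.p_one, F.s_one]
    simp only [this]
    exact bA ε hεε
  · have : A ε * P' ε + B ε * S' ε = B ε := by
      simp [hP', hS', hε1, F.p'_one, F.s'_one, hεc]
    simp only [this]
    exact bB ε hεε
  · have nA : ‖A x‖ ≤ ‖k₀‖ + ε * M * (Real.sqrt ε * Λ) := by
      have := norm_add_le k₀ (A x - k₀)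
      rw [add_sub_cancel] at this
      linarith [bA x hx]
    have nB : ‖B x‖ ≤ ‖k₁‖ + M * (Real.sqrt ε * Λ) := by
      have := norm_add_le k₁ (B x - k₁)
      rw [add_sub_cancel] at this
      linarith [bB x hx]
    refine (norm_add_le _ _).trans ?_
    rw [norm_mul, norm_mul]
    exact add_le_add (mul_le_mul nA (bP x hx) (norm_nonneg _) ((norm_nonneg _).trans nA))
      (mul_le_mul nB (bS x hx) (norm_nonneg _) ((norm_nonneg _).trans nB))

theorem memLp_piecewise_edge {g₁ g₂ : ℝ → ℂ} {b : ℝ} (h₁ : MemLp g₁ 2 (volume.restrict (Ioc 0 b)))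
    (h₂ : MemLp g₂ 2 edgeMeasure) : MemLp ((Iic b).piecewise g₁ g₂) 2 edgeMeasure := by
  classical
  refine MemLp.piecewise measurableSet_Iic ?_ (h₂.mono_measure Measure.restrict_le_self)
  rw [Measure.restrict_restrict measurableSet_Iic, Iic_inter_Ioi]
  exact h₁

theorem memLp_of_continuousOn {g : ℝ → ℂ} {b : ℝ} (h : ContinuousOn g (Icc 0 b)) :
    MemLp g 2 (volume.restrict (Ioc 0 b)) := by
  obtain ⟨C, hC⟩ := isCompact_Icc.exists_bound_of_continuousOn h
  refine MemLp.of_bound ((h.mono Ioc_subset_Icc_self).aestronglyMeasurable measurableSet_Ioc) C ?_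
  filter_upwards [ae_restrict_mem measurableSet_Ioc] with x hx
  exact hC x (Ioc_subset_Icc_self hx)

/-- A quasimode on one edge: the rescaled equation is solved exactly on `(0, ε]`, and beyond `ε` the
function is close to `u`. -/
theorem FundamentalSystem.exists_edge_quasimode {q : ℝ → ℝ} (F : FundamentalSystem q)
    (hq : ContinuousOn q (Icc 0 1)) {M : ℝ}
    (hM : ∀ x ∈ Icc (0 : ℝ) 1, |F.p x| ≤ M ∧ |F.p' x| ≤ M ∧ |F.s x| ≤ M ∧ |F.s' x| ≤ M)
    {ε : ℝ} (hε : 0 < ε) (hε1 : ε < 1) {f : ℝ → ℂ} (hf : MemLp f 2 edgeMeasure) {Λ : ℝ}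
    (hΛ : 0 ≤ Λ) (hfΛ : ∫ x in Ioi (0 : ℝ), ‖f x‖ ^ 2 ≤ Λ ^ 2) {u v w : ℝ → ℂ}
    (h : IsW22 u v w) (huΛ : ∫ x in Ioi (0 : ℝ), ‖u x‖ ^ 2 ≤ Λ ^ 2)
    (hwΛ : ∫ x in Ioi (0 : ℝ), ‖w x‖ ^ 2 ≤ Λ ^ 2) {c : ℂ} {Γ : ℝ} (hΓ : 0 ≤ Γ)
    (hc : ‖c‖ ≤ Γ * Λ) :
    ∃ Y Y' Y'' : ℝ → ℂ, IsW22 Y Y' Y'' ∧ Y 0 = (u 0 + ε * c) * F.p 0 + ε * v 0 * F.s 0 ∧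
      ε * Y' 0 = (u 0 + ε * c) * F.p' 0 + ε * v 0 * F.s' 0 ∧
      (∀ x, 0 < x → x ≤ ε → -Y'' x + (((ε ^ 2)⁻¹ * q (x / ε) : ℝ) : ℂ) * Y x = f x ∧
        ‖Y x‖ ≤ (24 + Γ + 2 * M) * M * Λ ∧ ‖u x‖ ≤ 25 * Λ) ∧
      ∀ x, ε < x →
        ‖Y x - u x‖ ≤ 42 * ((M + Γ + 13) * (Real.sqrt ε * Λ)) * Real.exp (-x / 2) ∧
        ‖Y'' x - w x‖ ≤ 42 * ((M + Γ + 13) * (Real.sqrt ε * Λ)) * Real.exp (-x / 2) := by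
  classical
  have hM0 : 0 ≤ M := (abs_nonneg _).trans (hM 0 (by simp)).1
  obtain ⟨W, W', hW, hW', hW0, hW'0, hWε, hW'ε, hWb⟩ :=
    F.exists_inner hq hM hε hf hΛ hfΛ (u 0 + ε * c) (v 0)
  obtain ⟨hu0, hv0⟩ := h.norm_zero_le hΛ huΛ hwΛ
  have hs0 := Real.sqrt_nonneg ε
  have hs1 : Real.sqrt ε ≤ 1 := Real.sqrt_le_one.2 hε1.le
  have hss : Real.sqrt ε * Real.sqrt ε = ε := Real.mul_self_sqrt hε.le
  have hes : ε ≤ Real.sqrt ε := by nlinarith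
  have hsΛ : Real.sqrt ε * Λ ≤ Λ := by nlinarith
  have hsΛ0 : 0 ≤ Real.sqrt ε * Λ := by positivity
  have hεΛ : ε * Λ ≤ Real.sqrt ε * Λ := by gcongr
  have hεn : ‖(ε : ℂ)‖ = ε := by rw [Complex.norm_real, Real.norm_of_nonneg hε.le]
  have hεc : ‖(ε : ℂ) * c‖ ≤ Γ * (Real.sqrt ε * Λ) := by
    rw [norm_mul, hεn]
    calc ε * ‖c‖ ≤ Real.sqrt ε * (Γ * Λ) := mul_le_mul hes hc (norm_nonneg _) hs0
      _ = _ := by ring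
  -- In the jump constant, `M` comes from variation of constants, `Γ` from `ε c`, `12` from `ε v 0`
  -- by the trace estimate and `1` from the Taylor remainder.
  have hj₀ : ‖W ε - u ε‖ ≤ (M + Γ + 13) * (Real.sqrt ε * Λ) := by
    have e1 : W ε - u ε = (W ε - (u 0 + ε * c)) + (ε * c - ε * v 0) - (u ε - u 0 - ε * v 0) := by
      ring
    have e2 := h.norm_sub_sub_le hΛ hwΛ hε.le
    have e3 : ‖(ε : ℂ) * v 0‖ ≤ 12 * (Real.sqrt ε * Λ) := by
      rw [norm_mul, hεn]
      calc ε * ‖v 0‖ ≤ Real.sqrt ε * (12 * Λ) := mul_le_mul hes hv0 (norm_nonneg _) hs0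
        _ = _ := by ring
    have e4 : ε * M * (Real.sqrt ε * Λ) ≤ M * (Real.sqrt ε * Λ) := by
      have : 0 ≤ M * (Real.sqrt ε * Λ) := by positivity
      nlinarith
    have e5 : ε * (Real.sqrt ε * Λ) ≤ Real.sqrt ε * Λ := by nlinarith
    rw [e1]
    refine (norm_sub_le _ _).trans ?_
    have e6 := norm_add_le (W ε - (u 0 + ε * c)) (ε * c - ε * v 0)
    have e7 := norm_sub_le ((ε : ℂ) * c) (ε * v 0)
    linarith
  have hj₁ : ‖W' ε - v ε‖ ≤ (M + Γ + 13) * (Real.sqrt ε * Λ) := by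
    have e1 : W' ε - v ε = (W' ε - v 0) - (v ε - v 0) := by ring
    have e2 := h.norm_deriv_sub_le hΛ hwΛ hε.le
    have e3 := norm_sub_le (W' ε - v 0) (v ε - v 0)
    have : 0 ≤ Γ * (Real.sqrt ε * Λ) := by positivity
    rw [e1]
    linarith
  -- The corrector takes exactly the jumps of value and derivative at `ε`, so `W` on `[0, ε]` and `u
  -- + k` beyond join in `W₂²`.
  obtain ⟨k, k', k'', hk, hkε, hk'ε, hkb⟩ := exists_corrector hε hε1 hj₀ hj₁
  have hU := h.add hk
  have hle : ∀ x, x ≤ ε → ∀ f g : ℝ → ℂ, (Iic ε).piecewise f g x = f x :=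
    fun x hx f g => piecewise_eq_of_mem _ _ _ hx
  have hgt : ∀ x, ε < x → ∀ f g : ℝ → ℂ, (Iic ε).piecewise f g x = g x :=
    fun x hx f g => piecewise_eq_of_notMem _ _ _ (by simpa using hx)
  have hqc : ContinuousOn (fun x => (((ε ^ 2)⁻¹ * q (x / ε) : ℝ) : ℂ)) (Icc 0 ε) := by
    refine Complex.continuous_ofReal.comp_continuousOn (continuousOn_const.mul
      (hq.comp (by fun_prop : ContinuousOn (fun x : ℝ => x / ε) (Icc 0 ε)) fun x hx => ?_))
    exact ⟨div_nonneg hx.1 hε.le, (div_le_one hε).2 hx.2⟩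
  have hfε : MemLp f 2 (volume.restrict (Ioc 0 ε)) :=
    hf.mono_measure (Measure.restrict_mono Ioc_subset_Ioi_self le_rfl)
  refine ⟨(Iic ε).piecewise W (u + k), (Iic ε).piecewise W' (v + k'),
    (Iic ε).piecewise (fun x => (((ε ^ 2)⁻¹ * q (x / ε) : ℝ) : ℂ) * W x - f x) (w + k''),
    ⟨?_, ?_, ?_, ?_, ?_⟩, ?_, ?_, fun x hx hxε => ?_, fun x hx => ?_⟩
  · exact memLp_piecewise_edge (memLp_of_continuousOn hW.continuousOn) hU.memLp
  · exact memLp_piecewise_edge (memLp_of_continuousOn hW'.continuousOn) hU.memLp_deriv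
  · exact memLp_piecewise_edge ((memLp_of_continuousOn (hqc.mul hW.continuousOn)).sub hfε)
      hU.memLp_deriv2
  · exact hW.glue hε.le hU.deriv (by rw [Pi.add_apply, hkε]; ring)
  · exact hW'.glue hε.le hU.deriv2 (by rw [Pi.add_apply, hk'ε]; ring)
  · rw [hle 0 hε.le, hW0]
  · rw [hle 0 hε.le, hW'0]
  · rw [hle x hxε, hle x hxε]
    refine ⟨by ring, (hWb x ⟨hx.le, hxε⟩).trans ?_, ?_⟩
    · have e1 : ‖u 0 + ε * c‖ ≤ (12 + Γ) * Λ := by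
        refine (norm_add_le _ _).trans ?_
        nlinarith
      have e2 : ε * M * (Real.sqrt ε * Λ) ≤ M * Λ := by
        calc ε * M * (Real.sqrt ε * Λ) ≤ 1 * M * Λ := by gcongr
          _ = _ := by ring
      calc (‖u 0 + ε * c‖ + ε * M * (Real.sqrt ε * Λ)) * M
            + (‖v 0‖ + M * (Real.sqrt ε * Λ)) * (ε * M)
          ≤ ((12 + Γ) * Λ + M * Λ) * M + (12 * Λ + M * Λ) * (1 * M) := by gcongr
        _ = _ := by ring
    · have e1 := h.norm_sub_sub_le hΛ hwΛ hx.le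
      have hx1 : x ≤ 1 := hxε.trans hε1.le
      have hsx : Real.sqrt x ≤ 1 := Real.sqrt_le_one.2 hx1
      have e2 : x * (Real.sqrt x * Λ) ≤ 1 * (1 * Λ) := by gcongr
      have e3 : ‖(x : ℂ) * v 0‖ ≤ 12 * Λ := by
        rw [norm_mul, Complex.norm_real, Real.norm_of_nonneg hx.le]
        nlinarith [norm_nonneg (v 0)]
      have e4 : u x = (u x - u 0 - x * v 0) + (u 0 + x * v 0) := by ring
      have e5 := norm_add_le (u x - u 0 - x * v 0) (u 0 + x * v 0)
      have e6 := norm_add_le (u 0) (x * v 0)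
      rw [e4]
      linarith
  · rw [hgt x hx, hgt x hx]
    simp only [Pi.add_apply, add_sub_cancel_left]
    exact hkb x (hε.le.trans hx.le)

/-! ### Norm bounds and quasimodes on the graph. -/

theorem norm_sq_eq_integral (r : Lp ℂ 2 edgeMeasure) :
    ‖r‖ ^ 2 = ∫ x in Ioi (0 : ℝ), ‖r x‖ ^ 2 := by
  have h1 : (inner ℂ r r) = ((‖r‖ ^ 2 : ℝ) : ℂ) := by
    rw [inner_self_eq_norm_sq_to_K]; simp
  rw [MeasureTheory.L2.inner_def] at h1
  have h2 : ∀ x, inner ℂ (r x) (r x) = ((‖r x‖ ^ 2 : ℝ) : ℂ) := fun x => by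
    rw [inner_self_eq_norm_sq_to_K]; simp
  simp only [h2] at h1
  rw [integral_complex_ofReal] at h1
  exact_mod_cast h1.symm

/-- Being merely bounded on an interval of length `ε` already gains `√ε` in `L₂`, while the tail
must be small pointwise. -/
theorem norm_le_of_ae_bound {r : Lp ℂ 2 edgeMeasure} {ε c₁ c₂ : ℝ} (hε : 0 ≤ ε) (h₁ : 0 ≤ c₁)
    (h₂ : 0 ≤ c₂) (h : ∀ᵐ x ∂edgeMeasure, (x ≤ ε → ‖r x‖ ≤ c₁) ∧
      (ε < x → ‖r x‖ ≤ c₂ * Real.exp (-x / 2))) : ‖r‖ ≤ c₁ * Real.sqrt ε + c₂ := by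
  refine abs_le_of_sq_le_sq' ?_ (by positivity) |>.2
  rw [norm_sq_eq_integral]
  have i₁ : IntegrableOn ((Iic ε).indicator fun _ => c₁ ^ 2) (Ioi 0) := by
    rw [IntegrableOn, integrable_indicator_iff measurableSet_Iic, IntegrableOn,
      Measure.restrict_restrict measurableSet_Iic, Iic_inter_Ioi]
    exact integrableOn_const (by simp)
  have i₂ : IntegrableOn (fun x => c₂ ^ 2 * Real.exp (-x)) (Ioi 0) :=
    (integrableOn_exp_neg_Ioi 0).const_mul _
  calc ∫ x in Ioi (0 : ℝ), ‖r x‖ ^ 2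
      ≤ ∫ x in Ioi (0 : ℝ), ((Iic ε).indicator (fun _ => c₁ ^ 2) x + c₂ ^ 2 * Real.exp (-x)) := by
        refine integral_mono_ae (integrable_sq_norm (Lp.memLp r)) (i₁.add i₂) ?_
        filter_upwards [h] with x hx
        rcases le_or_gt x ε with hxε | hxε
        · rw [indicator_of_mem (show x ∈ Iic ε from hxε)]
          have := pow_le_pow_left₀ (norm_nonneg _) (hx.1 hxε) 2
          have : 0 ≤ c₂ ^ 2 * Real.exp (-x) := by positivity
          linarith
        · rw [indicator_of_notMem (by simpa using hxε), zero_add]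
          refine (pow_le_pow_left₀ (norm_nonneg _) (hx.2 hxε) 2).trans (le_of_eq ?_)
          rw [mul_pow, ← Real.exp_nat_mul]
          congr 2
          push_cast
          ring
    _ = c₁ ^ 2 * ε + c₂ ^ 2 := by
        rw [integral_add i₁ i₂, integral_const_mul, integral_exp_neg_Ioi_zero, mul_one,
          integral_indicator measurableSet_Iic, Measure.restrict_restrict measurableSet_Iic,
          Iic_inter_Ioi, setIntegral_const]
        simp [hε, mul_comm]
    _ ≤ (c₁ * Real.sqrt ε + c₂) ^ 2 := by
        have : Real.sqrt ε ^ 2 = ε := Real.sq_sqrt hε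
        have h3 : 0 ≤ c₁ * Real.sqrt ε * c₂ := by positivity
        nlinarith

theorem norm_apply_le (r : L2) (n : Fin 3) : ‖r n‖ ≤ ‖r‖ := PiLp.norm_apply_le r n

/-- The factor `2` is a round bound for `√3`. -/
theorem norm_le_of_forall_norm_le {r : L2} {K : ℝ} (h : ∀ n, ‖r n‖ ≤ K) : ‖r‖ ≤ 2 * K := by
  have hK : 0 ≤ K := (norm_nonneg _).trans (h 0)
  refine abs_le_of_sq_le_sq' ?_ (by positivity) |>.2
  rw [PiLp.norm_sq_eq_of_L2, Fin.sum_univ_three]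
  have := fun n => pow_le_pow_left₀ (norm_nonneg _) (h n) 2
  nlinarith [this 0, this 1, this 2]

theorem setIntegral_sq_norm_le {r : L2} {n : Fin 3} {g : ℝ → ℂ} {Λ : ℝ}
    (hg : (r n : ℝ → ℂ) =ᵐ[edgeMeasure] g) (h : ‖r‖ ≤ Λ) :
    ∫ x in Ioi (0 : ℝ), ‖g x‖ ^ 2 ≤ Λ ^ 2 := by
  calc ∫ x in Ioi (0 : ℝ), ‖g x‖ ^ 2 = ∫ x in Ioi (0 : ℝ), ‖r n x‖ ^ 2 :=
        integral_congr_ae (hg.mono fun x hx => by simp only [hx])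
    _ = ‖r n‖ ^ 2 := (norm_sq_eq_integral _).symm
    _ ≤ Λ ^ 2 := pow_le_pow_left₀ (norm_nonneg _) ((norm_apply_le r n).trans h) 2

namespace IsProfile

variable {Q : Fin 3 → ℝ → ℝ}

theorem continuousOn (hQ : IsProfile Q) (n : Fin 3) : ContinuousOn (Q n) (Ici 0) :=
  (hQ.smooth n).continuousOn

theorem eq_zero (hQ : IsProfile Q) (n : Fin 3) {x : ℝ} (hx : 1 < x) : Q n x = 0 := by
  by_contra h
  have : x ∈ Icc (0 : ℝ) 1 := hQ.supp n ▸ subset_closure ⟨by linarith, h⟩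
  linarith [this.2]

theorem exists_bound (hQ : IsProfile Q) : ∃ M, ∀ n x, 0 ≤ x → |Q n x| ≤ M := by
  have h : ∀ n, ∃ M, ∀ x ∈ Icc (0 : ℝ) 1, ‖Q n x‖ ≤ M := fun n =>
    isCompact_Icc.exists_bound_of_continuousOn ((hQ.continuousOn n).mono Icc_subset_Ici_self)
  choose M hM using h
  refine ⟨∑ n, |M n|, fun n x hx => ?_⟩
  have h1 : |M n| ≤ ∑ n, |M n| :=
    Finset.single_le_sum (f := fun n => |M n|) (fun i _ => abs_nonneg _) (Finset.mem_univ n)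
  refine le_trans ?_ h1
  rcases le_or_gt x 1 with hx1 | hx1
  · exact (hM n x ⟨hx, hx1⟩).trans (le_abs_self _)
  · rw [hQ.eq_zero n hx1, abs_zero]
    exact abs_nonneg _

theorem aestronglyMeasurable_rescaled (hQ : IsProfile Q) (α : ℝ) {ε : ℝ} (hε : 0 < ε) (n : Fin 3) :
    AEStronglyMeasurable (fun x => α * (ε ^ 2)⁻¹ * Q n (x / ε)) edgeMeasure := by
  refine ContinuousOn.aestronglyMeasurable (continuousOn_const.mul ((hQ.continuousOn n).comp
    (by fun_prop : ContinuousOn (fun x : ℝ => x / ε) (Ioi 0)) fun x hx => ?_)) measurableSet_Ioi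
  exact div_nonneg (le_of_lt hx) hε.le

theorem exists_bound_rescaled (hQ : IsProfile Q) (α : ℝ) {ε : ℝ} (hε : 0 < ε) :
    ∃ M, ∀ n x, 0 < x → |α * (ε ^ 2)⁻¹ * Q n (x / ε)| ≤ M := by
  obtain ⟨M, hM⟩ := hQ.exists_bound
  refine ⟨|α * (ε ^ 2)⁻¹| * M, fun n x hx => ?_⟩
  rw [abs_mul]
  exact mul_le_mul_of_nonneg_left (hM n _ (div_nonneg hx.le hε.le)) (abs_nonneg _)

theorem isSelfAdjoint_regularized (hQ : IsProfile Q) (α : ℝ) {ε : ℝ} (hε : 0 < ε) :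
    IsSelfAdjoint (regularized α Q ε) := by
  obtain ⟨M, hM⟩ := hQ.exists_bound_rescaled α hε
  rw [regularized, kirchhoff_eq_splitCondition]
  refine isSelfAdjoint_schrodinger (fun k hk => ?_) (hQ.aestronglyMeasurable_rescaled α hε) hM
  obtain ⟨r, rfl⟩ := Submodule.mem_span_singleton.1 hk
  exact Submodule.mem_span_singleton.2 ⟨starRingEnd ℂ r, by ext; simp⟩

theorem continuousOn_mul (hQ : IsProfile Q) (α : ℝ) (n : Fin 3) :
    ContinuousOn (fun x => α * Q n x) (Icc 0 1) :=
  continuousOn_const.mul ((hQ.continuousOn n).mono Icc_subset_Ici_self)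

/-- Quasimodes: near each element of the domain of the limit operator there is an element of the
domain of the regularized operator, with nearly the same image under the shifted operators. -/
theorem exists_quasimode (hQ : IsProfile Q) {α : ℝ} (F : ∀ n, FundamentalSystem fun x => α * Q n x)
    (ζ : ℂ) : ∃ C : ℝ, ∀ ε ∈ Ioo (0 : ℝ) 1, ∀ (Λ : ℝ) (x f : L2),
      (x, f + ζ • x) ∈ (schrodinger (fun _ _ => 0) (splitCondition (resonantValues F))).graph →
      ‖x‖ ≤ Λ → ‖f‖ ≤ Λ → ‖f + ζ • x‖ ≤ Λ →
      ∃ y g : L2, (y, g) ∈ (regularized α Q ε).graph ∧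
        ‖g - ζ • y - f‖ ≤ C * Real.sqrt ε * Λ ∧ ‖y - x‖ ≤ C * Real.sqrt ε * Λ := by
  choose M₀ hM₀ using fun n => (F n).exists_bound
  set M := ∑ n, |M₀ n| with hMdef
  have hMn : ∀ n, M₀ n ≤ M := fun n => (le_abs_self _).trans
    (Finset.single_le_sum (f := fun n => |M₀ n|) (fun i _ => abs_nonneg _) (Finset.mem_univ n))
  have hM : ∀ n, ∀ x ∈ Icc (0 : ℝ) 1, |(F n).p x| ≤ M ∧ |(F n).p' x| ≤ M ∧ |(F n).s x| ≤ M ∧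
      |(F n).s' x| ≤ M := fun n x hx => by
    obtain ⟨a, b, c, d⟩ := hM₀ n x hx
    exact ⟨a.trans (hMn n), b.trans (hMn n), c.trans (hMn n), d.trans (hMn n)⟩
  have hM0 : 0 ≤ M := Finset.sum_nonneg fun _ _ => abs_nonneg _
  obtain ⟨Γ₀, hΓ₀, hweyl⟩ := exists_bounded_weyl F
  set Γ := Γ₀ * 12 with hΓ
  have hΓ0 : 0 ≤ Γ := by positivity
  set c₁ := (24 + Γ + 2 * M) * M + 25 with hc₁
  set c₂ := 42 * (M + Γ + 13) with hc₂
  have hc₁0 : 0 ≤ c₁ := by positivity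
  have hc₂0 : 0 ≤ c₂ := by positivity
  refine ⟨2 * ((1 + ‖ζ‖) * (c₁ + c₂)), fun ε hε Λ x f hx hxΛ hfΛ hgΛ => ?_⟩
  obtain ⟨hε0, hε1⟩ := hε
  have hΛ : 0 ≤ Λ := (norm_nonneg _).trans hxΛ
  rw [mem_schrodinger_graph] at hx
  obtain ⟨u, v, w, hW, hB, h1, h2⟩ := hx
  obtain ⟨hBa, hBb⟩ := mem_splitCondition.1 hB
  have h1' : ∀ n, (x n : ℝ → ℂ) =ᵐ[edgeMeasure] u n := h1
  have h2' : ∀ n, ((f + ζ • x) n : ℝ → ℂ) =ᵐ[edgeMeasure] fun t => -w n t := fun n => by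
    filter_upwards [h2 n] with t ht
    simpa using ht
  have huΛ := fun n => setIntegral_sq_norm_le (h1' n) hxΛ
  have hwΛ : ∀ n, ∫ t in Ioi (0 : ℝ), ‖w n t‖ ^ 2 ≤ Λ ^ 2 := fun n => by
    have := setIntegral_sq_norm_le (h2' n) hgΛ
    simpa using this
  have hfΛ' := fun n => setIntegral_sq_norm_le (r := f) (n := n) (EventuallyEq.refl _ _) hfΛ
  -- The derivatives of `u` annihilate `resonantValues F`, so they occur in the Weyl relation; `c`
  -- is the first-order correction of the values at distance `ε`.
  obtain ⟨c, hcw, hcn⟩ := hweyl (fun n => v n 0) hBb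
  have hcΛ : ∀ n, ‖c n‖ ≤ Γ * Λ := fun n => by
    refine (norm_le_pi_norm c n).trans (hcn.trans ?_)
    have : ‖fun n => v n 0‖ ≤ 12 * Λ := (pi_norm_le_iff_of_nonneg (by positivity)).2 fun n =>
      ((hW n).norm_zero_le hΛ (huΛ n) (hwΛ n)).2
    rw [hΓ, mul_assoc]
    gcongr
  choose Y Y' Y'' hY hY0 hY'0 hin hout using fun n =>
    (F n).exists_edge_quasimode (hQ.continuousOn_mul α n) (hM n) hε0 hε1 (Lp.memLp (f n)) hΛ
      (hfΛ' n) (hW n) (huΛ n) (hwΛ n) hΓ0 (hcΛ n)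
  set V : Fin 3 → ℝ → ℝ := fun n t => α * (ε ^ 2)⁻¹ * Q n (t / ε) with hV
  have hVin : ∀ n t, V n t = (ε ^ 2)⁻¹ * (α * Q n (t / ε)) := fun n t => by
    simp only [hV]; ring
  have hVout : ∀ n t, ε < t → V n t = 0 := fun n t ht => by
    simp only [hV]
    rw [hQ.eq_zero n ((one_lt_div hε0).2 ht), mul_zero]
  obtain ⟨D, hD⟩ := hQ.exists_bound_rescaled α hε0
  have hG : ∀ n, MemLp (fun t => -Y'' n t + (V n t : ℂ) * Y n t) 2 edgeMeasure := fun n =>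
    (hY n).memLp_deriv2.neg.add
      (memLp_ofReal_mul (hQ.aestronglyMeasurable_rescaled α hε0 n) (hD n) (hY n).memLp)
  set y : L2 := WithLp.toLp 2 fun n => (hY n).memLp.toLp _ with hy
  set g : L2 := WithLp.toLp 2 fun n => (hG n).toLp _ with hg
  have hyn : ∀ n, (y n : ℝ → ℂ) =ᵐ[edgeMeasure] Y n := fun n => (hY n).memLp.coeFn_toLp
  have hgn : ∀ n, (g n : ℝ → ℂ) =ᵐ[edgeMeasure] fun t => -Y'' n t + (V n t : ℂ) * Y n t :=
    fun n => (hG n).coeFn_toLp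
  have hkir : ((fun n => Y n 0, fun n => Y' n 0) : (Fin 3 → ℂ) × (Fin 3 → ℂ)) ∈ kirchhoff := by
    -- The data `(u 0, 0) + ε (c, v 0)` are in the Weyl relation, which is exactly Kirchhoff for
    -- `Y`. The derivatives appear multiplied by `ε`, which is divided out below.
    have hw := (mem_weyl F).1 ((weyl F).add_mem hBa ((weyl F).smul_mem (ε : ℂ) hcw))
    simp only [LinearMap.coe_inl, Prod.fst_add, Prod.snd_add, Prod.smul_fst, Prod.smul_snd,
      Pi.add_apply, Pi.smul_apply, smul_eq_mul, Pi.zero_apply, zero_add] at hw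
    rw [mem_kirchhoff]
    refine ⟨fun m n => ?_, ?_⟩
    · simp only [hY0]
      exact hw.1 m n
    · have hεc : (ε : ℂ) ≠ 0 := by exact_mod_cast hε0.ne'
      refine mul_left_cancel₀ hεc ?_
      rw [Finset.mul_sum, mul_zero]
      simp only [hY'0]
      exact hw.2
  have hs0 := Real.sqrt_nonneg ε
  have hfin : ∀ {A B : ℝ}, A ≤ (1 + ‖ζ‖) * c₁ → B ≤ (1 + ‖ζ‖) * c₂ →
      A * Λ * Real.sqrt ε + B * (Real.sqrt ε * Λ) ≤ (1 + ‖ζ‖) * (c₁ + c₂) * (Real.sqrt ε * Λ) := by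
    intro A B hA hB
    have : 0 ≤ Real.sqrt ε * Λ := by positivity
    nlinarith
  refine ⟨y, g, ?_, ?_, ?_⟩
  · rw [regularized, mem_schrodinger_graph]
    exact ⟨Y, Y', Y'', hY, hkir, hyn, hgn⟩
  · have key : ∀ n, ‖(g - ζ • y - f) n‖ ≤ (1 + ‖ζ‖) * (c₁ + c₂) * (Real.sqrt ε * Λ) := by
      intro n
      have hr : ((g - ζ • y - f) n : ℝ → ℂ) =ᵐ[edgeMeasure]
          fun t => (-Y'' n t + (V n t : ℂ) * Y n t) - ζ * Y n t - f n t := by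
        have e : (g - ζ • y - f) n = g n - ζ • y n - f n := rfl
        rw [e]
        filter_upwards [Lp.coeFn_sub (g n - ζ • y n) (f n), Lp.coeFn_sub (g n) (ζ • y n),
          Lp.coeFn_smul ζ (y n), hyn n, hgn n] with t e1 e2 e3 e4 e5
        rw [e1, Pi.sub_apply, e2, Pi.sub_apply, e3, Pi.smul_apply, e4, e5, smul_eq_mul]
      refine (norm_le_of_ae_bound (c₁ := ‖ζ‖ * c₁ * Λ)
        (c₂ := (1 + ‖ζ‖) * c₂ * (Real.sqrt ε * Λ)) hε0.le (by positivity) (by positivity)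
        ?_).trans (hfin (by nlinarith [norm_nonneg ζ]) le_rfl)
      filter_upwards [hr, h1' n, h2' n, ae_restrict_mem measurableSet_Ioi,
        Lp.coeFn_add (f n) ((ζ • x) n), Lp.coeFn_smul ζ (x n)] with t e1 e2 e3 ht e4 e5
      have ef : f n t + ζ * u n t = -w n t := by
        have e6 : (f + ζ • x) n = f n + ζ • x n := rfl
        rw [e6] at e3
        have e7 : (f n + ζ • x n : Lp ℂ 2 edgeMeasure) t = f n t + (ζ • x n : Lp ℂ 2 edgeMeasure) t :=
          e4
        rw [e7, e5, Pi.smul_apply, e2, smul_eq_mul] at e3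
        exact e3
      rw [e1]
      refine ⟨fun htε => ?_, fun htε => ?_⟩
      -- On `(0, ε]` the singular equation with source `f` is solved exactly, so the residual is `-ζ
      -- Y`.
      · obtain ⟨a1, a2, -⟩ := hin n t ht htε
        rw [← hVin] at a1
        rw [a1, sub_right_comm, sub_self, zero_sub, norm_neg, norm_mul, mul_assoc]
        refine mul_le_mul_of_nonneg_left (a2.trans ?_) (norm_nonneg _)
        gcongr
        linarith
      · obtain ⟨a1, a2⟩ := hout n t htε
        -- Beyond `ε` the potential vanishes and `u` solves the limit equation, so only the
        -- corrector contributes.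
        have e8 : -Y'' n t + (V n t : ℂ) * Y n t - ζ * Y n t - f n t
            = -(Y'' n t - w n t) - ζ * (Y n t - u n t) := by
          rw [hVout n t htε, Complex.ofReal_zero, zero_mul]
          linear_combination -ef
        rw [e8]
        refine (norm_sub_le _ _).trans ?_
        rw [norm_neg, norm_mul]
        calc _ ≤ _ + ‖ζ‖ * _ := add_le_add a2 (mul_le_mul_of_nonneg_left a1 (norm_nonneg _))
          _ = _ := by rw [hc₂]; ring
    refine (norm_le_of_forall_norm_le key).trans (le_of_eq (by ring))
  · have key : ∀ n, ‖(y - x) n‖ ≤ (1 + ‖ζ‖) * (c₁ + c₂) * (Real.sqrt ε * Λ) := by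
      intro n
      have hr : ((y - x) n : ℝ → ℂ) =ᵐ[edgeMeasure] fun t => Y n t - u n t := by
        have e : (y - x) n = y n - x n := rfl
        rw [e]
        filter_upwards [Lp.coeFn_sub (y n) (x n), hyn n, h1' n] with t e1 e2 e3
        rw [e1, Pi.sub_apply, e2, e3]
      have hz := norm_nonneg ζ
      refine (norm_le_of_ae_bound (c₁ := c₁ * Λ) (c₂ := c₂ * (Real.sqrt ε * Λ)) hε0.le
        (by positivity) (by positivity) ?_).trans (hfin (by nlinarith) (by nlinarith))
      filter_upwards [hr, ae_restrict_mem measurableSet_Ioi] with t e1 ht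
      rw [e1]
      refine ⟨fun htε => ?_, fun htε => ?_⟩
      · obtain ⟨-, a2, a3⟩ := hin n t ht htε
        exact (norm_sub_le _ _).trans ((add_le_add a2 a3).trans (le_of_eq (by rw [hc₁]; ring)))
      · refine (hout n t htε).1.trans (le_of_eq (by rw [hc₂]; ring))
    refine (norm_le_of_forall_norm_le key).trans (le_of_eq (by ring))

end IsProfile

end StarGraph

/-! ### Norm resolvent convergence. -/

open StarGraph

theorem theorem1 (α : ℝ) (Q : Fin 3 → ℝ → ℝ) (hQ : StarGraph.IsProfile Q) :
    (∃! H : StarGraph.L2 →ₗ.[ℂ] StarGraph.L2, StarGraph.IsLimitOperator α Q H) ∧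
    ∀ H : StarGraph.L2 →ₗ.[ℂ] StarGraph.L2, StarGraph.IsLimitOperator α Q H →
      StarGraph.NormResolventTendsto (StarGraph.regularized α Q) (𝓝[>] 0) H ∧
      ∀ ζ : ℂ, ζ.im ≠ 0 → ∃ (C : ℝ) (R₀ : StarGraph.L2 →L[ℂ] StarGraph.L2),
        StarGraph.IsResolvent H ζ R₀ ∧
        ∀ ε ∈ Ioo (0 : ℝ) 1, ∃ R : StarGraph.L2 →L[ℂ] StarGraph.L2,
          StarGraph.IsResolvent (StarGraph.regularized α Q ε) ζ R ∧
          ‖R - R₀‖ ≤ C * ε ^ (1 / 2 : ℝ) := by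
  have hF : ∀ n, Nonempty (FundamentalSystem fun x => α * Q n x) := fun n =>
    FundamentalSystem.nonempty (hQ.continuousOn_mul α n)
  let F : ∀ n, FundamentalSystem fun x => α * Q n x := fun n => (hF n).some
  refine ⟨existsUnique_isLimitOperator F, fun H hH => ?_⟩
  have hsa : IsSelfAdjoint H := by
    rw [hH.eq_schrodinger F]
    exact isSelfAdjoint_free (conjStable_resonantValues F)
  have main : ∀ ζ : ℂ, ζ.im ≠ 0 → ∃ (C : ℝ) (R₀ : L2 →L[ℂ] L2), IsResolvent H ζ R₀ ∧
      ∀ ε ∈ Ioo (0 : ℝ) 1, ∃ R : L2 →L[ℂ] L2, IsResolvent (regularized α Q ε) ζ R ∧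
        ‖R - R₀‖ ≤ C * ε ^ (1 / 2 : ℝ) := by
    intro ζ hζ
    obtain ⟨C, hC⟩ := hQ.exists_quasimode F ζ
    obtain ⟨R₀, hR₀, hb₀⟩ := exists_isResolvent hsa hζ
    set κ := |ζ.im|⁻¹ with hκ
    have hκ0 : 0 ≤ κ := by positivity
    -- One constant that dominates `f`, `R₀ f` and `f + ζ R₀ f` relative to `‖f‖`.
    set D := 1 + (1 + ‖ζ‖) * κ with hD
    refine ⟨(1 + κ) * (|C| * D), R₀, hR₀, fun ε hε => ?_⟩
    obtain ⟨R, hR, hb⟩ := exists_isResolvent (hQ.isSelfAdjoint_regularized α hε.1) hζ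
    refine ⟨R, hR, ContinuousLinearMap.opNorm_le_bound _ (by
      have := Real.rpow_nonneg hε.1.le (1 / 2 : ℝ); positivity) fun f => ?_⟩
    have hz := norm_nonneg ζ
    have hf := norm_nonneg f
    have hζκ : 0 ≤ ‖ζ‖ * κ := by positivity
    have hx : ‖R₀ f‖ ≤ D * ‖f‖ := (hb₀ f).trans (by
      gcongr
      rw [hD]
      linarith)
    have hf' : ‖f‖ ≤ D * ‖f‖ := by
      have : 1 ≤ D := by rw [hD]; linarith
      nlinarith
    have hg : ‖f + ζ • R₀ f‖ ≤ D * ‖f‖ := by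
      refine (norm_add_le _ _).trans ?_
      rw [norm_smul]
      have := mul_le_mul_of_nonneg_left (hb₀ f) hz
      have : 0 ≤ κ * ‖f‖ := by positivity
      rw [hD]
      linarith
    have hmem : (R₀ f, f + ζ • R₀ f) ∈
        (schrodinger (fun _ _ => 0) (splitCondition (resonantValues F))).graph := by
      rw [← hH.eq_schrodinger F, LinearPMap.mem_graph_iff]
      obtain ⟨u, hu1, hu2⟩ := hR₀.1 f
      refine ⟨u, hu1, ?_⟩
      rw [← hu1, ← hu2]
      simp
    obtain ⟨y, g, hyg, e1, e2⟩ := hC ε hε (D * ‖f‖) (R₀ f) f hmem hx hf' hg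
    have hRy : R (g - ζ • y) = y := by
      rw [LinearPMap.mem_graph_iff] at hyg
      obtain ⟨u, hu1, hu2⟩ := hyg
      have := hR.2 u
      rw [hu1, hu2] at this
      exact this
    -- Since `R` maps `g - ζ y` back to `y`, the resolvent difference is the quasimode error minus
    -- `R` of the residual, and `‖R‖ ≤ κ` uniformly in `ε`.
    have hdiff : (R - R₀) f = (y - R₀ f) - R (g - ζ • y - f) := by
      rw [map_sub, hRy, _root_.sub_apply]
      abel
    have hCs : C * Real.sqrt ε * (D * ‖f‖) ≤ |C| * Real.sqrt ε * (D * ‖f‖) := by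
      have : 0 ≤ D * ‖f‖ := hf.trans hf'
      gcongr
      exact le_abs_self C
    rw [hdiff, ← Real.sqrt_eq_rpow]
    refine (norm_sub_le _ _).trans ?_
    have e3 := hb (g - ζ • y - f)
    have e4 := mul_le_mul_of_nonneg_left (e1.trans hCs) hκ0
    have e5 := e2.trans hCs
    calc _ ≤ |C| * Real.sqrt ε * (D * ‖f‖) + κ * (|C| * Real.sqrt ε * (D * ‖f‖)) :=
          add_le_add e5 (e3.trans e4)
      _ = _ := by ring
  refine ⟨⟨?_, hsa, fun ζ hζ => ?_⟩, main⟩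
  · filter_upwards [self_mem_nhdsWithin] with ε hε
    exact hQ.isSelfAdjoint_regularized α hε
  · classical
    obtain ⟨C, R₀, hR₀, h⟩ := main ζ hζ
    choose! R hR hRC using h
    have hev : ∀ᶠ ε : ℝ in 𝓝[>] 0, ε ∈ Ioo (0 : ℝ) 1 := Ioo_mem_nhdsGT zero_lt_one
    refine ⟨R, R₀, hev.mono hR, hR₀, tendsto_iff_norm_sub_tendsto_zero.2 ?_⟩
    refine squeeze_zero' (Eventually.of_forall fun ε => norm_nonneg _) (hev.mono hRC) ?_
    have : Tendsto (fun ε : ℝ => C * ε ^ (1 / 2 : ℝ)) (𝓝 0) (𝓝 (C * (0 : ℝ) ^ (1 / 2 : ℝ))) :=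
      ((Real.continuous_rpow_const (by norm_num)).tendsto 0).const_mul C
    rw [Real.zero_rpow (by norm_num), mul_zero] at this
    exact this.mono_left nhdsWithin_le_nhds
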